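/- For a finite graph $G$ with adjacency matrix $A$ over $\mathbb F_2$, let the solvability $s(G)$ be the number of pairs $(a,b)\in\mathbb F_2^{V(G)}\times\mathbb F_2^{V(G)}$ for which there is an $x\in\mathbb F_2^{V(G)}$ with $(A+\operatorname{diag}(a))x=b$. Write $[T_1,\dots,T_k]$ for the rooted tree whose root has the roots of $T_1,\dots,T_k$ as its neighbours, with $T_1,\dots,T_k$ as the components left when the root is removed, and $[d]$ for the rooted star consisting of a root and $d-1$ leaves attached to it. Let $D$ be the degree sequence of a finite tree, in non-increasing order, and let $d_1\ge d_2\ge\dots\ge d_t$ be its entries that are at least $2$. The $\mathcal M$-tree $\mathcal M(D)=\mathcal M(d_1,\dots,d_t)$, with labels $v_1,v_2,\dots$ on some of its vertices, is defined recursively as follows. * If $t=0$, then $\mathcal M(D)$ is the only tree with degree sequence $D$ (a single vertex or a single edge). * If $1\le t\le d_t+1$, then $\mathcal M(d_1,\dots,d_t)=[[d_{t-1}],[d_{t-2}],\dots,[d_1],[1],\dots,[1]]$ with $d_t$ branches in total; $v_1$ is the root and $v_2,\dots,v_t$ are the roots of $[d_{t-1}],\dots,[d_1]$, in this order. * If $t\ge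 d_t+2$, take $\mathcal M(d_{d_t},d_{d_t+1},\dots,d_{t-1})$ with labels $v_1,\dots,v_\ell$, and let $s$ be the smallest index such that $v_s$ is adjacent to a leaf in it. Then $\mathcal M(d_1,\dots,d_t)$ is obtained by merging the root of $[[d_{d_t-1}],[d_{d_t-2}],\dots,[d_1]]$ with a leaf adjacent to $v_s$. The old labels are kept, and the roots of $[d_{d_t-1}],\dots,[d_1]$ are labelled $v_{\ell+1},\dots,v_{\ell+d_t-1}$, in this order; the merged vertex gets no label. **Theorem.** Let $D$ be the degree sequence of a finite tree. Then $\mathcal M(D)$ is a tree with degree sequence $D$, and $s(\mathcal M(D))\le s(T)$ for every tree $T$ with degree sequence $D$. -/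

import Mathlib

open Classical in
/-- The solvability of a finite graph `G`: the number of pairs `(a, b)` of vectors over the field
with two elements such that `(A + diag(a)) x = b` has a solution `x`, where `A` is the adjacency
matrix of `G`. -/
noncomputable def solvability {V : Type*} [Fintype V] (G : SimpleGraph V) : ℕ :=
  Nat.card {p : (V → ZMod 2) × (V → ZMod 2) //
    ∃ x : V → ZMod 2, Matrix.mulVec (G.adjMatrix (ZMod 2) + Matrix.diagonal p.1) x = p.2}

open Classical in
/-- The degree sequence of a finite graph: the degrees of all vertices (with multiplicity), in
non-increasing order. -/
noncomputable def degreeSequence {V : Type*} [Fintype V] (G : SimpleGraph V) : List ℕ :=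
  ((Finset.univ : Finset V).val.map fun v => G.degree v).sort (fun a b => b ≤ a)

/-- `D` is the degree sequence of some finite tree. -/
def IsTreeDegreeSequence (D : List ℕ) : Prop :=
  ∃ (n : ℕ) (T : SimpleGraph (Fin n)), T.IsTree ∧ degreeSequence T = D

/-- A leaf is a vertex with exactly one neighbour. -/
def IsLeaf {V : Type*} (G : SimpleGraph V) (w : V) : Prop := ∃! u, G.Adj w u

/-- A finite graph together with a list of labelled vertices: the `i`-th entry of `labels`
(counted from `0`) is the vertex labelled `v_{i+1}`. -/
structure LabelledGraph where
  V : Type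
  [fintypeV : Fintype V]
  graph : SimpleGraph V
  labels : List V

attribute [instance] LabelledGraph.fintypeV

namespace LabelledGraph

/-- The graph with one vertex, which is labelled `v_1`. -/
def point : LabelledGraph where
  V := Unit
  graph := ⊥
  labels := [()]

/-- The vertices that are added when the root of `[[e_1], …, [e_k]]` is merged with a vertex of an
existing graph: for each `i`, the root `none` of the star `[e_i]` and its `e_i - 1` leaves
`some j`. -/
abbrev StarVertices (es : List ℕ) : Type := Σ i : Fin es.length, Option (Fin (es.get i - 1))

/-- The edges (each in one direction) of the graph obtained from `M` by merging the root of
`[[e_1], …, [e_k]]` with the vertex `w`: the edges of `M`, an edge from `w` to the root of each star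
`[e_i]`, and an edge from the root of each star to each leaf of the same star. -/
def graftRel (M : LabelledGraph) (w : M.V) (es : List ℕ) :
    M.V ⊕ StarVertices es → M.V ⊕ StarVertices es → Prop
  | .inl a, .inl b => M.graph.Adj a b
  | .inl a, .inr ⟨_, none⟩ => a = w
  | .inr ⟨i, none⟩, .inr ⟨j, some _⟩ => i = j
  | _, _ => False

/-- Merge the root of `[[e_1], …, [e_k]]` with the vertex `w` of `M`, where `[e]` is the rooted star
with `e` vertices, a root and `e - 1` leaves. The old labels are kept, and the roots of those stars
that have at least two vertices receive the next labels, in the order of the list. -/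
def graft (M : LabelledGraph) (w : M.V) (es : List ℕ) : LabelledGraph where
  V := M.V ⊕ StarVertices es
  graph := SimpleGraph.fromRel (M.graftRel w es)
  labels := M.labels.map Sum.inl ++
    ((List.finRange es.length).filter fun i => 2 ≤ es.get i).map fun i => Sum.inr ⟨i, none⟩

/-- `w` is a leaf adjacent to `v_s`, where `s` is the smallest index for which `v_s` is adjacent to
a leaf. -/
def IsSlot (M : LabelledGraph) (w : M.V) : Prop :=
  IsLeaf M.graph w ∧ ∃ s : Fin M.labels.length, M.graph.Adj (M.labels.get s) w ∧
    ∀ r < s, ∀ u, M.graph.Adj (M.labels.get r) u → ¬ IsLeaf M.graph u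

open Classical in
/-- Merge the root of `[[e_1], …, [e_k]]` with a leaf adjacent to `v_s`, where `s` is the smallest
index for which `v_s` is adjacent to a leaf. (The second branch is a default value: such a leaf
always exists in the construction below.) -/
noncomputable def graftAtSlot (M : LabelledGraph) (es : List ℕ) : LabelledGraph :=
  if h : ∃ w, M.IsSlot w then M.graft h.choose es else M

end LabelledGraph

/-- The `M`-tree, with its labelling, of the reduced degree sequence `(d_1, …, d_t)`, which is given
here in the reverse order `d_t ≤ d_{t-1} ≤ … ≤ d_1`. So the head of the list is `d = d_t`, and its
tail is `es = [d_{t-1}, …, d_1]`.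

If `t ≤ d_t + 1`, it is `[[d_{t-1}], …, [d_1], [1], …, [1]]` with `d_t` branches; the root is
labelled `v_1` and the root of `[d_i]` is labelled `v_{t-i+1}`.

If `t ≥ d_t + 2`, it is obtained from the `M`-tree of `(d_{d_t}, …, d_{t-1})` by merging the root of
`[[d_{d_t - 1}], …, [d_1]]` with a leaf adjacent to `v_s`, where `s` is the smallest index for which
`v_s` is adjacent to a leaf; the roots of `[d_{d_t - 1}], …, [d_1]` get the next labels, in this
order.

The empty list gives a single vertex by convention. -/
noncomputable def mTreeReduced : List ℕ → LabelledGraph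
  | [] => LabelledGraph.point
  | d :: es =>
    if es.length ≤ d then
      LabelledGraph.point.graft () (es ++ List.replicate (d - es.length) 1)
    else
      (mTreeReduced (es.take (es.length - (d - 1)))).graftAtSlot (es.drop (es.length - (d - 1)))
  termination_by ds => ds.length
  decreasing_by
    simp only [List.length_take, List.length_cons]
    omega

/-- The `M`-tree of the degree sequence `D` of a tree, given in non-increasing order. The reduced
degree sequence consists of the entries of `D` that are at least `2`. If there are none, so that
`D = (0)` or `D = (1, 1)`, then the only tree with degree sequence `D`, a star with `D.length`
vertices, is taken. -/
noncomputable def mTree (D : List ℕ) : LabelledGraph :=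
  if D.filter (fun d => 2 ≤ d) = [] then
    LabelledGraph.point.graft () (List.replicate (D.length - 1) 1)
  else mTreeReduced (D.filter fun d => 2 ≤ d).reverse

/-! Root the tree and eliminate variables from the leaves upwards. The equations below a vertex
leave, as the relation between its variable and the sum of its children's variables, an affine line
in the plane over the two-element field, or nothing. For the forest below a vertex it therefore
suffices to count the choices of `(a, b)` that are solvable for one given value of the parent's
variable (say `τ` of them, whichever value is given) and those solvable for both values (`σ`).
Siblings multiply, a vertex turns `(τ, σ)` into `(8τ - 5σ, 8τ - 6σ)`, and `s(T) = 8τ - 5σ` at the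
root (`LF.Rep.solvability`). A leaf gives `(3, 2)`, or `(1, 2/3)` after division by 3. Trees with
the same degree sequence have equally many leaves, so the normalised weights `Fo.rv` may be compared
instead. They make sense for leaves `(1, x)` with arbitrary values `0 < x < 1`.

Contraction: an inner vertex all of whose neighbours but one are leaves, with product of values `p`,
can be replaced by one leaf of value `(8 - 6p) / (8 - 5p)` at the cost of the factor `8 - 5p`. This
removes an inner vertex and drives an induction over weighted trees.

Exchange (`Fo.exchange`): let the branches at the two ends of a path have quotients `P = σ / τ`
equal to `l` and `r`. If these branches are redistributed, the weight changes only through a term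
`-(u r + v l)` with `u, v ≥ 0`, up to a positive factor, while the product `l r` is fixed. Driving
the two quotients apart, and reversing the path if necessary, does not increase the weight. Hence
the smallest leaves can be collected at a vertex of largest degree, and the largest leaves at a
vertex of smallest degree, provided that these leaves are extreme among all branches and not only
among the leaves (`Fo.gather`, `Fo.merge`). The invariant `Fo.Cond` guarantees this: the leaves
split into small ones and large ones, with all branch values in between. As the map from `p` to `(8
- 6p) / (8 - 5p)` is decreasing, contracting smallest leaves yields a new large leaf and contracting
largest leaves a new small one, and `Fo.Cond` survives (`Fo.small_move`, `Fo.large_move`).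

The recursion of the M-tree is this greedy procedure. Let `d` be the smallest degree. The `d - 1`
largest degrees take the smallest leaves; the `d - 1` large leaves that arise go to a vertex of
degree `d`; its contraction is the largest of the remaining leaves. In the smaller M-tree this leaf
belongs at the first labelled vertex that has a leaf, since labels list the vertices by decreasing
values of their leaves. The induction statement `LF.Opt` thus asserts optimality for all leaf values
sorted along the labels; the theorem is the case of the constant value `2/3`. -/

/-! ### Weighted rooted forests and moving the root -/

/-- Rooted forests, given by first child and next sibling, whose leaves carry a mark and a value. -/
inductive Fo where
  | nil : Fo
  | leaf (m : Bool) (x : ℝ) (f : Fo) : Fo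
  | node (c f : Fo) : Fo

namespace Fo

/-- Concatenation of forests. -/
def append : Fo → Fo → Fo
  | nil, g => g
  | leaf m x f, g => leaf m x (append f g)
  | node c f, g => node c (append f g)

/-- The number of components. -/
def k : Fo → ℕ
  | nil => 0
  | leaf _ _ f => k f + 1
  | node _ f => k f + 1

/-- The degrees of the inner nodes, all of which have a parent. -/
def dg : Fo → Multiset ℕ
  | nil => 0
  | leaf _ _ f => dg f
  | node c f => (k c + 1) ::ₘ (dg c + dg f)

/-- The values of the marked leaves. -/
def mv : Fo → Multiset ℝ
  | nil => 0
  | leaf m x f => (if m then {x} else 0) + mv f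
  | node c f => mv c + mv f

/-- The values of the unmarked leaves. -/
def lv : Fo → Multiset ℝ
  | nil => 0
  | leaf m x f => (if m then 0 else {x}) + lv f
  | node c f => lv c + lv f

/-- The pair of weights of a forest. -/
noncomputable def wt : Fo → ℝ × ℝ
  | nil => (1, 1)
  | leaf _ x f => ((wt f).1, x * (wt f).2)
  | node c f => ((8 * (wt c).1 - 5 * (wt c).2) * (wt f).1, (8 * (wt c).1 - 6 * (wt c).2) * (wt f).2)

/-- The first weight of a forest. -/
noncomputable def ta (f : Fo) : ℝ := (wt f).1

/-- The second weight of a forest. -/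
noncomputable def si (f : Fo) : ℝ := (wt f).2

/-- The number of components that are marked leaves. -/
def mt : Fo → ℕ
  | nil => 0
  | leaf m _ f => (if m then 1 else 0) + mt f
  | node _ f => mt f

/-- The weight of the tree whose root has the components of the forest as its branches. -/
noncomputable def rv (f : Fo) : ℝ := 8 * ta f - 5 * si f

/-- The values of all leaves. -/
def al (f : Fo) : Multiset ℝ := mv f + lv f

@[simp] lemma ta_nil : ta nil = 1 := rfl

@[simp] lemma si_nil : si nil = 1 := rfl

@[simp] lemma ta_leaf (m x f) : ta (leaf m x f) = ta f := rfl

@[simp] lemma si_leaf (m x f) : si (leaf m x f) = x * si f := rfl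

@[simp] lemma ta_node (c f) : ta (node c f) = (8 * ta c - 5 * si c) * ta f := rfl

@[simp] lemma si_node (c f) : si (node c f) = (8 * ta c - 6 * si c) * si f := rfl

@[simp] lemma k_append (f g : Fo) : k (f.append g) = k f + k g := by
  induction f <;> simp_all [append, k] <;> omega

@[simp] lemma dg_append (f g : Fo) : dg (f.append g) = dg f + dg g := by
  induction f <;> simp_all [append, dg, add_assoc]

@[simp] lemma mv_append (f g : Fo) : mv (f.append g) = mv f + mv g := by
  induction f <;> simp_all [append, mv, add_assoc]

@[simp] lemma lv_append (f g : Fo) : lv (f.append g) = lv f + lv g := by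
  induction f <;> simp_all [append, lv, add_assoc]

@[simp] lemma mt_append (f g : Fo) : mt (f.append g) = mt f + mt g := by
  induction f <;> simp_all [append, mt, add_assoc]

@[simp] lemma ta_append (f g : Fo) : ta (f.append g) = ta f * ta g := by
  induction f <;> simp_all [append, mul_assoc]

@[simp] lemma si_append (f g : Fo) : si (f.append g) = si f * si g := by
  induction f <;> simp_all [append, mul_assoc]

@[simp] lemma al_append (f g : Fo) : al (f.append g) = al f + al g := by
  simp only [al, mv_append, lv_append]; abel

/-- Two forests agree in all the quantities that matter. -/
structure Equ (f g : Fo) : Prop where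
  k : k f = k g
  dg : dg f = dg g
  mv : mv f = mv g
  lv : lv f = lv g
  mt : mt f = mt g
  ta : ta f = ta g
  si : si f = si g

lemma Equ.refl (f : Fo) : Equ f f := ⟨rfl, rfl, rfl, rfl, rfl, rfl, rfl⟩

lemma Equ.symm {f g : Fo} (h : Equ f g) : Equ g f :=
  ⟨h.1.symm, h.2.symm, h.3.symm, h.4.symm, h.5.symm, h.6.symm, h.7.symm⟩

lemma Equ.trans {f g h : Fo} (a : Equ f g) (b : Equ g h) : Equ f h :=
  ⟨a.1.trans b.1, a.2.trans b.2, a.3.trans b.3, a.4.trans b.4, a.5.trans b.5, a.6.trans b.6,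
    a.7.trans b.7⟩

lemma Equ.al {f g : Fo} (h : Equ f g) : al f = al g := by simp [Fo.al, h.mv, h.lv]

lemma Equ.rv {f g : Fo} (h : Equ f g) : rv f = rv g := by simp [Fo.rv, h.ta, h.si]

lemma Equ.node {c c' : Fo} (h : Equ c c') (f : Fo) : Equ (node c f) (node c' f) := by
  constructor <;> simp [Fo.k, Fo.dg, Fo.mv, Fo.lv, Fo.mt, h.k, h.dg, h.mv, h.lv, h.ta, h.si]

lemma Equ.append {a a' b b' : Fo} (h : Equ a a') (h' : Equ b b') :
    Equ (a.append b) (a'.append b') := by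
  constructor <;> simp [h.k, h.dg, h.mv, h.lv, h.ta, h.si, h.mt, h'.k, h'.dg, h'.mv, h'.lv, h'.ta,
    h'.si, h'.mt]

lemma Equ.append_comm (a b : Fo) : Equ (a.append b) (b.append a) := by
  constructor <;> simp <;> first | omega | abel | ring

lemma Equ.append_assoc (a b c : Fo) : Equ ((a.append b).append c) (a.append (b.append c)) := by
  constructor <;> simp <;> first | omega | abel | ring

lemma Equ.append_right_comm (a b c : Fo) :
    Equ ((a.append b).append c) ((a.append c).append b) := by
  constructor <;> simp <;> first | omega | abel | ring

/-- Two rooted trees agree in all the quantities that do not depend on the root. -/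
structure TEqu (f g : Fo) : Prop where
  dg : k f ::ₘ dg f = k g ::ₘ dg g
  mv : mv f = mv g
  lv : lv f = lv g
  rv : rv f = rv g

lemma TEqu.trans {f g h : Fo} (a : TEqu f g) (b : TEqu g h) : TEqu f h :=
  ⟨a.1.trans b.1, a.2.trans b.2, a.3.trans b.3, a.4.trans b.4⟩

lemma Equ.tEqu {f g : Fo} (h : Equ f g) : TEqu f g :=
  ⟨by rw [h.k, h.dg], h.mv, h.lv, h.rv⟩

/-- Moving the root along an edge. -/
lemma TEqu.flip (L X : Fo) : TEqu (L.append (node X nil)) (X.append (node L nil)) := by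
  constructor
  · simp only [k_append, dg_append, Fo.k, Fo.dg, zero_add, add_zero, Multiset.add_cons]
    rw [Multiset.cons_swap, add_comm (Fo.dg L)]
  · simp [Fo.mv, add_comm]
  · simp [Fo.lv, add_comm]
  · simp [Fo.rv]; ring

/-- The branch obtained from a path by attaching the given forests to its inner vertices and `R`
to its last vertex. -/
def spine : List Fo → Fo → Fo
  | [], R => node R nil
  | M :: C, R => node (M.append (spine C R)) nil

/-- The branch obtained from a path as in `spine`, seen from the other end. -/
def up : List Fo → Fo → Fo
  | [], L => node L nil
  | M :: C, L => up C (M.append (node L nil))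

lemma up_simple (C : List Fo) (L : Fo) : k (up C L) = 1 ∧ mt (up C L) = 0 := by
  induction C generalizing L with
  | nil => simp [up, k, mt]
  | cons M C ih => exact ih _

lemma spine_simple (C : List Fo) (L : Fo) : k (spine C L) = 1 ∧ mt (spine C L) = 0 := by
  cases C <;> simp [spine, k, mt]

/-- The root travels along the path one edge at a time, by `TEqu.flip`. -/
lemma reroot (C : List Fo) (L R : Fo) :
    TEqu (L.append (spine C R)) (R.append (up C L)) := by
  induction C generalizing L with
  | nil => exact TEqu.flip _ _
  | cons M C ih =>
    exact (TEqu.flip _ _).trans ((Equ.append_right_comm _ _ _).tEqu.trans (ih _))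

/-- The part of the spine that does not depend on the last forest. -/
lemma spine_dg (C : List Fo) : ∃ E : Multiset ℕ, ∃ W W' : Multiset ℝ, ∀ R,
    dg (spine C R) = E + (k R + 1) ::ₘ dg R ∧ mv (spine C R) = W + mv R ∧
      lv (spine C R) = W' + lv R := by
  induction C with
  | nil => exact ⟨0, 0, 0, fun R => by simp [spine, dg, mv, lv]⟩
  | cons M C ih =>
    obtain ⟨E, W, W', h⟩ := ih
    refine ⟨(k M + 1 + 1) ::ₘ (dg M + E), mv M + W, lv M + W', fun R => ?_⟩
    obtain ⟨h1, h2, h3⟩ := h R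
    refine ⟨?_, by simp [spine, mv, h2, add_assoc], by simp [spine, lv, h3, add_assoc]⟩
    simp [spine, dg, h1, (spine_simple C R).1, add_assoc, Multiset.cons_swap (k M + 2)]

/-- All leaf values lie strictly between `0` and `1`. -/
def Ok (f : Fo) : Prop := ∀ x ∈ al f, 0 < x ∧ x < 1

lemma Ok.of_le {f g : Fo} (hf : Ok f) (h : al g ≤ al f) : Ok g :=
  fun x hx => hf x (Multiset.mem_of_le h hx)

@[simp] lemma al_leaf (m x f) : al (leaf m x f) = x ::ₘ al f := by
  cases m <;> simp [al, mv, lv]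

@[simp] lemma al_node (c f) : al (node c f) = al c + al f := by
  simp only [al, mv, lv]; abel

@[simp] lemma al_nil : al nil = 0 := rfl

/-- The inequality `si ≤ ta` is what keeps `8 * ta - 5 * si` and `8 * ta - 6 * si` positive, and it
reproduces itself at each node. -/
lemma Ok.pos {f : Fo} (hf : Ok f) : 0 < ta f ∧ 0 < si f ∧ si f ≤ ta f := by
  induction f with
  | nil => simp
  | leaf m x f ih =>
    obtain ⟨h1, h2, h3⟩ := ih (hf.of_le (by simpa using Multiset.le_cons_self _ _))
    obtain ⟨h4, h5⟩ := hf x (by simp)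
    refine ⟨h1, by simp; positivity, ?_⟩
    simp only [si_leaf, ta_leaf]; nlinarith
  | node c f ih1 ih2 =>
    obtain ⟨h1, h2, h3⟩ := ih1 (hf.of_le (by simp))
    obtain ⟨h4, h5, h6⟩ := ih2 (hf.of_le (by simp))
    have a : 0 < 8 * ta c - 5 * si c := by linarith
    have b : 0 < 8 * ta c - 6 * si c := by linarith
    refine ⟨by simp; positivity, by simp; positivity, ?_⟩
    simp only [si_node, ta_node]
    exact mul_le_mul (by linarith) h6 h5.le a.le

/-- Each vertex of the path acts linearly on the pair of weights, hence so does the whole path. The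
bounds `5 * a' ≤ 6 * a` and `5 * b' ≤ 6 * b` carry the induction; together with `si M ≤ ta M` they
keep the coefficients nonnegative, which `exchange` needs. -/
lemma spine_wt (C : List Fo) (hC : ∀ M ∈ C, Ok M) : ∃ a b a' b' : ℝ, 0 ≤ a' ∧ 5 * a' ≤ 6 * a ∧
    0 ≤ b' ∧ 5 * b' ≤ 6 * b ∧ ∀ R, ta (spine C R) = a * ta R - b * si R ∧
      si (spine C R) = a' * ta R - b' * si R := by
  induction C with
  | nil =>
    exact ⟨8, 5, 8, 6, by norm_num, by norm_num, by norm_num, by norm_num,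
      fun R => by simp [spine]⟩
  | cons M C ih =>
    obtain ⟨a, b, a', b', h1, h2, h3, h4, h⟩ := ih fun M hM => hC M (by simp [hM])
    obtain ⟨p1, p2, p3⟩ := (hC M (by simp)).pos
    refine ⟨8 * ta M * a - 5 * si M * a', 8 * ta M * b - 5 * si M * b',
      8 * ta M * a - 6 * si M * a', 8 * ta M * b - 6 * si M * b', ?_, ?_, ?_, ?_, fun R => ?_⟩
    · nlinarith [mul_le_mul p3 h2 (by linarith) p1.le]
    · nlinarith [mul_le_mul p3 h2 (by linarith) p1.le, mul_nonneg p1.le h1]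
    · nlinarith [mul_le_mul p3 h4 (by linarith) p1.le]
    · nlinarith [mul_le_mul p3 h4 (by linarith) p1.le, mul_nonneg p1.le h3]
    · obtain ⟨e1, e2⟩ := h R
      simp only [spine, ta_node, si_node, ta_append, si_append, e1, e2, ta_nil, si_nil]
      constructor <;> ring

end Fo

/-! ### The exchange argument along a path -/

namespace Fo

lemma exists_split (f : Fo) {j : ℕ} (hj : j ≤ k f) :
    ∃ f₁ f₂, Equ f (f₁.append f₂) ∧ k f₁ = j := by
  induction f generalizing j with
  | nil => exact ⟨nil, nil, Equ.refl _, by simp [k] at hj ⊢; omega⟩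
  | leaf m x f ih =>
    cases j with
    | zero => exact ⟨nil, _, Equ.refl _, rfl⟩
    | succ j =>
      obtain ⟨a, b, h, e⟩ := ih (Nat.le_of_succ_le_succ hj)
      exact ⟨leaf m x a, b, (Equ.refl (leaf m x nil)).append h, by simp [k, e]⟩
  | node c f _ ih =>
    cases j with
    | zero => exact ⟨nil, _, Equ.refl _, rfl⟩
    | succ j =>
      obtain ⟨a, b, h, e⟩ := ih (Nat.le_of_succ_le_succ hj)
      exact ⟨node c a, b, (Equ.refl (node c nil)).append h, by simp [k, e]⟩

/-- A single component that is not a marked leaf. -/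
def IsBr (b : Fo) : Prop := (∃ y, b = leaf false y nil) ∨ ∃ c, b = node c nil

lemma IsBr.simple {b : Fo} (h : IsBr b) : k b = 1 ∧ mt b = 0 := by
  rcases h with ⟨y, rfl⟩ | ⟨c, rfl⟩ <;> simp [k, mt]

lemma exists_marked (f : Fo) (h : 0 < mt f) :
    ∃ x f₁, Equ f ((leaf true x nil).append f₁) := by
  induction f with
  | nil => simp [mt] at h
  | leaf m x f ih =>
    cases m with
    | true => exact ⟨x, f, Equ.refl _⟩
    | false =>
      obtain ⟨y, f₁, e⟩ := ih (by simpa [mt] using h)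
      exact ⟨y, leaf false x f₁, ((Equ.refl (leaf false x nil)).append e).trans
        (((Equ.append_assoc _ _ _).symm.trans
          ((Equ.append_comm _ _).append (Equ.refl _))).trans (Equ.append_assoc _ _ _))⟩
  | node c f _ ih =>
    obtain ⟨y, f₁, e⟩ := ih h
    exact ⟨y, node c f₁, ((Equ.refl (node c nil)).append e).trans
        (((Equ.append_assoc _ _ _).symm.trans
          ((Equ.append_comm _ _).append (Equ.refl _))).trans (Equ.append_assoc _ _ _))⟩

lemma exists_unmarked (f : Fo) (h : mt f < k f) :
    ∃ b f₁, IsBr b ∧ Equ f (b.append f₁) := by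
  induction f with
  | nil => simp [k] at h
  | leaf m x f ih =>
    cases m with
    | false => exact ⟨_, f, Or.inl ⟨x, rfl⟩, Equ.refl _⟩
    | true =>
      obtain ⟨b, f₁, hb, e⟩ := ih (by simp [mt, k] at h; omega)
      exact ⟨b, leaf true x f₁, hb, ((Equ.refl (leaf true x nil)).append e).trans
        (((Equ.append_assoc _ _ _).symm.trans
          ((Equ.append_comm _ _).append (Equ.refl _))).trans (Equ.append_assoc _ _ _))⟩
  | node c f _ ih => exact ⟨_, f, Or.inr ⟨c, rfl⟩, Equ.refl _⟩

lemma mt_le (f : Fo) : mt f ≤ k f ∧ mt f ≤ Multiset.card (mv f) := by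
  induction f with
  | nil => simp [mt, k]
  | leaf m x f ih => cases m <;> simp [mt, k, mv] <;> omega
  | node c f _ ih => simp [mt, k, mv]; omega

lemma exists_spine_of_mt (f : Fo) (h : mt f < Multiset.card (mv f)) :
    ∃ (L : Fo) (C : List Fo) (R : Fo), Equ f (L.append (spine C R)) ∧ 0 < mt R := by
  induction f with
  | nil => simp [mv] at h
  | leaf m x f ih =>
    obtain ⟨L, C, R, e, hR⟩ := ih (by cases m <;> simp [mt, mv] at h <;> omega)
    exact ⟨leaf m x L, C, R, (Equ.refl (leaf m x nil)).append e, hR⟩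
  | node c f ih1 ih2 =>
    by_cases h2 : mt f < Multiset.card (mv f)
    · obtain ⟨L, C, R, e, hR⟩ := ih2 h2
      exact ⟨node c L, C, R, (Equ.refl (node c nil)).append e, hR⟩
    · by_cases h1 : 0 < mt c
      · exact ⟨f, [], c, Equ.append_comm (node c nil) f, h1⟩
      · obtain ⟨L, C, R, e, hR⟩ := ih1 (by simp [mt, mv] at h; omega)
        exact ⟨f, L :: C, R, (Equ.append_comm (node c nil) f).trans
          ((Equ.refl f).append (e.node nil)), hR⟩

lemma exists_spine_of_dg (f : Fo) {d : ℕ} (h : d ∈ dg f) :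
    ∃ (L : Fo) (C : List Fo) (R : Fo), Equ f (L.append (spine C R)) ∧ k R + 1 = d := by
  induction f with
  | nil => simp [dg] at h
  | leaf m x f ih =>
    obtain ⟨L, C, R, e, hR⟩ := ih h
    exact ⟨leaf m x L, C, R, (Equ.refl (leaf m x nil)).append e, hR⟩
  | node c f ih1 ih2 =>
    simp only [dg, Multiset.mem_cons, Multiset.mem_add] at h
    rcases h with h | h | h
    · exact ⟨f, [], c, Equ.append_comm (node c nil) f, h.symm⟩
    · obtain ⟨L, C, R, e, hR⟩ := ih1 h
      exact ⟨f, L :: C, R, (Equ.append_comm (node c nil) f).trans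
          ((Equ.refl f).append (e.node nil)), hR⟩
    · obtain ⟨L, C, R, e, hR⟩ := ih2 h
      exact ⟨node c L, C, R, (Equ.refl (node c nil)).append e, hR⟩

lemma exists_root (f : Fo) {d : ℕ} (h : d ∈ k f ::ₘ dg f) : ∃ g, TEqu f g ∧ k g = d := by
  rcases Multiset.mem_cons.1 h with h | h
  · exact ⟨f, (Equ.refl f).tEqu, h.symm⟩
  · obtain ⟨L, C, R, e, hR⟩ := exists_spine_of_dg f h
    exact ⟨_, e.tEqu.trans (reroot C L R), by simp [(up_simple C L).1, hR]⟩

/-- The quotient of the weights. -/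
noncomputable def P (f : Fo) : ℝ := si f / ta f

lemma P_append (f g : Fo) : P (f.append g) = P f * P g := by
  simp [P, mul_div_mul_comm]

@[simp] lemma P_leaf (m x) : P (leaf m x nil) = x := by simp [P]

lemma Equ.P {f g : Fo} (h : Equ f g) : P f = P g := by simp [Fo.P, h.ta, h.si]

lemma Ok.P {f : Fo} (h : Ok f) : 0 < P f ∧ P f ≤ 1 :=
  ⟨div_pos h.pos.2.1 h.pos.1, (div_le_one h.pos.1).2 h.pos.2.2⟩

/-- From `a * b = l * r` and `a` not strictly between `l` and `r` follows `l + r ≤ a + b`, and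
neither `l` nor `r` exceeds the maximum of `a` and `b`. Pairing this maximum with the larger of the
coefficients `u` and `v` gives the bound. -/
lemma exchange_aux {u v a b l r : ℝ} (hu : 0 ≤ u) (hv : 0 ≤ v) (ha : 0 < a)
    (hab : a * b = l * r) (hx : 0 ≤ (a - l) * (a - r)) :
    u * r + v * l ≤ u * b + v * a ∨ u * r + v * l ≤ u * a + v * b := by
  have h1 : l + r ≤ a + b := by
    by_contra! h
    nlinarith
  have key : ∀ M, (M = a ∨ M = b) → a ≤ M → b ≤ M → r ≤ M ∧ l ≤ M := by
    intro M hM h2 h3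
    have h4 : (a - r) * (b - r) ≤ 0 ∨ r ≤ 0 := by
      by_cases h : 0 ≤ r
      · left; nlinarith
      · right; linarith
    have h5 : (a - l) * (b - l) ≤ 0 ∨ l ≤ 0 := by
      by_cases h : 0 ≤ l
      · left; nlinarith
      · right; linarith
    have h6 : 0 < M := by linarith
    constructor
    · by_contra! h
      rcases h4 with h4 | h4
      · nlinarith [mul_pos (show 0 < r - a by linarith) (show 0 < r - b by linarith)]
      · linarith
    · by_contra! h
      rcases h5 with h5 | h5
      · nlinarith [mul_pos (show 0 < l - a by linarith) (show 0 < l - b by linarith)]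
      · linarith
  rcases le_total a b with h | h <;> rcases le_total u v with huv | huv
  · obtain ⟨k1, k2⟩ := key b (Or.inr rfl) h le_rfl
    right
    nlinarith [mul_nonneg (sub_nonneg.2 huv) (sub_nonneg.2 k2), mul_nonneg hu (sub_nonneg.2 h1)]
  · obtain ⟨k1, k2⟩ := key b (Or.inr rfl) h le_rfl
    left
    nlinarith [mul_nonneg (sub_nonneg.2 huv) (sub_nonneg.2 k1), mul_nonneg hv (sub_nonneg.2 h1)]
  · obtain ⟨k1, k2⟩ := key a (Or.inl rfl) le_rfl h
    left
    nlinarith [mul_nonneg (sub_nonneg.2 huv) (sub_nonneg.2 k2), mul_nonneg hu (sub_nonneg.2 h1)]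
  · obtain ⟨k1, k2⟩ := key a (Or.inl rfl) le_rfl h
    right
    nlinarith [mul_nonneg (sub_nonneg.2 huv) (sub_nonneg.2 k1), mul_nonneg hv (sub_nonneg.2 h1)]

lemma Ok.si_eq {f : Fo} (h : Ok f) : si f = ta f * Fo.P f := by
  rw [Fo.P, mul_div_cancel₀ _ h.pos.1.ne']

/-- Exchanging the branches at two vertices so as to make the products at the two ends more
different from each other lowers the weight, in one of the two ways of doing it. -/
lemma exchange {L R A B : Fo} {C : List Fo} (hC : ∀ M ∈ C, Ok M) (hL : Ok L) (hR : Ok R)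
    (hA : Ok A) (hB : Ok B) (ht : ta A * ta B = ta L * ta R) (hs : si A * si B = si L * si R)
    (hx : 0 ≤ (P A - P L) * (P A - P R)) :
    rv (A.append (spine C B)) ≤ rv (L.append (spine C R)) ∨
      rv (A.append (up C B)) ≤ rv (L.append (spine C R)) := by
  rw [← (reroot C B A).rv]
  obtain ⟨a, b, a', b', h1, h2, h3, h4, h⟩ := spine_wt C hC
  have hab : P A * P B = P L * P R := by
    simp only [P, div_mul_div_comm, ht, hs]
  have hpos : 0 < ta L * ta R := mul_pos hL.pos.1 hR.pos.1
  have hb : 0 ≤ b := by linarith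
  -- The weight is bilinear in the data at the two ends. With the products of the `ta` and of the
  -- `si` fixed, only the middle term depends on the distribution of the branches.
  have e : ∀ F G : Fo, Ok F → Ok G → rv (F.append (spine C G)) = 8 * a * (ta F * ta G) -
      (ta F * ta G) * (8 * b * P G + 5 * a' * P F) + 5 * b' * (si F * si G) := by
    intro F G hF hG
    simp only [rv, ta_append, si_append, (h G).1, (h G).2]
    rw [hF.si_eq, hG.si_eq]; ring
  rw [e L R hL hR, e A B hA hB, e B A hB hA, mul_comm (ta B), mul_comm (si B), ht, hs]
  rcases exchange_aux (u := 8 * b) (v := 5 * a') (by positivity) (by positivity) hA.P.1 hab hx with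
    h | h
  · left; nlinarith [mul_le_mul_of_nonneg_left h hpos.le]
  · right; nlinarith [mul_le_mul_of_nonneg_left h hpos.le]

/-- The order relation `≤`, or its reverse. -/
def rel (s : Bool) (a b : ℝ) : Prop := if s then a ≤ b else b ≤ a

lemma rel.refl (s a) : rel s a a := by simp [rel]

lemma rel.trans {s a b c} (h : rel s a b) (h' : rel s b c) : rel s a c := by
  cases s <;> simp only [rel, if_true, if_false, Bool.false_eq_true] at * <;> linarith

lemma rel.mul {s a b c d} (h : rel s a b) (h' : rel s c d) (ha : 0 ≤ a) (hb : 0 ≤ b) (hc : 0 ≤ c)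
    (hd : 0 ≤ d) : rel s (a * c) (b * d) := by
  cases s <;> simp only [rel, if_true, if_false, Bool.false_eq_true] at * <;> gcongr

lemma rel.total (s a b) : rel s a b ∨ rel s b a := by
  cases s <;> simp only [rel, if_true, if_false, Bool.false_eq_true] <;> exact le_total _ _

lemma rel.sign {s a b c} (h : rel s a b) (h' : rel s a c) : 0 ≤ (a - b) * (a - c) := by
  cases s <;> simp only [rel, if_true, if_false, Bool.false_eq_true] at *
  · exact mul_nonneg (by linarith) (by linarith)
  · exact mul_nonneg_of_nonpos_of_nonpos (by linarith) (by linarith)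

/-- Two pairs of forests have the same components, up to the order and up to the quantities that
matter. -/
structure Same (A B L R : Fo) : Prop where
  kl : k A = k L
  kr : k B = k R
  dg : dg A + dg B = dg L + dg R
  mv : mv A + mv B = mv L + mv R
  lv : lv A + lv B = lv L + lv R
  ta : ta A * ta B = ta L * ta R
  si : si A * si B = si L * si R
  mt : mt A + mt B = mt L + mt R

lemma Same.trans {A B L R X Y : Fo} (h : Same A B L R) (h' : Same L R X Y) : Same A B X Y :=
  ⟨h.1.trans h'.1, h.2.trans h'.2, h.3.trans h'.3, h.4.trans h'.4, h.5.trans h'.5, h.6.trans h'.6,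
    h.7.trans h'.7, h.8.trans h'.8⟩

lemma Same.of_equ {A B L R : Fo} (h : Equ A L) (h' : Equ B R) : Same A B L R :=
  ⟨h.k, h'.k, by rw [h.dg, h'.dg], by rw [h.mv, h'.mv], by rw [h.lv, h'.lv], by rw [h.ta, h'.ta],
    by rw [h.si, h'.si], by rw [h.mt, h'.mt]⟩

lemma Same.swap {a b : Fo} (A B : Fo) (h : k a = k b) :
    Same (b.append A) (a.append B) (a.append A) (b.append B) := by
  constructor <;> simp [h]
  all_goals first | omega | abel | ring

lemma Same.al {A B L R : Fo} (h : Same A B L R) : al A + al B = al L + al R := by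
  have e1 : Fo.al A + Fo.al B = (Fo.mv A + Fo.mv B) + (Fo.lv A + Fo.lv B) := by
    simp only [Fo.al]; abel
  have e2 : Fo.al L + Fo.al R = (Fo.mv L + Fo.mv R) + (Fo.lv L + Fo.lv R) := by
    simp only [Fo.al]; abel
  rw [e1, e2, h.mv, h.lv]

lemma Same.ok {A B L R : Fo} (h : Same A B L R) (hL : Ok L) (hR : Ok R) : Ok A ∧ Ok B := by
  have : ∀ x, x ∈ Fo.al A + Fo.al B → 0 < x ∧ x < 1 := by
    intro x hx
    rw [h.al, Multiset.mem_add] at hx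
    exact hx.elim (hL x) (hR x)
  exact ⟨fun x hx => this x (Multiset.mem_add.2 (Or.inl hx)),
    fun x hx => this x (Multiset.mem_add.2 (Or.inr hx))⟩

/-- The marked leaf values are extreme among all branches with data in the given bounds. -/
def Extr (s : Bool) (E : Multiset ℕ) (S W : Multiset ℝ) : Prop :=
  ∀ b, IsBr b → dg b ≤ E → mv b ≤ S → lv b ≤ W → ∀ x ∈ S, rel s x (P b)

/-- A marked leaf of `B` is swapped with an unmarked component of `A`. Since marked values are
extreme, each swap moves `P A` only in the extreme direction. The bound `mt A + mt B ≤ k A` ensures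
that `A` has an unmarked component as long as `B` has a marked one. -/
lemma pull {s E S W} (H : Extr s E S W) (n : ℕ) : ∀ A B : Fo, mt B = n → dg A + dg B ≤ E →
    mv A + mv B ≤ S → lv A + lv B ≤ W → Ok A → Ok B → mt A + mt B ≤ k A →
    ∃ A' B', Same A' B' A B ∧ mt B' = 0 ∧ rel s (P A') (P A) := by
  induction n with
  | zero =>
    intro A B h0 _ _ _ _ _ _
    exact ⟨A, B, Same.of_equ (Equ.refl _) (Equ.refl _), h0, rel.refl _ _⟩
  | succ n ih =>
    intro A B hn hE hS hW hA hB hk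
    obtain ⟨x, B₁, eB⟩ := exists_marked B (by omega)
    obtain ⟨b, A₁, hb, eA⟩ := exists_unmarked A (by omega)
    have sw : Same ((leaf true x nil).append A₁) (b.append B₁) A B :=
      (Same.swap A₁ B₁ (by rw [hb.simple.1]; rfl)).trans (Same.of_equ eA.symm eB.symm)
    obtain ⟨hA', hB'⟩ := sw.ok hA hB
    have hmt : mt (b.append B₁) = n := by
      have := eB.mt
      simp [mt] at this
      simp [hb.simple.2]; omega
    obtain ⟨A', B', h1, h2, h3⟩ := ih _ _ hmt (by rwa [sw.dg]) (by rwa [sw.mv]) (by rwa [sw.lv])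
      hA' hB' (by rw [sw.mt, sw.kl]; exact hk)
    refine ⟨A', B', h1.trans sw, h2, h3.trans ?_⟩
    have okA : Ok (b.append A₁) := by intro y hy; rw [← eA.al] at hy; exact hA y hy
    have ok1 : Ok A₁ := okA.of_le (by simp)
    have okb : Ok b := okA.of_le (by simp)
    have hx : x ∈ S := by
      refine Multiset.mem_of_le hS (Multiset.mem_add.2 (Or.inr ?_))
      rw [eB.mv]; simp [mv]
    have hxx : 0 < x := (hA' x (by simp)).1
    rw [eA.P, P_append, P_append, P_leaf]
    refine rel.mul (H b hb ?_ ?_ ?_ x hx) (rel.refl _ _) hxx.le okb.P.1.le ok1.P.1.le ok1.P.1.le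
    · refine le_trans ?_ hE
      rw [eA.dg, dg_append, add_assoc]; exact Multiset.le_add_right _ _
    · refine le_trans ?_ hS
      rw [eA.mv, mv_append, add_assoc]; exact Multiset.le_add_right _ _
    · refine le_trans ?_ hW
      rw [eA.lv, lv_append, add_assoc]; exact Multiset.le_add_right _ _

/-- Of two forests, the first can be made the one with the extreme product. -/
lemma arrange (s : Bool) {L R : Fo} (hL : Ok L) (hR : Ok R)
    (hk : if s then k R ≤ k L else k L ≤ k R) :
    ∃ A B, Same A B L R ∧ rel s (P A) (P L) ∧ rel s (P A) (P R) := by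
  rcases rel.total s (P L) (P R) with h | h
  · exact ⟨L, R, Same.of_equ (Equ.refl _) (Equ.refl _), rel.refl _ _, h⟩
  · cases s
    · obtain ⟨R₁, R₂, e, hk'⟩ := exists_split R (show k L ≤ k R by simpa using hk)
      have okR : Ok (R₁.append R₂) := by intro y hy; rw [← e.al] at hy; exact hR y hy
      have hp : rel false (P R₁) (P R) := by
        rw [e.P, P_append]
        simp only [rel, Bool.false_eq_true, if_false]
        have h1 := (okR.of_le (g := R₁) (by simp)).P
        have h2 := (okR.of_le (g := R₂) (by simp)).P
        nlinarith
      refine ⟨R₁, L.append R₂, ⟨hk', ?_, ?_, ?_, ?_, ?_, ?_, ?_⟩, hp.trans h, hp⟩ <;>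
        simp [e.k, e.dg, e.mv, e.lv, e.mt, e.ta, e.si, hk']
      all_goals first | abel | ring
    · obtain ⟨L₁, L₂, e, hk'⟩ := exists_split L (show k R ≤ k L by simpa using hk)
      have okL : Ok (L₁.append L₂) := by intro y hy; rw [← e.al] at hy; exact hL y hy
      have hp : rel true (P (R.append L₂)) (P R) := by
        rw [P_append]
        simp only [rel, if_true]
        have h2 := (okL.of_le (g := L₂) (by simp)).P
        have h3 := hR.P
        nlinarith
      refine ⟨R.append L₂, L₁, ⟨?_, hk', ?_, ?_, ?_, ?_, ?_, ?_⟩, hp.trans h, hp⟩ <;>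
        simp [e.k, e.dg, e.mv, e.lv, e.mt, e.ta, e.si, hk']
      all_goals first | abel | ring

end Fo

/-! ### Gathering the marked leaves at the root and contracting -/

namespace Fo

/-- Take the path from the root to a vertex that carries a marked leaf. After `arrange` the root's
side has the extreme quotient, `pull` moves all marks of the far end to it, and `exchange` shows
that the weight does not increase for the path or for its reversal. -/
lemma gather_step {s : Bool} {f : Fo} (hf : Ok f) (H : Extr s (dg f) (mv f) (lv f))
    (hd : ∀ e ∈ dg f, if s then e ≤ k f else k f ≤ e) (hc : Multiset.card (mv f) + 1 = k f)
    (hm : mt f < Multiset.card (mv f)) :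
    ∃ f', Ok f' ∧ k f' = k f ∧ dg f' = dg f ∧ mv f' = mv f ∧ lv f' = lv f ∧ rv f' ≤ rv f ∧
      mt f < mt f' := by
  obtain ⟨L, C, R, e, hR⟩ := exists_spine_of_mt f hm
  obtain ⟨E, W, W', hs⟩ := spine_dg C
  obtain ⟨s1, s2⟩ := spine_simple C R
  have ek : k f = k L + 1 := by rw [e.k, k_append, s1]
  have edg : dg f = dg L + (E + (k R + 1) ::ₘ dg R) := by rw [e.dg, dg_append, (hs R).1]
  have emv : mv f = mv L + (W + mv R) := by rw [e.mv, mv_append, (hs R).2.1]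
  have elv : lv f = lv L + (W' + lv R) := by rw [e.lv, lv_append, (hs R).2.2]
  have emt : mt f = mt L := by rw [e.mt, mt_append, s2, add_zero]
  have okf : Ok (L.append (spine C R)) := by intro x hx; rw [← e.al] at hx; exact hf x hx
  have okL : Ok L := okf.of_le (by simp)
  have al_spine : ∀ G, al (spine C G) = W + W' + al G := by
    intro G; simp only [al, (hs G).2.1, (hs G).2.2]; abel
  have okR : Ok R := okf.of_le (by
    rw [al_append, al_spine, ← add_assoc]; exact Multiset.le_add_left _ _)
  have okC : ∀ M ∈ C, Ok M := by
    have : Ok (spine C R) := okf.of_le (by simp)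
    clear * - this
    induction C with
    | nil => simp
    | cons M C ih =>
      simp only [spine] at this
      intro N hN
      rcases List.mem_cons.1 hN with rfl | hN
      · exact this.of_le (by simp)
      · exact ih (this.of_le (by simp)) N hN
  -- The end vertex has degree `k R + 1` and the root has degree `k L + 1`; the degree of the root
  -- is extreme.
  have hkR : if s then k R ≤ k L else k L ≤ k R := by
    have := hd (k R + 1) (by rw [edg]; simp)
    cases s <;> simp_all
  obtain ⟨A₀, B₀, h0, hl, hr⟩ := arrange s okL okR hkR
  obtain ⟨okA0, okB0⟩ := h0.ok okL okR
  -- There are only `k f - 1 = k L` marked leaves in all, so there is room for those of both ends at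
  -- the root.
  have lesum : mt L + mt R ≤ Multiset.card (mv f) := by
    rw [emv]; have := (mt_le L).2; have := (mt_le R).2
    simp only [Multiset.card_add]; omega
  obtain ⟨A, B, h1, hmB, hAA⟩ := pull H _ A₀ B₀ rfl
    (by rw [h0.dg, edg]
        refine add_le_add_right ?_ _
        exact le_trans (Multiset.le_cons_self _ _) (Multiset.le_add_left _ _))
    (by rw [h0.mv, emv]; exact add_le_add_right (Multiset.le_add_left _ _) _)
    (by rw [h0.lv, elv]; exact add_le_add_right (Multiset.le_add_left _ _) _)
    okA0 okB0 (by rw [h0.mt, h0.kl]; omega)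
  have hS := h1.trans h0
  obtain ⟨okA, okB⟩ := hS.ok okL okR
  have hmA : mt f < mt A := by have := hS.mt; omega
  have tA : k (A.append (spine C B)) = k f ∧ dg (A.append (spine C B)) = dg f ∧
      mv (A.append (spine C B)) = mv f ∧ lv (A.append (spine C B)) = lv f := by
    refine ⟨by simp [(spine_simple C B).1, hS.kl, ek], ?_, ?_, ?_⟩
    · rw [dg_append, (hs B).1, edg, hS.kr]
      simp only [Multiset.add_cons, ← add_assoc]
      rw [add_right_comm, hS.dg, add_right_comm]
    · rw [mv_append, (hs B).2.1, emv, add_left_comm, hS.mv, add_left_comm]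
    · rw [lv_append, (hs B).2.2, elv, add_left_comm, hS.lv, add_left_comm]
  have tB := reroot C B A
  have tB' : k (A.append (up C B)) = k f ∧ dg (A.append (up C B)) = dg f ∧
      mv (A.append (up C B)) = mv f ∧ lv (A.append (up C B)) = lv f := by
    have k1 : k (A.append (up C B)) = k f := by simp [(up_simple C B).1, hS.kl, ek]
    refine ⟨k1, ?_, ?_, ?_⟩
    · have := tB.dg
      rw [k1, k_append, dg_append, (spine_simple C A).1, (hs A).1, hS.kl, hS.kr, ← ek] at this
      refine Multiset.cons_inj_right (k f) |>.1 (this.symm.trans ?_)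
      rw [edg]
      simp only [Multiset.add_cons, ← add_assoc]
      rw [Multiset.cons_swap, add_right_comm, add_comm (dg B), hS.dg, add_right_comm]
    · rw [← tB.mv, mv_append, (hs A).2.1, emv, add_left_comm, add_comm (mv B), hS.mv, add_left_comm]
    · rw [← tB.lv, lv_append, (hs A).2.2, elv, add_left_comm, add_comm (lv B), hS.lv, add_left_comm]
  have okk : ∀ g, mv g = mv f → lv g = lv f → Ok g := by
    intro g h h' x hx
    refine hf x ?_
    rwa [al, h, h', ← al] at hx
  rcases exchange okC okL okR okA okB hS.ta hS.si ((hAA.trans hl).sign (hAA.trans hr)) with h | h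
  · rw [← e.rv] at h
    exact ⟨_, okk _ tA.2.2.1 tA.2.2.2, tA.1, tA.2.1, tA.2.2.1, tA.2.2.2, h, by
      rw [mt_append]; omega⟩
  · rw [← e.rv] at h
    exact ⟨_, okk _ tB'.2.2.1 tB'.2.2.2, tB'.1, tB'.2.1, tB'.2.2.1, tB'.2.2.2, h, by
      rw [mt_append]; omega⟩

lemma gather {s : Bool} (n : ℕ) : ∀ {f : Fo}, Multiset.card (mv f) - mt f = n → Ok f →
    Extr s (dg f) (mv f) (lv f) → (∀ e ∈ dg f, if s then e ≤ k f else k f ≤ e) →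
    Multiset.card (mv f) + 1 = k f →
    ∃ f', k f' = k f ∧ dg f' = dg f ∧ mv f' = mv f ∧ lv f' = lv f ∧ rv f' ≤ rv f ∧
      mt f' = Multiset.card (mv f) := by
  induction n using Nat.strong_induction_on with
  | _ n ih =>
    intro f hn hf H hd hc
    rcases (mt_le f).2.lt_or_eq with h | h
    · obtain ⟨g, g1, g2, g3, g4, g5, g6, g7⟩ := gather_step hf H hd hc h
      obtain ⟨f', a1, a2, a3, a4, a5, a6⟩ := ih (Multiset.card (mv g) - mt g)
        (by rw [g4]; omega) rfl g1 (by rwa [g3, g4, g5]) (by rwa [g2, g3]) (by rwa [g2, g4])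
      exact ⟨f', a1.trans g2, a2.trans g3, a3.trans g4, a4.trans g5, a5.trans g6,
        by rw [a6, g4]⟩
    · exact ⟨f, rfl, rfl, rfl, rfl, le_rfl, h⟩

lemma all_marked (f : Fo) (h : mt f = k f) :
    dg f = 0 ∧ lv f = 0 ∧ ta f = 1 ∧ si f = (mv f).prod ∧ Multiset.card (mv f) = k f := by
  induction f with
  | nil => simp [dg, lv, mv, k]
  | leaf m x f ih =>
    have := (mt_le f).1
    cases m with
    | false => simp [mt, k] at h; omega
    | true =>
      obtain ⟨h1, h2, h3, h4, h5⟩ := ih (by simp [mt, k] at h; omega)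
      simp [dg, lv, mv, k, h1, h2, h3, h4, h5]
  | node c f _ ih =>
    have := (mt_le f).1
    simp [mt, k] at h; omega

/-- Replacing a node all of whose branches but one are marked leaves by a leaf. -/
lemma contract {f : Fo} (hk : Multiset.card (mv f) + 1 = k f) (hm : mt f = Multiset.card (mv f))
    (h0 : dg f ≠ 0) {z : ℝ} (hz : (8 - 5 * (mv f).prod) * z = 8 - 6 * (mv f).prod) :
    ∃ g, k g ::ₘ dg g = dg f ∧ mv g = 0 ∧ lv g = z ::ₘ lv f ∧
      rv f = (8 - 5 * (mv f).prod) * rv g := by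
  obtain ⟨b, f₁, hb, e⟩ := exists_unmarked f (by omega)
  obtain ⟨b1, b2⟩ := hb.simple
  have h1 : mt f₁ = mt f := by rw [e.mt, mt_append, b2, zero_add]
  have h2 : k f₁ + 1 = k f := by rw [e.k, k_append, b1, add_comm]
  obtain ⟨a1, a2, a3, a4, a5⟩ := all_marked f₁ (by omega)
  rcases hb with ⟨y, rfl⟩ | ⟨c, rfl⟩
  · rw [e.dg, dg_append, a1] at h0
    simp [dg] at h0
  · have hmv : mv f = mv c + mv f₁ := by rw [e.mv, mv_append]; simp [mv]
    have hc : mv c = 0 := by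
      rw [← Multiset.card_eq_zero]
      have := congrArg Multiset.card hmv
      rw [Multiset.card_add] at this; omega
    rw [hc, zero_add] at hmv
    refine ⟨c.append (leaf false z nil), ?_, by simp [hc, mv], ?_, ?_⟩
    · rw [e.dg]; simp [k, dg, a1]
    · rw [e.lv]; simp [lv, a2, add_comm (lv c)]
    · rw [e.rv, rv, rv, ta_append, si_append, ta_append, si_append, a3, a4, ← hmv]
      simp only [ta_node, si_node, ta_leaf, si_leaf, ta_nil, si_nil]
      linear_combination (5 * si c) * hz

/-- Values may repeat, so `S` does not determine which leaves to mark; any choice will do, as marks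
do not affect the weights. -/
lemma mark {f : Fo} : ∀ {S W : Multiset ℝ}, mv f = 0 → lv f = S + W → ∃ f', k f' = k f ∧
    dg f' = dg f ∧ mv f' = S ∧ lv f' = W ∧ ta f' = ta f ∧ si f' = si f := by
  induction f with
  | nil =>
    intro S W _ h
    obtain ⟨h1, h2⟩ := add_eq_zero.1 h.symm
    exact ⟨nil, rfl, rfl, h1.symm, h2.symm, rfl, rfl⟩
  | leaf m x f ih =>
    intro S W h0 h
    cases m
    · simp only [mv, Bool.false_eq_true, if_false, zero_add] at h0
      simp only [lv, Bool.false_eq_true, if_false, Multiset.singleton_add] at h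
      have hx : x ∈ S + W := by rw [← h]; simp
      rcases Multiset.mem_add.1 hx with hx | hx
      · obtain ⟨S', rfl⟩ := Multiset.exists_cons_of_mem hx
        rw [Multiset.cons_add, Multiset.cons_inj_right] at h
        obtain ⟨f', a1, a2, a3, a4, a5, a6⟩ := ih h0 h
        exact ⟨leaf true x f', by simp [k, a1], a2, by simp [mv, a3], by simp [lv, a4],
          a5, by simp [a6]⟩
      · obtain ⟨W', rfl⟩ := Multiset.exists_cons_of_mem hx
        rw [Multiset.add_cons, Multiset.cons_inj_right] at h
        obtain ⟨f', a1, a2, a3, a4, a5, a6⟩ := ih h0 h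
        exact ⟨leaf false x f', by simp [k, a1], a2, by simp [mv, a3], by simp [lv, a4],
          a5, by simp [a6]⟩
    · simp [mv] at h0
  | node c f ih1 ih2 =>
    intro S W h0 h
    obtain ⟨hc, hf⟩ := add_eq_zero.1 h0
    simp only [lv] at h
    have hcount : ∀ a, (lv c).count a + (lv f).count a = S.count a + W.count a := by
      intro a; rw [← Multiset.count_add, h, Multiset.count_add]
    -- The children of the node take as much of `S` as their values allow; the siblings get the
    -- rest.
    obtain ⟨c', a1, a2, a3, a4, a5, a6⟩ := ih1 (S := lv c ∩ S) (W := lv c - (lv c ∩ S)) hc (by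
      ext a; simp only [Multiset.count_add, Multiset.count_sub, Multiset.count_inter]; omega)
    obtain ⟨f', b1, b2, b3, b4, b5, b6⟩ := ih2 (S := S - (lv c ∩ S))
      (W := W - (lv c - (lv c ∩ S))) hf (by
      ext a; simp only [Multiset.count_add, Multiset.count_sub, Multiset.count_inter]
      have := hcount a; omega)
    refine ⟨node c' f', by simp [k, b1], by simp [dg, a1, a2, b2], ?_, ?_, by simp [a5, a6, b5],
      by simp [a5, a6, b6]⟩
    · simp only [mv, a3, b3]
      ext a; simp only [Multiset.count_add, Multiset.count_sub, Multiset.count_inter]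
      have := hcount a; omega
    · simp only [lv, a4, b4]
      ext a; simp only [Multiset.count_add, Multiset.count_sub, Multiset.count_inter]
      have := hcount a; omega

/-- `V` is a lower bound for the weights of all trees with inner degrees `D` and leaf values `W`. -/
def LB (D : Multiset ℕ) (W : Multiset ℝ) (V : ℝ) : Prop :=
  ∀ f, k f ::ₘ dg f = D → mv f = 0 → lv f = W → V ≤ rv f

lemma prod_bounds {S : Multiset ℝ} (h : ∀ x ∈ S, 0 < x ∧ x < 1) : 0 < S.prod ∧ S.prod ≤ 1 := by
  induction S using Multiset.induction_on with
  | empty => simp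
  | cons a S ih =>
    obtain ⟨h1, h2⟩ := ih fun x hx => h x (by simp [hx])
    obtain ⟨h3, h4⟩ := h a (by simp)
    rw [Multiset.prod_cons]
    exact ⟨by positivity, by nlinarith⟩

/-- The induction step of the optimisation. A competitor is rooted at a vertex of the extreme degree
`d`, leaves with values `S` are marked and gathered at this root, which then has only one further
branch, and the root with its leaves is contracted to a leaf of value `z`. -/
lemma merge {s : Bool} {d : ℕ} {D : Multiset ℕ} {S W : Multiset ℝ} {V z : ℝ}
    (hd : ∀ e ∈ D, if s then e ≤ d else d ≤ e) (hS : Multiset.card S + 1 = d) (hD : D ≠ 0)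
    (hv : ∀ x ∈ S + W, 0 < x ∧ x < 1) (H : Extr s D S W)
    (hz : (8 - 5 * S.prod) * z = 8 - 6 * S.prod) (hV : LB D (z ::ₘ W) V) :
    LB (d ::ₘ D) (S + W) ((8 - 5 * S.prod) * V) := by
  intro f hf hm hl
  obtain ⟨f₁, t, hk⟩ := exists_root f (d := d) (by rw [hf]; simp)
  have h1 : dg f₁ = D := by
    have := t.dg
    rw [hf, hk] at this
    exact ((Multiset.cons_inj_right d).1 this).symm
  obtain ⟨f₂, a1, a2, a3, a4, a5, a6⟩ := mark (S := S) (W := W) (t.mv.symm.trans hm)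
    (t.lv.symm.trans hl)
  have ok : Ok f₂ := by intro x hx; rw [al, a3, a4] at hx; exact hv x hx
  obtain ⟨f₃, b1, b2, b3, b4, b5, b6⟩ := gather (s := s) _ rfl ok (by rwa [a2, a3, a4, h1])
    (by rwa [a1, a2, h1, hk]) (by rw [a1, a3, hk, hS])
  have e3 : mv f₃ = S := b3.trans a3
  obtain ⟨g, g1, g2, g3, g4⟩ := contract (f := f₃) (z := z) (by rw [e3, b1, a1, hk, hS])
    (by rw [b6, e3, a3]) (by rwa [b2, a2, h1]) (by rwa [e3])
  have := hV g (by rw [g1, b2, a2, h1]) g2 (by rw [g3, b4, a4])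
  have hp := prod_bounds fun x hx => hv x (Multiset.mem_add.2 (Or.inl hx))
  calc (8 - 5 * S.prod) * V ≤ (8 - 5 * S.prod) * rv g :=
        mul_le_mul_of_nonneg_left this (by linarith)
    _ = rv f₃ := by rw [g4, e3]
    _ ≤ rv f₂ := b5
    _ = rv f₁ := by simp [rv, a5, a6]
    _ = rv f := t.rv.symm

end Fo

/-! ### The greedy moves and their invariant -/

namespace Fo

/-- The forest of unmarked leaves with the given values. -/
def leaves : List ℝ → Fo
  | [] => nil
  | x :: l => leaf false x (leaves l)

lemma leaves_spec (l : List ℝ) : k (leaves l) = l.length ∧ dg (leaves l) = 0 ∧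
    mv (leaves l) = 0 ∧ lv (leaves l) = l ∧ ta (leaves l) = 1 ∧ si (leaves l) = l.prod := by
  induction l with
  | nil => simp [leaves, k, dg, mv, lv]
  | cons x l ih => simp [leaves, k, dg, mv, lv, ih]

/-- Every branch value lies between the values in `X` and those in `Z`. -/
structure Cond (D : Multiset ℕ) (X Z : Multiset ℝ) : Prop where
  ok : ∀ x ∈ X + Z, 0 < x ∧ x < 1
  le : ∀ x ∈ X, ∀ z ∈ Z, x ≤ z
  br : ∀ c d, d ::ₘ dg (node c nil) ≤ D → al c ≤ X + Z →
    (∀ x ∈ X, x ≤ P (node c nil)) ∧ ∀ z ∈ Z, P (node c nil) ≤ z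

lemma al_pos {f : Fo} {W : Multiset ℝ} (h : ∀ x ∈ W, 0 < x ∧ x < 1) (hf : al f ≤ W) : Ok f :=
  fun x hx => h x (Multiset.mem_of_le hf hx)

/-- Replacing a leaf by a node with leaves. -/
lemma expand {S : Multiset ℝ} {z : ℝ} (hz : (8 - 5 * S.prod) * z = 8 - 6 * S.prod) (f : Fo)
    (h : z ∈ al f) : ∃ f', k f' = k f ∧ dg f' = (Multiset.card S + 1) ::ₘ dg f ∧
      z ::ₘ al f' = S + al f ∧ ta f' = (8 - 5 * S.prod) * ta f ∧
      si f' = (8 - 5 * S.prod) * si f := by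
  induction f with
  | nil => simp at h
  | leaf m x f ih =>
    rw [al_leaf, Multiset.mem_cons] at h
    rcases h with rfl | h
    · obtain ⟨l, rfl⟩ : ∃ l : List ℝ, (l : Multiset ℝ) = S := Quot.exists_rep S
      simp only [Multiset.coe_card, Multiset.prod_coe] at *
      obtain ⟨h1, h2, h3, h4, h5, h6⟩ := leaves_spec l
      refine ⟨node (leaves l) f, rfl, by simp [dg, h1, h2], ?_, by simp [h5, h6], ?_⟩
      · rw [al_node, al_leaf, al, h3, h4, zero_add, Multiset.add_cons]
      · simp only [si_node, h5, h6, si_leaf]; linear_combination (-si f) * hz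
    · obtain ⟨f', a1, a2, a3, a4, a5⟩ := ih h
      refine ⟨leaf m x f', by simp [k, a1], a2, ?_, a4, by simp [a5]; ring⟩
      rw [al_leaf, al_leaf, Multiset.cons_swap, a3, Multiset.add_cons]
  | node c f ih1 ih2 =>
    rw [al_node, Multiset.mem_add] at h
    rcases h with h | h
    · obtain ⟨c', a1, a2, a3, a4, a5⟩ := ih1 h
      refine ⟨node c' f, rfl, by simp [dg, a1, a2, Multiset.cons_swap], ?_,
        by simp [a4, a5]; ring, by simp [a4, a5]; ring⟩
      rw [al_node, al_node, ← Multiset.cons_add, a3, add_assoc]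
    · obtain ⟨f', a1, a2, a3, a4, a5⟩ := ih2 h
      refine ⟨node c f', by simp [k, a1], by simp [dg, a2, Multiset.cons_swap], ?_,
        by simp [a4]; ring, by simp [a5]; ring⟩
      rw [al_node, al_node, ← Multiset.add_cons, a3, add_left_comm]

/-- The product of the branch values is extreme. -/
lemma prod_bound {s : Bool} {E : Multiset ℕ} {W : Multiset ℝ} (f : Fo) : ∀ {S : Multiset ℝ},
    (∀ x ∈ S, 0 < x ∧ x < 1) → (∀ x ∈ W, 0 < x ∧ x < 1) →
    (∀ y ∈ W, ∀ x ∈ S, rel s x y) →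
    (∀ c, dg (node c nil) ≤ E → al c ≤ W → ∀ x ∈ S, rel s x (P (node c nil))) →
    dg f ≤ E → al f ≤ W → (if s then k f ≤ Multiset.card S else Multiset.card S ≤ k f) →
    rel s S.prod (P f) := by
  -- One branch is paired with one element of `S`. For upper bounds on `P f` the multiset `S` may
  -- run out first, and then the empty product `1` is a bound; for lower bounds this cannot happen,
  -- and leftover elements of `S` only decrease its product.
  have step : ∀ {b f : Fo} {S : Multiset ℝ}, (∀ x ∈ S, 0 < x ∧ x < 1) → Ok b → Ok f → k b = 1 →
      (∀ x ∈ S, rel s x (P b)) →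
      (if s then k (b.append f) ≤ Multiset.card S else Multiset.card S ≤ k (b.append f)) →
      (∀ {S' : Multiset ℝ}, S' ≤ S → (if s then k f ≤ Multiset.card S' else
        Multiset.card S' ≤ k f) → rel s S'.prod (P f)) → rel s S.prod (P (b.append f)) := by
    intro b f S hS hb hf hkb hbr hk ih
    rw [P_append]
    rcases S.empty_or_exists_mem with rfl | ⟨x, hx⟩
    · cases s
      · simp only [rel, Bool.false_eq_true, if_false, Multiset.prod_zero]
        have := hb.P; have := hf.P; nlinarith
      · simp [hkb] at hk
    · obtain ⟨S', rfl⟩ := Multiset.exists_cons_of_mem hx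
      rw [Multiset.prod_cons]
      refine rel.mul (hbr x hx) (ih (Multiset.le_cons_self _ _) ?_) (hS x hx).1.le hb.P.1.le
        (prod_bounds fun y hy => hS y (by simp [hy])).1.le hf.P.1.le
      cases s <;> simp [hkb] at hk ⊢ <;> omega
  induction f with
  | nil =>
    intro S hS _ _ _ _ _ hk
    cases s
    · simp [k] at hk; simp [rel, hk, P]
    · simpa [rel, P] using (prod_bounds hS).2
  | leaf m y f ih =>
    intro S hS hW hl hn hd ha hk
    have hf : al f ≤ W := le_trans (by simpa using Multiset.le_cons_self _ _) ha
    have hy : y ∈ W := Multiset.mem_of_le ha (by simp)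
    exact step (b := leaf m y nil) hS (by intro x hx; simp at hx; exact hx ▸ hW y hy)
      (al_pos hW hf) rfl (by simpa using hl y hy) hk
      fun hS' hk' => ih (fun x hx => hS x (Multiset.mem_of_le hS' hx)) hW
        (fun y hy x hx => hl y hy x (Multiset.mem_of_le hS' hx))
        (fun c h1 h2 x hx => hn c h1 h2 x (Multiset.mem_of_le hS' hx)) hd hf hk'
  | node c f _ ih =>
    intro S hS hW hl hn hd ha hk
    rw [al_node] at ha
    have hf : al f ≤ W := le_trans (Multiset.le_add_left _ _) ha
    have hc : al c ≤ W := le_trans (Multiset.le_add_right _ _) ha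
    have hdc : dg (node c nil) ≤ E := le_trans (by simp [dg]) hd
    have hdf : dg f ≤ E := le_trans (by
      simp only [dg]; exact (Multiset.le_add_left _ _).trans (Multiset.le_cons_self _ _)) hd
    exact step (b := node c nil) hS (by intro x hx; simp at hx; exact al_pos hW hc x hx)
      (al_pos hW hf) rfl (hn c hdc hc) hk
      fun hS' hk' => ih (fun x hx => hS x (Multiset.mem_of_le hS' hx)) hW
        (fun y hy x hx => hl y hy x (Multiset.mem_of_le hS' hx))
        (fun c h1 h2 x hx => hn c h1 h2 x (Multiset.mem_of_le hS' hx)) hdf hf hk'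

lemma P_node {c : Fo} (hc : Ok c) : P (node c nil) = (8 - 6 * P c) / (8 - 5 * P c) := by
  have h1 := hc.pos
  have h2 := hc.P
  rw [P, ta_node, si_node, hc.si_eq]
  simp only [ta_nil, si_nil, mul_one]
  rw [div_eq_div_iff (by nlinarith) (by linarith)]
  ring

/-- The monotonicity behind the alternation: small leaves below a vertex make a large branch, and
large leaves make a small one. -/
lemma branch_anti {p q : ℝ} (hq : q ≤ 1) (h : p ≤ q) :
    (8 - 6 * q) / (8 - 5 * q) ≤ (8 - 6 * p) / (8 - 5 * p) := by
  rw [div_le_div_iff₀ (by linarith) (by linarith)]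
  nlinarith

lemma rel_branch_anti {s : Bool} {p q : ℝ} (hp : p ≤ 1) (hq : q ≤ 1) (h : rel s p q) :
    rel s ((8 - 6 * q) / (8 - 5 * q)) ((8 - 6 * p) / (8 - 5 * p)) := by
  cases s <;> simp only [rel, if_true, if_false, Bool.false_eq_true] at *
  · exact branch_anti hp h
  · exact branch_anti hq h

/-- The value of a leaf that replaces a node with leaves. -/
noncomputable def val (S : Multiset ℝ) : ℝ := (8 - 6 * S.prod) / (8 - 5 * S.prod)

lemma val_spec {S : Multiset ℝ} (h : ∀ x ∈ S, 0 < x ∧ x < 1) :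
    (8 - 5 * S.prod) * val S = 8 - 6 * S.prod ∧ 0 < val S ∧ val S < 1 := by
  obtain ⟨h1, h2⟩ := prod_bounds h
  refine ⟨mul_div_cancel₀ _ (by linarith), div_pos (by linarith) (by linarith), ?_⟩
  rw [val, div_lt_one (by linarith)]; linarith

/-- A branch that uses the new leaf becomes, when this leaf is expanded into a star of degree `d`, a
branch over the old data with the same quotient. A branch that avoids the new leaf is one over the
old data already. -/
lemma Cond.transfer {d : ℕ} {D : Multiset ℕ} {X Z S W : Multiset ℝ} (h : Cond (d ::ₘ D) X Z)
    (hd : Multiset.card S + 1 = d) (hW : X + Z = S + W) {c : Fo} {e : ℕ}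
    (he : e ::ₘ dg (node c nil) ≤ D) (hc : al c ≤ val S ::ₘ W) :
    (∀ x ∈ X, x ≤ P (node c nil)) ∧ ∀ z ∈ Z, P (node c nil) ≤ z := by
  have hS : ∀ x ∈ S, 0 < x ∧ x < 1 := fun x hx => h.ok x (by rw [hW]; simp [hx])
  by_cases hz : val S ∈ al c
  · obtain ⟨c', a1, a2, a3, a4, a5⟩ := expand (val_spec hS).1 c hz
    have hP : P (node c' nil) = P (node c nil) := by
      have := prod_bounds hS
      simp only [P, ta_node, si_node, a4, a5, ta_nil, si_nil, mul_one]
      rw [← mul_div_mul_left (8 * ta c - 6 * si c) (8 * ta c - 5 * si c)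
        (show (8 - 5 * S.prod) ≠ 0 by linarith)]
      ring_nf
    rw [← hP]
    refine h.br c' e ?_ ?_
    · simp only [dg, a1, a2, hd, add_zero] at he ⊢
      rw [Multiset.cons_swap (k c + 1), Multiset.cons_swap e]
      exact Multiset.cons_le_cons d he
    · rw [hW, ← Multiset.cons_le_cons_iff (val S), a3, ← Multiset.add_cons]
      exact add_le_add_right hc S
  · refine h.br c e (he.trans (Multiset.le_cons_self _ _)) ?_
    rw [hW]
    exact ((Multiset.le_cons_of_notMem hz).1 hc).trans (Multiset.le_add_left _ _)

/-- The contracted star is itself a branch over the old data; `D ≠ 0` supplies the spare degree that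
`Cond.br` requires. -/
lemma Cond.val_bounds {d : ℕ} {D : Multiset ℕ} {X Z S W : Multiset ℝ} (h : Cond (d ::ₘ D) X Z)
    (hd : Multiset.card S + 1 = d) (hW : X + Z = S + W) (hD : D ≠ 0) :
    (∀ x ∈ X, x ≤ val S) ∧ ∀ z ∈ Z, val S ≤ z := by
  obtain ⟨e, he⟩ := Multiset.exists_mem_of_ne_zero hD
  obtain ⟨l, hl⟩ : ∃ l : List ℝ, (l : Multiset ℝ) = S := Quot.exists_rep S
  obtain ⟨h1, h2, h3, h4, h5, h6⟩ := leaves_spec l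
  have : P (node (leaves l) nil) = val S := by
    rw [P, ta_node, si_node, h5, h6, val, ← hl]; simp
  rw [← this]
  refine h.br _ e ?_ ?_
  · obtain ⟨D', rfl⟩ := Multiset.exists_cons_of_mem he
    simp only [dg, h1, h2, add_zero]
    rw [← hd, ← hl, Multiset.coe_card, Multiset.cons_swap]
    exact Multiset.cons_le_cons _ (Multiset.cons_le_cons _ (Multiset.zero_le _))
  · rw [hW, al, h3, h4, hl, zero_add]; exact Multiset.le_add_right _ _

/-- No other branch beats the contracted star: its children are no more extreme than the elements of
`S`, and as `d` is the extreme degree their number is on the right side of the cardinality of `S`.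
So `prod_bound` compares the products, and `rel_branch_anti` reverses the comparison. -/
lemma Cond.val_rel {s : Bool} {d : ℕ} {D : Multiset ℕ} {X Z S W : Multiset ℝ}
    (h : Cond (d ::ₘ D) X Z) (hd : Multiset.card S + 1 = d) (hW : X + Z = S + W)
    (hD : ∀ e ∈ D, if s then e ≤ d else d ≤ e)
    (hS : ∀ y ∈ val S ::ₘ W, ∀ x ∈ S, rel s x y) (hSS : S ≤ if s then X else Z)
    {c : Fo} {e : ℕ} (he : e ::ₘ dg (node c nil) ≤ D) (hc : al c ≤ val S ::ₘ W) :
    rel s (P (node c nil)) (val S) := by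
  have hS' : ∀ x ∈ S, 0 < x ∧ x < 1 := fun x hx => h.ok x (by rw [hW]; simp [hx])
  have hok : ∀ x ∈ val S ::ₘ W, 0 < x ∧ x < 1 := by
    intro x hx
    rcases Multiset.mem_cons.1 hx with rfl | hx
    · exact (val_spec hS').2
    · exact h.ok x (by rw [hW]; simp [hx])
  have okc := al_pos hok hc
  rw [P_node okc, val]
  refine rel_branch_anti (prod_bounds hS').2 okc.P.2 (prod_bound (E := dg c) c hS' hok hS ?_ le_rfl hc ?_)
  · intro c' h1 h2 x hx
    have he' : e ::ₘ dg (node c' nil) ≤ D := by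
      refine le_trans (Multiset.cons_le_cons e (h1.trans ?_)) he
      simp only [dg, add_zero]; exact Multiset.le_cons_self _ _
    have := h.transfer hd hW he' h2
    cases s
    · exact this.2 x (Multiset.mem_of_le hSS hx)
    · exact this.1 x (Multiset.mem_of_le hSS hx)
  · have := hD (k c + 1) (Multiset.mem_of_le he (by simp [dg]))
    cases s <;> simp at this ⊢ <;> omega

/-- The degree `d` is reserved for the root, so it serves as the spare degree in `Cond.br` for every
branch with degrees in `D`. -/
lemma Cond.extr {s : Bool} {d : ℕ} {D : Multiset ℕ} {X Z S W : Multiset ℝ}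
    (h : Cond (d ::ₘ D) X Z) (hW : X + Z = S + W)
    (hS : ∀ y ∈ W, ∀ x ∈ S, rel s x y) (hSS : S ≤ if s then X else Z) : Extr s D S W := by
  rintro b (⟨y, rfl⟩ | ⟨c, rfl⟩) hb h1 h2 x hx
  · rw [P_leaf]
    exact hS y (Multiset.mem_of_le h2 (by simp [lv])) x hx
  · have := h.br c d (Multiset.cons_le_cons d hb) (by
      rw [hW]; exact add_le_add (by simpa [mv] using h1) (by simpa [lv] using h2))
    cases s
    · exact this.2 x (Multiset.mem_of_le hSS hx)
    · exact this.1 x (Multiset.mem_of_le hSS hx)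

/-- The smallest leaves can be attached to a node of the largest degree. -/
lemma small_move {d : ℕ} {D : Multiset ℕ} {S X Z : Multiset ℝ} (h : Cond (d ::ₘ D) (S + X) Z)
    (hd : Multiset.card S + 1 = d) (hD : ∀ e ∈ D, e ≤ d) (hD0 : D ≠ 0)
    (hS : ∀ x ∈ S, ∀ y ∈ X, x ≤ y) : Cond D X (val S ::ₘ Z) ∧
      ∀ V, LB D (X + val S ::ₘ Z) V → LB (d ::ₘ D) (S + X + Z) ((8 - 5 * S.prod) * V) := by
  have hW : S + X + Z = S + (X + Z) := add_assoc _ _ _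
  have hS' : ∀ x ∈ S, 0 < x ∧ x < 1 := fun x hx => h.ok x (by simp [hx])
  have v := h.val_bounds hd hW hD0
  have ext : ∀ y ∈ X + Z, ∀ x ∈ S, rel true x y := by
    intro y hy x hx
    rcases Multiset.mem_add.1 hy with hy | hy
    · exact hS x hx y hy
    · exact h.le x (by simp [hx]) y hy
  refine ⟨⟨?_, ?_, ?_⟩, fun V hV => ?_⟩
  · intro x hx
    rw [Multiset.add_cons, Multiset.mem_cons] at hx
    rcases hx with rfl | hx
    · exact (val_spec hS').2
    · exact h.ok x (by rw [hW]; exact Multiset.mem_add.2 (Or.inr hx))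
  · intro x hx z hz
    rcases Multiset.mem_cons.1 hz with rfl | hz
    · exact v.1 x (by simp [hx])
    · exact h.le x (by simp [hx]) z hz
  · intro c e he hc
    rw [Multiset.add_cons] at hc
    have := h.transfer hd hW he hc
    refine ⟨fun x hx => this.1 x (by simp [hx]), fun z hz => ?_⟩
    rcases Multiset.mem_cons.1 hz with rfl | hz
    · refine h.val_rel (s := true) hd hW (by simpa using hD) ?_ (by simp) he hc
      intro y hy x hx
      rcases Multiset.mem_cons.1 hy with rfl | hy
      · exact v.1 x (by simp [hx])
      · exact ext y hy x hx
    · exact this.2 z hz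
  · rw [hW]
    refine merge (s := true) (by simpa using hD) hd hD0 (by rw [← hW]; exact h.ok)
      (h.extr hW ext (by simp)) (val_spec hS').1 ?_
    rwa [Multiset.add_cons] at hV

/-- The largest leaves can be attached to a node of the smallest degree. -/
lemma large_move {d : ℕ} {D : Multiset ℕ} {S X Z : Multiset ℝ} (h : Cond (d ::ₘ D) X (S + Z))
    (hd : Multiset.card S + 1 = d) (hD : ∀ e ∈ D, d ≤ e) (hD0 : D ≠ 0)
    (hS : ∀ x ∈ S, ∀ y ∈ Z, y ≤ x) : Cond D (val S ::ₘ X) Z ∧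
      ∀ V, LB D (val S ::ₘ X + Z) V → LB (d ::ₘ D) (X + (S + Z)) ((8 - 5 * S.prod) * V) := by
  have hW : X + (S + Z) = S + (X + Z) := add_left_comm _ _ _
  have hS' : ∀ x ∈ S, 0 < x ∧ x < 1 := fun x hx => h.ok x (by simp [hx])
  have v := h.val_bounds hd hW hD0
  have ext : ∀ y ∈ X + Z, ∀ x ∈ S, rel false x y := by
    intro y hy x hx
    rcases Multiset.mem_add.1 hy with hy | hy
    · exact h.le y hy x (by simp [hx])
    · exact hS x hx y hy
  refine ⟨⟨?_, ?_, ?_⟩, fun V hV => ?_⟩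
  · intro x hx
    rw [Multiset.cons_add, Multiset.mem_cons] at hx
    rcases hx with rfl | hx
    · exact (val_spec hS').2
    · exact h.ok x (by rw [hW]; exact Multiset.mem_add.2 (Or.inr hx))
  · intro x hx z hz
    rcases Multiset.mem_cons.1 hx with rfl | hx
    · exact v.2 z (by simp [hz])
    · exact h.le x hx z (by simp [hz])
  · intro c e he hc
    rw [Multiset.cons_add] at hc
    have := h.transfer hd hW he hc
    refine ⟨fun x hx => ?_, fun z hz => this.2 z (by simp [hz])⟩
    rcases Multiset.mem_cons.1 hx with rfl | hx
    · refine h.val_rel (s := false) hd hW (by simpa using hD) ?_ (by simp) he hc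
      intro y hy x hx
      rcases Multiset.mem_cons.1 hy with rfl | hy
      · exact v.2 x (by simp [hx])
      · exact ext y hy x hx
    · exact this.1 x hx
  · rw [hW]
    refine merge (s := false) (by simpa using hD) hd hD0 (by rw [← hW]; exact h.ok)
      (h.extr hW ext (by simp)) (val_spec hS').1 ?_
    rwa [Multiset.cons_add] at hV

/-- A sequence of moves as in `small_move`; the last set of leaves is moved first. -/
lemma small_moves {D : Multiset ℕ} {Z : Multiset ℝ} (hD0 : D ≠ 0) (Ss : List (Multiset ℝ)) :
    ∀ {X}, Cond ((Ss.map fun S => Multiset.card S + 1 : List ℕ) + D) (Ss.sum + X) Z →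
    (Ss.Pairwise fun S S' => Multiset.card S ≤ Multiset.card S' ∧ ∀ x ∈ S', ∀ y ∈ S, x ≤ y) →
    (∀ S ∈ Ss, (∀ e ∈ D, e ≤ Multiset.card S + 1) ∧ ∀ x ∈ S, ∀ y ∈ X, x ≤ y) →
    Cond D X ((Ss.map val : List ℝ) + Z) ∧ ∀ V, LB D (X + ((Ss.map val : List ℝ) + Z)) V →
      LB ((Ss.map fun S => Multiset.card S + 1 : List ℕ) + D) (Ss.sum + X + Z)
        ((Ss.map fun S => 8 - 5 * S.prod).prod * V) := by
  induction Ss generalizing D with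
  | nil => intro X h _ _; simpa using h
  | cons S Ss ih =>
    intro X h hp hS
    rw [List.pairwise_cons] at hp
    have e1 : (((S :: Ss).map fun S => Multiset.card S + 1 : List ℕ) : Multiset ℕ) + D =
        (Ss.map fun S => Multiset.card S + 1 : List ℕ) + (Multiset.card S + 1) ::ₘ D := by
      simp [Multiset.add_cons]
      rw [← Multiset.cons_coe, Multiset.cons_add]
    have e2 : (S :: Ss).sum + X = Ss.sum + (S + X) := by
      rw [List.sum_cons, add_comm S, add_assoc]
    have e3 : (((S :: Ss).map val : List ℝ) : Multiset ℝ) + Z =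
        val S ::ₘ ((Ss.map val : List ℝ) + Z) := by
      rw [List.map_cons, ← Multiset.cons_coe, Multiset.cons_add]
    rw [e1, e2] at h ⊢
    rw [e3]
    obtain ⟨h1, h2⟩ := ih (by simp) h hp.2 (fun S' hS' => by
      refine ⟨fun e he => ?_, fun x hx y hy => ?_⟩
      · rcases Multiset.mem_cons.1 he with rfl | he
        · have := (hp.1 S' hS').1; omega
        · exact (hS S' (by simp [hS'])).1 e he
      · rcases Multiset.mem_add.1 hy with hy | hy
        · exact (hp.1 S' hS').2 x hx y hy
        · exact (hS S' (by simp [hS'])).2 x hx y hy)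
    obtain ⟨h3, h4⟩ := small_move h1 rfl (hS S (by simp)).1 hD0 (hS S (by simp)).2
    refine ⟨h3, fun V hV => ?_⟩
    have := h2 _ (h4 V hV)
    rwa [List.map_cons, List.prod_cons, mul_comm (8 - 5 * S.prod), mul_assoc]

/-- With a single inner vertex the tree is a star, so its weight is determined by the leaf values.
The greedy moves end here. -/
lemma LB_single {d : ℕ} {W : Multiset ℝ} : LB {d} W (8 - 5 * W.prod) := by
  intro f hf hm hl
  have h0 : dg f = 0 := by
    have := congrArg Multiset.card hf
    simpa using this
  have : ∀ g : Fo, dg g = 0 → mv g = 0 → ta g = 1 ∧ si g = (lv g).prod := by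
    intro g
    induction g with
    | nil => simp [lv]
    | leaf m x g ih =>
      cases m
      · intro h1 h2
        obtain ⟨h3, h4⟩ := ih h1 (by simpa [mv] using h2)
        simp [lv, h3, h4]
      · intro h1 h2; simp [mv] at h2
    | node c f _ _ => intro h; simp [dg] at h
  obtain ⟨h1, h2⟩ := this f h0 hm
  rw [rv, h1, h2, hl, mul_one]

/-- Initially all leaves have the smallest branch value. -/
lemma cond_initial (D : Multiset ℕ) (n : ℕ) : Cond D (Multiset.replicate n (2 / 3)) 0 := by
  have ok : ∀ x ∈ Multiset.replicate n (2 / 3 : ℝ) + 0, 0 < x ∧ x < 1 := by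
    intro x hx
    rw [add_zero] at hx
    rw [Multiset.eq_of_mem_replicate hx]; norm_num
  refine ⟨ok, by simp, fun c d _ hc => ⟨fun x hx => ?_, by simp⟩⟩
  rw [Multiset.eq_of_mem_replicate hx]
  have hp := (al_pos ok hc).P
  -- The decreasing function `(8 - 6p) / (8 - 5p)` takes the value `2 / 3` at `p = 1`, the quotient
  -- of the empty forest.
  rw [P_node (al_pos ok hc), le_div_iff₀ (by linarith)]
  linarith

end Fo

/-! ### Finite trees as labelled rooted forests -/

/-- Rooted forests whose vertices carry labels. -/
inductive LF (V : Type*) where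
  | nil : LF V
  | cons (v : V) (c f : LF V) : LF V

namespace LF

variable {V V' : Type*}

/-- Concatenation of forests. -/
def append : LF V → LF V → LF V
  | nil, g => g
  | cons v c f, g => cons v c (append f g)

/-- The labels of all vertices. -/
def labels : LF V → List V
  | nil => []
  | cons v c f => v :: (labels c ++ labels f)

/-- The labels of the roots. -/
def tops : LF V → List V
  | nil => []
  | cons v _ f => v :: tops f

/-- The number of neighbours of each vertex, where each root has a parent. -/
def degs : LF V → List ℕ
  | nil => []
  | cons _ c f => ((tops c).length + 1) :: (degs c ++ degs f)

/-- The labels of the vertices without children. -/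
def lfs : LF V → List V
  | nil => []
  | cons v nil f => v :: lfs f
  | cons _ (cons v c d) f => lfs (cons v c d) ++ lfs f

@[simp] lemma labels_append (f g : LF V) : labels (f.append g) = labels f ++ labels g := by
  induction f <;> simp_all [append, labels]

@[simp] lemma tops_append (f g : LF V) : tops (f.append g) = tops f ++ tops g := by
  induction f <;> simp_all [append, tops]

@[simp] lemma append_nil (f : LF V) : f.append nil = f := by
  induction f <;> simp_all [append]

lemma tops_subset (f : LF V) : tops f ⊆ labels f := by
  induction f with
  | nil => simp [tops]
  | cons v c f _ ih =>
    simp only [tops, labels]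
    exact List.cons_subset_cons _ fun u hu => List.mem_append_right _ (ih hu)

lemma tops_sublist (f : LF V) : List.Sublist (tops f) (labels f) := by
  induction f with
  | nil => simp [tops]
  | cons v c f _ ih =>
    exact (ih.trans (List.sublist_append_right _ _)).cons_cons _

lemma lfs_sublist (f : LF V) : List.Sublist (lfs f) (labels f) := by
  induction f with
  | nil => simp [lfs]
  | cons v c f ih1 ih2 =>
    cases c with
    | nil => exact ih2.cons_cons _
    | cons w c d => exact (ih1.append ih2).cons _

lemma tops_length_eq_zero {f : LF V} : (tops f).length = 0 ↔ f = nil := by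
  cases f <;> simp [tops]

lemma degs_length (f : LF V) : (degs f).length = (labels f).length := by
  induction f <;> simp_all [degs, labels]

/-- Handshake: every vertex of the forest owns the edge to its parent, and the upper ends of the
edges at the roots are missing from `degs`. -/
lemma degs_sum (f : LF V) : (tops f).length + (degs f).sum = 2 * (labels f).length := by
  induction f with
  | nil => rfl
  | cons v c f ih1 ih2 =>
    simp only [degs, labels, tops, List.length_cons, List.sum_cons, List.sum_append,
      List.length_append]
    omega

lemma degs_pos (f : LF V) : ∀ d ∈ degs f, 1 ≤ d := by
  induction f with
  | nil => simp [degs]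
  | cons v c f ih1 ih2 =>
    intro d hd
    simp only [degs, List.mem_cons, List.mem_append] at hd
    rcases hd with rfl | h | h
    · omega
    · exact ih1 d h
    · exact ih2 d h

lemma count_one_degs (f : LF V) : (degs f).count 1 = (lfs f).length := by
  induction f with
  | nil => rfl
  | cons v c f ih1 ih2 =>
    cases c with
    | nil => simp [degs, lfs, ih2, tops]
    | cons w c d =>
      have : ((tops (cons w c d)).length + 1 == 1) = false := by simp [tops]
      rw [degs, List.count_cons, this, List.count_append, ih1, ih2, lfs]; simp

/-- The neighbours of the vertices of the forest `f`, whose roots have the parent `p`, are as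
prescribed by `f`. -/
def Good (G : SimpleGraph V) (p : V) : LF V → Prop
  | nil => True
  | cons v c f => (∀ u, G.Adj v u ↔ u = p ∨ u ∈ tops c) ∧ Good G v c ∧ Good G p f

lemma good_append {G : SimpleGraph V} {p : V} {f g : LF V} :
    Good G p (f.append g) ↔ Good G p f ∧ Good G p g := by
  induction f <;> simp_all [append, Good, and_assoc]

/-- The graph `G` is the tree with root `r` and the components of `f` as its branches. -/
structure Rep (G : SimpleGraph V) (r : V) (f : LF V) : Prop where
  nodup : (r :: labels f).Nodup
  cover : ∀ v, v ∈ r :: labels f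
  root : ∀ u, G.Adj r u ↔ u ∈ tops f
  good : Good G r f

lemma Good.reachable {G : SimpleGraph V} {r p : V} {f : LF V} (h : Good G p f)
    (hp : G.Reachable r p) : ∀ v ∈ labels f, G.Reachable r v := by
  induction f generalizing p with
  | nil => simp [labels]
  | cons v c f ih1 ih2 =>
    intro u hu
    obtain ⟨h1, h2, h3⟩ := h
    have hv : G.Reachable r v := hp.trans ((h1 p).2 (Or.inl rfl)).symm.reachable
    simp only [labels, List.mem_cons, List.mem_append] at hu
    rcases hu with rfl | hu | hu
    · exact hv
    · exact ih1 h2 hv u hu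
    · exact ih2 h3 hp u hu

open Classical in
lemma degree_eq [Fintype V] {G : SimpleGraph V} {v : V} {l : List V} (hl : l.Nodup)
    (h : ∀ u, G.Adj v u ↔ u ∈ l) : G.degree v = l.length := by
  rw [← List.toFinset_card_of_nodup hl, ← SimpleGraph.card_neighborFinset_eq_degree]
  congr 1
  ext u; simp [h]

lemma nodup_cons_iff {p v : V} {c f : LF V} : (p :: labels (cons v c f)).Nodup ↔
    (p :: labels f).Nodup ∧ (v :: labels c).Nodup ∧ p ≠ v ∧ p ∉ labels c ∧ v ∉ labels f ∧
      List.Disjoint (labels c) (labels f) := by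
  simp only [labels, List.nodup_cons, List.mem_cons, List.mem_append, List.nodup_append']
  tauto

lemma nodup_nbr {p v : V} {c f : LF V} (h : (p :: labels (cons v c f)).Nodup) :
    (p :: tops c).Nodup := by
  obtain ⟨_, h2, h3, h4, _⟩ := nodup_cons_iff.1 h
  exact List.nodup_cons.2 ⟨fun hp => h4 (tops_subset c hp),
    (List.nodup_cons.1 h2).2.sublist (tops_sublist c)⟩

open Classical in
lemma Good.degs [Fintype V] {G : SimpleGraph V} {p : V} {f : LF V} (h : Good G p f)
    (hn : (p :: labels f).Nodup) : (labels f).map (fun v => G.degree v) = degs f := by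
  induction f generalizing p with
  | nil => rfl
  | cons v c f ih1 ih2 =>
    obtain ⟨h1, h2, h3⟩ := h
    have hn' := nodup_cons_iff.1 hn
    simp only [labels, LF.degs, List.map_cons, List.map_append, ih1 h2 hn'.2.1, ih2 h3 hn'.1]
    rw [degree_eq (nodup_nbr hn) (fun u => by rw [h1, List.mem_cons])]
    simp

variable {G : SimpleGraph V} {r : V} {f : LF V}

open Classical in
lemma Rep.univ [Fintype V] (h : Rep G r f) :
    (Finset.univ : Finset V).val = ((r :: labels f : List V) : Multiset V) := by
  refine (Multiset.Nodup.ext Finset.univ.nodup (Multiset.coe_nodup.2 h.nodup)).2 fun v => ?_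
  simpa using h.cover v

open Classical in
lemma Rep.degrees [Fintype V] (h : Rep G r f) :
    (Finset.univ : Finset V).val.map (fun v => G.degree v) =
      (((tops f).length :: degs f : List ℕ) : Multiset ℕ) := by
  rw [h.univ, Multiset.map_coe, List.map_cons, h.good.degs h.nodup,
    degree_eq ((List.nodup_cons.1 h.nodup).2.sublist (tops_sublist f)) h.root]

lemma Rep.degreeSequence [Fintype V] (h : Rep G r f) :
    (degreeSequence G : Multiset ℕ) = (((tops f).length :: degs f : List ℕ) : Multiset ℕ) := by
  rw [_root_.degreeSequence, Multiset.sort_eq, h.degrees]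

lemma Rep.card [Fintype V] (h : Rep G r f) : Fintype.card V = (labels f).length + 1 := by
  have := congrArg Multiset.card h.univ
  simpa using this

/-- All vertices are reachable from the root, and `degs_sum` gives one edge fewer than vertices. -/
lemma Rep.isTree [Fintype V] (h : Rep G r f) : G.IsTree := by
  classical
  have hr : ∀ v, G.Reachable r v := by
    intro v
    rcases List.mem_cons.1 (h.cover v) with rfl | hv
    · exact SimpleGraph.Reachable.refl _
    · exact h.good.reachable (SimpleGraph.Reachable.refl _) v hv
  rw [SimpleGraph.isTree_iff_connected_and_card]
  refine ⟨(SimpleGraph.connected_iff _).2 ⟨fun u v => (hr u).symm.trans (hr v), ⟨r⟩⟩, ?_⟩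
  have h1 := G.sum_degrees_eq_twice_card_edges
  have h2 : ∑ v, G.degree v = ((Finset.univ : Finset V).val.map fun v => G.degree v).sum := rfl
  rw [h2, h.degrees, Multiset.sum_coe, List.sum_cons, degs_sum] at h1
  rw [Nat.card_eq_fintype_card, Nat.card_eq_fintype_card, h.card, ← SimpleGraph.edgeFinset_card]
  omega

/-- The forest obtained from `f` by renaming the labels and attaching `g` to the vertex `w`. -/
noncomputable def graftF [DecidableEq V] (ι : V → V') (w : V) (g : LF V') : LF V → LF V'
  | nil => nil
  | cons v c f => cons (ι v) ((if v = w then g else nil).append (graftF ι w g c)) (graftF ι w g f)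

/-- The tree with root `r` and branches `f` with `g` attached to the vertex `w`. -/
noncomputable def graftT [DecidableEq V] (ι : V → V') (w : V) (g : LF V') (r : V) (f : LF V) : LF V' :=
  (if r = w then g else nil).append (graftF ι w g f)

variable [DecidableEq V] {ι : V → V'} {w : V} {g : LF V'}

@[simp] lemma tops_graftF (f : LF V) : tops (graftF ι w g f) = (tops f).map ι := by
  induction f <;> simp_all [graftF, tops]

lemma labels_graftF (f : LF V) (hf : (labels f).Nodup) : (labels (graftF ι w g f)).Perm
    ((labels f).map ι ++ if w ∈ labels f then labels g else []) := by
  induction f with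
  | nil => simp [graftF, labels]
  | cons v c f ih1 ih2 =>
    simp only [labels, List.nodup_cons, List.mem_append, List.nodup_append', not_or] at hf
    obtain ⟨⟨v1, v2⟩, hc, hf, hd⟩ := hf
    have i1 := ih1 hc
    have i2 := ih2 hf
    rw [← Multiset.coe_eq_coe] at i1 i2 ⊢
    have e : (labels (if v = w then g else nil)) = if v = w then labels g else [] := by
      split <;> rfl
    simp only [graftF, labels, labels_append, ← Multiset.cons_coe, ← Multiset.coe_add, i1, i2, e,
      List.map_cons, List.map_append, List.mem_cons, List.mem_append]
    by_cases h1 : v = w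
    · subst h1
      simp only [v1, v2, if_true, if_false, or_false,
        Multiset.coe_nil, add_zero, ← Multiset.singleton_add]; abel
    · have h1' : w ≠ v := fun h => h1 h.symm
      by_cases h2 : w ∈ labels c
      · have h3 : w ∉ labels f := fun h => hd h2 h
        simp only [h1, h1', h2, h3, if_true, if_false, false_or, or_false,
        Multiset.coe_nil, add_zero, ← Multiset.singleton_add]; abel
      · by_cases h3 : w ∈ labels f
        · simp [h1, h1', h2, h3]
        · simp [h1, h1', h2, h3]

lemma labels_graftT (f : LF V) (hf : (r :: labels f).Nodup) (hw : w ∈ r :: labels f) :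
    (ι r :: labels (graftT ι w g r f)).Perm ((r :: labels f).map ι ++ labels g) := by
  obtain ⟨h1, h2⟩ := List.nodup_cons.1 hf
  have i1 := labels_graftF (ι := ι) (w := w) (g := g) f h2
  rw [← Multiset.coe_eq_coe] at i1 ⊢
  have e : (labels (if r = w then g else nil)) = if r = w then labels g else [] := by
    split <;> rfl
  simp only [graftT, labels_append, ← Multiset.cons_coe, ← Multiset.coe_add, i1, e, List.map_cons]
  by_cases h : r = w
  · subst h; simp only [h1, if_true, if_false,
        Multiset.coe_nil, add_zero, ← Multiset.singleton_add]; abel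
  · have : w ∈ labels f := (List.mem_cons.1 hw).resolve_left fun h' => h h'.symm
    simp [h, this]

lemma Good.graft {G' : SimpleGraph V'} (h1 : ∀ v u', v ≠ w → (G'.Adj (ι v) u' ↔
      ∃ u, u' = ι u ∧ G.Adj v u))
    (h2 : ∀ u', G'.Adj (ι w) u' ↔ (∃ u, u' = ι u ∧ G.Adj w u) ∨ u' ∈ tops g)
    (hg : Good G' (ι w) g) {p : V} (h : Good G p f) : Good G' (ι p) (graftF ι w g f) := by
  induction f generalizing p with
  | nil => trivial
  | cons v c f ih1 ih2 =>
    obtain ⟨a1, a2, a3⟩ := h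
    refine ⟨fun u' => ?_, good_append.2 ⟨?_, ih1 a2⟩, ih2 a3⟩
    · by_cases hv : v = w
      · subst hv
        simp only [h2, a1, if_true, tops_append, tops_graftF, List.mem_append, List.mem_map]
        grind
      · simp only [h1 v u' hv, a1, hv, if_false, tops_append, tops_graftF, tops, List.nil_append,
          List.mem_map]
        grind
    · split
      · next hv => rw [hv]; exact hg
      · trivial

/-- A criterion in terms of neighbourhoods only. It serves both to put back a deleted leaf in
`exists_rep` and to describe the grafts of the M-tree in `rep_graft`. -/
lemma Rep.graft {G' : SimpleGraph V'} (hι : Function.Injective ι) (h : Rep G r f)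
    (h1 : ∀ v u', v ≠ w → (G'.Adj (ι v) u' ↔ ∃ u, u' = ι u ∧ G.Adj v u))
    (h2 : ∀ u', G'.Adj (ι w) u' ↔ (∃ u, u' = ι u ∧ G.Adj w u) ∨ u' ∈ tops g)
    (hg : Good G' (ι w) g) (hn : (labels g).Nodup) (hd : ∀ v, ι v ∉ labels g)
    (hc : ∀ v', v' ∈ labels g ∨ ∃ v, v' = ι v) : Rep G' (ι r) (graftT ι w g r f) := by
  have hp := labels_graftT (ι := ι) (g := g) f h.nodup (h.cover w)
  refine ⟨?_, fun v' => ?_, fun u' => ?_, ?_⟩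
  · rw [hp.nodup_iff, List.nodup_append']
    refine ⟨h.nodup.map hι, hn, fun v' hv => ?_⟩
    obtain ⟨v, _, rfl⟩ := List.mem_map.1 hv
    exact hd v
  · rw [hp.mem_iff, List.mem_append]
    rcases hc v' with h' | ⟨v, rfl⟩
    · exact Or.inr h'
    · exact Or.inl (List.mem_map_of_mem (h.cover v))
  · by_cases hr : r = w
    · subst hr
      simp only [h2, h.root, graftT, if_true, tops_append, tops_graftF, List.mem_append,
        List.mem_map]
      grind
    · simp only [h1 r u' hr, h.root, graftT, hr, if_false, tops_append, tops_graftF, tops,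
        List.nil_append, List.mem_map]
      grind
  · refine good_append.2 ⟨?_, Good.graft h1 h2 hg h.good⟩
    split
    · next hv => rw [hv]; exact hg
    · trivial

end LF

/-! ### Existence of a description with a prescribed root -/

namespace LF

open Classical in
/-- A tree with at least two vertices has a leaf that is different from a given vertex. -/
lemma exists_leaf_ne {V : Type*} [Fintype V] {G : SimpleGraph V} (hG : G.IsTree) (r : V)
    (h : 2 ≤ Fintype.card V) : ∃ u, u ≠ r ∧ G.degree u = 1 := by
  have : Nontrivial V := Fintype.one_lt_card_iff_nontrivial.1 h
  by_contra! hc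
  have hpos : ∀ v, 1 ≤ G.degree v := fun v => hG.connected.preconnected.degree_pos_of_nontrivial v
  have h1 := G.sum_degrees_eq_twice_card_edges
  have h2 := hG.card_edgeFinset
  rw [← Finset.add_sum_erase _ _ (Finset.mem_univ r)] at h1
  have h3 : (Finset.univ.erase r).card * 2 ≤ ∑ v ∈ Finset.univ.erase r, G.degree v := by
    refine Finset.card_nsmul_le_sum _ _ 2 fun v hv => ?_
    have := hpos v
    have := hc v (Finset.ne_of_mem_erase hv)
    omega
  rw [Finset.card_erase_of_mem (Finset.mem_univ r), Finset.card_univ] at h3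
  have := hpos r
  omega

/-- Every finite tree has a description as a rooted labelled forest, with any vertex as root. -/
lemma exists_rep (n : ℕ) : ∀ {V : Type*} [Fintype V] (G : SimpleGraph V), G.IsTree →
    Fintype.card V = n → ∀ r, ∃ f, Rep G r f := by
  classical
  induction n with
  | zero =>
    intro V _ G hG hn r
    exact (Fintype.card_eq_zero_iff.1 hn).elim r
  | succ n ih =>
    intro V _ G hG hn r
    rcases Nat.eq_zero_or_pos n with rfl | hpos
    · have : Subsingleton V := Fintype.card_le_one_iff_subsingleton.1 hn.le
      refine ⟨nil, ⟨by simp [labels], fun v => by simp [Subsingleton.elim v r], fun u => ?_, trivial⟩⟩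
      rw [Subsingleton.elim u r]; simp [tops]
    -- A leaf `u` other than the root is deleted, and then grafted back to its only neighbour `w`.
    · obtain ⟨u, hur, hu⟩ := exists_leaf_ne hG r (by omega)
      have hT : (G.induce {u}ᶜ).IsTree :=
        ⟨hG.connected.induce_compl_singleton_of_degree_eq_one hu, hG.isAcyclic.induce _⟩
      obtain ⟨w, hw, huniq⟩ := (SimpleGraph.degree_eq_one_iff_existsUnique_adj).1 hu
      obtain ⟨f, hf⟩ := ih (V := ({u}ᶜ : Set V)) (G.induce {u}ᶜ) hT
        (by rw [Fintype.card_compl_set]; simp [hn]) ⟨r, hur.symm⟩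
      have hwu : w ≠ u := hw.ne'
      refine ⟨_, hf.graft (w := ⟨w, hwu⟩) (g := cons u nil nil) Subtype.val_injective ?_ ?_ ?_ ?_ ?_ ?_⟩
      · intro v u' hv
        refine ⟨fun h => ⟨⟨u', ?_⟩, rfl, h⟩, ?_⟩
        · rintro rfl
          exact hv (Subtype.ext (huniq _ h.symm))
        · rintro ⟨x, rfl, h⟩; exact h
      · intro u'
        by_cases h : u' = u
        · subst h; simpa [tops] using hw.symm
        · simp [tops, h]
      · exact ⟨fun x => by simpa [tops] using ⟨fun h => huniq x h, fun h => h ▸ hw⟩, trivial, trivial⟩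
      · simp [labels]
      · intro v; simpa [labels] using show v.1 ≠ u from v.2
      · intro v
        by_cases h : v = u
        · left; simp [labels, h]
        · right; exact ⟨⟨v, h⟩, rfl⟩

end LF

/-! ### Counting solvable systems by elimination along the tree -/

namespace LF

variable {V : Type*}

open Classical in
/-- The indicator of a proposition. -/
noncomputable def ind (p : Prop) : ℤ := if p then 1 else 0

lemma ind_eq (p : Prop) [Decidable p] : ind p = if p then 1 else 0 := by
  unfold ind; split_ifs <;> rfl

lemma ind_and (p q : Prop) : ind (p ∧ q) = ind p * ind q := by
  by_cases hp : p <;> by_cases hq : q <;> simp [ind, hp, hq]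

/-- The relations between the variable of a vertex and the sum of the variables of its children
that occur as solution sets. -/
def Lagrange (S : ZMod 2 → ZMod 2 → Prop) : Prop :=
  (∃ m β, S = fun ξ s => s = m * ξ + β) ∨ (∃ β, S = fun ξ _ => ξ = β) ∨ S = fun _ _ => False

/-- The equation at a vertex with diagonal entry `a` and right hand side `b`, where `ξ` is the
variable of the parent, `x` that of the vertex, and `S` is the relation given by the children. -/
def Vertex (S : ZMod 2 → ZMod 2 → Prop) (a b ξ x : ZMod 2) : Prop :=
  ∃ s, S x s ∧ a * x + s + ξ = b

/-- Substituting `s = m * x + β` leaves `(a + m) * x + ξ = b + β`, which determines `x` from `ξ` if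
`a + m = 1` and otherwise fixes `ξ` with `x` free. If the children fix `x`, then `s` is free and
absorbs the equation. -/
lemma Lagrange.vertex {S : ZMod 2 → ZMod 2 → Prop} (h : Lagrange S) (a b : ZMod 2) :
    (∃ β, Vertex S a b = fun ξ x => x = ξ + β) ∨ (∃ β, Vertex S a b = fun ξ _ => ξ = β) ∨
      (∃ β, Vertex S a b = fun _ x => x = β) ∨ Vertex S a b = fun _ _ => False := by
  rcases h with ⟨m, β, rfl⟩ | ⟨β, rfl⟩ | rfl
  · by_cases h : a + m = 1
    · refine Or.inl ⟨b + β, ?_⟩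
      ext ξ x
      simp only [Vertex]
      revert a m β b ξ x; decide
    · refine Or.inr (Or.inl ⟨b + β, ?_⟩)
      ext ξ x
      simp only [Vertex]
      revert a m β b ξ x; decide
  · refine Or.inr (Or.inr (Or.inl ⟨β, ?_⟩))
    ext ξ x
    simp only [Vertex]
    revert a β b ξ x; decide
  · refine Or.inr (Or.inr (Or.inr ?_))
    ext ξ x
    simp [Vertex]

lemma Lagrange.add {S : ZMod 2 → ZMod 2 → Prop} (h : Lagrange S) {S' : ZMod 2 → ZMod 2 → Prop}
    (h' : Lagrange S') (a b : ZMod 2) :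
    Lagrange fun ξ s => ∃ x s', Vertex S a b ξ x ∧ S' ξ s' ∧ s = x + s' := by
  rcases h.vertex a b with ⟨β, e⟩ | ⟨β, e⟩ | ⟨β, e⟩ | e <;>
    rcases h' with ⟨m, γ, rfl⟩ | ⟨γ, rfl⟩ | rfl <;> rw [e] <;> clear h e
  · refine Or.inl ⟨1 + m, β + γ, ?_⟩
    ext ξ s; revert β m γ ξ s; decide
  · refine Or.inr (Or.inl ⟨γ, ?_⟩)
    ext ξ s; revert β γ ξ s; decide
  · right; right; simp
  · refine Or.inr (Or.inl ⟨β, ?_⟩)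
    ext ξ s; revert β m γ ξ s; decide
  · by_cases hβ : β = γ
    · refine Or.inr (Or.inl ⟨β, ?_⟩)
      ext ξ s; revert β γ ξ s; decide
    · refine Or.inr (Or.inr ?_)
      ext ξ s; revert β γ ξ s; decide
  · right; right; simp
  · refine Or.inl ⟨m, β + γ, ?_⟩
    ext ξ s; revert β m γ ξ s; decide
  · refine Or.inr (Or.inl ⟨γ, ?_⟩)
    ext ξ s; revert β γ ξ s; decide
  · right; right; simp
  all_goals right; right; simp

/-- If `S` allows both values of `x`, then `s = m * x + β`, and exactly one of the four pairs fails: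
`a = m` with the wrong `b`. If `S` allows one value of `x`, then `s` is free and all four work. The
right-hand side interpolates the numbers 3, 4 and 0. -/
lemma Lagrange.count {S : ZMod 2 → ZMod 2 → Prop} (h : Lagrange S) (ξ : ZMod 2) :
    ∑ q : ZMod 2 × ZMod 2, ind (∃ x, Vertex S q.1 q.2 ξ x) =
      4 * ind (∃ s, S 0 s) + 4 * ind (∃ s, S 1 s) - 5 * (ind (∃ s, S 0 s) * ind (∃ s, S 1 s)) := by
  rcases h with ⟨m, β, rfl⟩ | ⟨β, rfl⟩ | rfl
  · simp only [Vertex, ind_eq]; revert m β ξ; decide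
  · simp only [Vertex, ind_eq]; revert β ξ; decide
  · simp [Vertex, ind]

/-- As in `Lagrange.count`, but when both values of `x` are allowed, solvability for both `ξ` forces
`a ≠ m`, which leaves two pairs. -/
lemma Lagrange.count_both {S : ZMod 2 → ZMod 2 → Prop} (h : Lagrange S) :
    ∑ q : ZMod 2 × ZMod 2, ind (∃ x, Vertex S q.1 q.2 0 x) * ind (∃ x, Vertex S q.1 q.2 1 x) =
      4 * ind (∃ s, S 0 s) + 4 * ind (∃ s, S 1 s) - 6 * (ind (∃ s, S 0 s) * ind (∃ s, S 1 s)) := by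
  rcases h with ⟨m, β, rfl⟩ | ⟨β, rfl⟩ | rfl
  · simp only [Vertex, ind_eq]; revert m β; decide
  · simp only [Vertex, ind_eq]; revert β; decide
  · simp [Vertex, ind]

/-- The choices of a diagonal entry and a right hand side for each vertex. -/
def Cfg : LF V → Type
  | nil => Unit
  | cons _ c f => (ZMod 2 × ZMod 2) × Cfg c × Cfg f

instance Cfg.fintype : (f : LF V) → Fintype (Cfg f)
  | nil => inferInstanceAs (Fintype Unit)
  | cons _ c f => @instFintypeProd _ _ _ (@instFintypeProd _ _ (Cfg.fintype c) (Cfg.fintype f))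

/-- The relation between the variable `ξ` of the parent of the roots and the sum `s` of the
variables of the roots that is given by the equations at all vertices. -/
def Sol : (f : LF V) → Cfg f → ZMod 2 → ZMod 2 → Prop
  | nil, _ => fun ξ s => s = 0 * ξ + 0
  | cons _ c f, q => fun ξ s => ∃ x s', Vertex (Sol c q.2.1) q.1.1 q.1.2 ξ x ∧ Sol f q.2.2 ξ s' ∧
      s = x + s'

lemma Sol.lagrange (f : LF V) : ∀ q, Lagrange (Sol f q) := by
  induction f with
  | nil => exact fun _ => Or.inl ⟨0, 0, rfl⟩
  | cons v c f ih1 ih2 => exact fun q => (ih1 q.2.1).add (ih2 q.2.2) _ _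

/-- The numbers of solvable choices, for one value and for both values of the variable of the
parent. -/
def cnt : LF V → ℤ × ℤ
  | nil => (1, 1)
  | cons _ c f => ((8 * (cnt c).1 - 5 * (cnt c).2) * (cnt f).1,
      (8 * (cnt c).1 - 6 * (cnt c).2) * (cnt f).2)

/-- The two linear terms of `Lagrange.count` have equal sums because the count is the same for both
values of the parent's variable; this gives the coefficient 8. -/
lemma sum_vertex {f : LF V} (h : (∀ ξ, ∑ q, ind (∃ s, Sol f q ξ s) = (cnt f).1) ∧
    ∑ q, ind (∃ s, Sol f q 0 s) * ind (∃ s, Sol f q 1 s) = (cnt f).2) :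
    (∀ ξ, ∑ u : (ZMod 2 × ZMod 2) × Cfg f, ind (∃ x, Vertex (Sol f u.2) u.1.1 u.1.2 ξ x) =
      8 * (cnt f).1 - 5 * (cnt f).2) ∧
    ∑ u : (ZMod 2 × ZMod 2) × Cfg f, ind (∃ x, Vertex (Sol f u.2) u.1.1 u.1.2 0 x) *
      ind (∃ x, Vertex (Sol f u.2) u.1.1 u.1.2 1 x) = 8 * (cnt f).1 - 6 * (cnt f).2 := by
  constructor
  · intro ξ
    rw [Fintype.sum_prod_type, Finset.sum_comm]
    simp only [(Sol.lagrange f _).count]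
    rw [Finset.sum_sub_distrib, Finset.sum_add_distrib, ← Finset.mul_sum, ← Finset.mul_sum,
      ← Finset.mul_sum, h.1, h.1, h.2]
    ring
  · rw [Fintype.sum_prod_type, Finset.sum_comm]
    simp only [(Sol.lagrange f _).count_both]
    rw [Finset.sum_sub_distrib, Finset.sum_add_distrib, ← Finset.mul_sum, ← Finset.mul_sum,
      ← Finset.mul_sum, h.1, h.1, h.2]
    ring

/-- Siblings interact only through the variable `ξ` of their parent, so for fixed `ξ` they are
solvable independently. This makes the counts multiplicative. -/
lemma sol_cons {v : V} {c f : LF V} (q : Cfg (cons v c f)) (ξ : ZMod 2) :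
    (∃ s, Sol (cons v c f) q ξ s) ↔
      (∃ x, Vertex (Sol c q.2.1) q.1.1 q.1.2 ξ x) ∧ ∃ s, Sol f q.2.2 ξ s := by
  constructor
  · rintro ⟨s, x, s', h1, h2, -⟩
    exact ⟨⟨x, h1⟩, s', h2⟩
  · rintro ⟨⟨x, h1⟩, s', h2⟩
    exact ⟨_, x, s', h1, h2, rfl⟩

lemma sum_sol (f : LF V) : (∀ ξ, ∑ q, ind (∃ s, Sol f q ξ s) = (cnt f).1) ∧
    ∑ q, ind (∃ s, Sol f q 0 s) * ind (∃ s, Sol f q 1 s) = (cnt f).2 := by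
  induction f with
  | nil =>
    have : ∀ ξ, ∀ q : Cfg (nil : LF V), ind (∃ s, Sol nil q ξ s) = 1 := by
      intro ξ q; simp [Sol, ind]
    simp only [this]
    simp [cnt]
    rfl
  | cons v c f ih1 ih2 =>
    obtain ⟨h1, h2⟩ := sum_vertex ih1
    have key : ∀ (F : (ZMod 2 × ZMod 2) × Cfg c → ℤ) (H : Cfg f → ℤ),
        ∑ q : Cfg (cons v c f), F (q.1, q.2.1) * H q.2.2 = (∑ u, F u) * ∑ q, H q := by
      intro F H
      rw [Finset.sum_mul_sum, ← Fintype.sum_prod_type']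
      exact Fintype.sum_equiv (Equiv.prodAssoc _ _ _).symm _ _ fun q => rfl
    constructor
    · intro ξ
      simp only [sol_cons, ind_and]
      rw [key (fun u => ind (∃ x, Vertex (Sol c u.2) u.1.1 u.1.2 ξ x))
        (fun q => ind (∃ s, Sol f q ξ s)), h1, ih2.1, cnt]
    · simp only [sol_cons, ind_and]
      rw [cnt, ← h2, ← ih2.2, ← key (fun u => ind (∃ x, Vertex (Sol c u.2) u.1.1 u.1.2 0 x) *
        ind (∃ x, Vertex (Sol c u.2) u.1.1 u.1.2 1 x))]
      exact Finset.sum_congr rfl fun q _ => by ring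

/-- The choices for the vertices of the forest `f` given by the vectors `a` and `b`. -/
def cfg (a b : V → ZMod 2) : (f : LF V) → Cfg f
  | nil => ()
  | cons v c f => ((a v, b v), cfg a b c, cfg a b f)

/-- The vector `x` solves the equations at all vertices of the forest, whose roots have the
parent `p`. -/
def Rows (a b x : V → ZMod 2) (p : V) : LF V → Prop
  | nil => True
  | cons v c f => a v * x v + ((tops c).map x).sum + x p = b v ∧ Rows a b x v c ∧ Rows a b x p f

lemma Rows.congr {a b x y : V → ZMod 2} {p : V} {f : LF V} (h : Rows a b x p f)
    (hxy : ∀ v ∈ p :: labels f, x v = y v) : Rows a b y p f := by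
  induction f generalizing p with
  | nil => trivial
  | cons v c f ih1 ih2 =>
    obtain ⟨h1, h2, h3⟩ := h
    have e : (tops c).map x = (tops c).map y :=
      List.map_congr_left fun u hu => hxy u (by simp [labels, tops_subset c hu])
    refine ⟨?_, ih1 h2 fun u hu => hxy u ?_, ih2 h3 fun u hu => hxy u ?_⟩
    · rw [← e, ← hxy v (by simp [labels]), ← hxy p (by simp)]; exact h1
    · simp [labels] at hu ⊢; tauto
    · simp [labels] at hu ⊢; tauto

lemma sol_iff {a b : V → ZMod 2} {p : V} {f : LF V} (hn : (p :: labels f).Nodup) (ξ s : ZMod 2) :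
    Sol f (cfg a b f) ξ s ↔ ∃ x : V → ZMod 2, x p = ξ ∧ ((tops f).map x).sum = s ∧
      Rows a b x p f := by
  classical
  induction f generalizing p ξ s with
  | nil =>
    simp only [Sol, tops, Rows]
    constructor
    · rintro rfl; exact ⟨fun _ => ξ, rfl, by simp, trivial⟩
    · rintro ⟨x, _, h, _⟩; simpa using h.symm
  | cons v c f ih1 ih2 =>
    obtain ⟨n1, n2, n3, n4, n5, n6⟩ := nodup_cons_iff.1 hn
    simp only [Sol, Vertex, cfg, ih1 n2, ih2 n1]
    constructor
    · rintro ⟨x', s', ⟨t, ⟨x₁, e1, e2, e3⟩, e4⟩, ⟨x₂, e5, e6, e7⟩, rfl⟩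
      -- The solutions on the first tree and on its siblings with their parent live on disjoint sets
      -- of vertices, so they can be glued.
      obtain ⟨y, g1, g2⟩ : ∃ y : V → ZMod 2, (∀ u ∈ v :: labels c, x₁ u = y u) ∧
          ∀ u ∈ p :: labels f, x₂ u = y u := by
        refine ⟨fun u => if u ∈ v :: labels c then x₁ u else x₂ u,
          fun u hu => by simp only [hu, if_true], fun u hu => ?_⟩
        have : u ∉ v :: labels c := by
          rcases List.mem_cons.1 hu with rfl | hu
          · simp [n3, n4]
          · intro h
            rcases List.mem_cons.1 h with rfl | h
            · exact n5 hu
            · exact n6 h hu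
        simp only [this, if_false]
      refine ⟨y, ?_, ?_, ?_, e3.congr g1, e7.congr g2⟩
      · rw [← g2 p (by simp), e5]
      · rw [tops, List.map_cons, List.sum_cons, ← g1 v (by simp), e1, ← e6,
          List.map_congr_left fun u hu => (g2 u (by simp [tops_subset f hu])).symm]
      · rw [← g1 v (by simp), ← g2 p (by simp), e1, e5, ← e4, ← e2,
          List.map_congr_left fun u hu => (g1 u (by simp [tops_subset c hu])).symm]
    · rintro ⟨x, rfl, rfl, h1, h2, h3⟩
      exact ⟨x v, _, ⟨_, ⟨x, rfl, rfl, h2⟩, h1⟩, ⟨x, rfl, rfl, h3⟩, by simp [tops]⟩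

open Classical in
lemma row_eq [Fintype V] {G : SimpleGraph V} {v : V} {l : List V} (hl : l.Nodup)
    (h : ∀ u, G.Adj v u ↔ u ∈ l) (a x : V → ZMod 2) :
    Matrix.mulVec (G.adjMatrix (ZMod 2) + Matrix.diagonal a) x v = a v * x v + (l.map x).sum := by
  rw [Matrix.add_mulVec, Pi.add_apply, Matrix.mulVec_diagonal, SimpleGraph.adjMatrix_mulVec_apply,
    add_comm, ← List.sum_toFinset _ hl]
  congr 1
  refine Finset.sum_congr ?_ fun _ _ => rfl
  ext u; simp [h]

open Classical in
lemma Good.rows_iff [Fintype V] {G : SimpleGraph V} {p : V} {f : LF V} (h : Good G p f)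
    (hn : (p :: labels f).Nodup) (a b x : V → ZMod 2) : Rows a b x p f ↔ ∀ v ∈ labels f,
      Matrix.mulVec (G.adjMatrix (ZMod 2) + Matrix.diagonal a) x v = b v := by
  induction f generalizing p with
  | nil => simp [Rows, labels]
  | cons v c f ih1 ih2 =>
    obtain ⟨h1, h2, h3⟩ := h
    have hn' := nodup_cons_iff.1 hn
    simp only [Rows, labels, List.forall_mem_cons, List.forall_mem_append, ih1 h2 hn'.2.1,
      ih2 h3 hn'.1]
    rw [row_eq (nodup_nbr hn) (fun u => by rw [h1, List.mem_cons]), List.map_cons, List.sum_cons,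
      add_comm (x p), add_assoc]

open Classical in
-- The root is treated as a vertex with a fictitious parent whose variable is `0`.
lemma Rep.solvable_iff [Fintype V] {G : SimpleGraph V} {r : V} {f : LF V} (h : Rep G r f)
    (a b : V → ZMod 2) :
    (∃ x : V → ZMod 2, Matrix.mulVec (G.adjMatrix (ZMod 2) + Matrix.diagonal a) x = b) ↔
      ∃ x, Vertex (Sol f (cfg a b f)) (a r) (b r) 0 x := by
  have hr : ∀ x, Matrix.mulVec (G.adjMatrix (ZMod 2) + Matrix.diagonal a) x = b ↔
      a r * x r + ((tops f).map x).sum + 0 = b r ∧ Rows a b x r f := by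
    intro x
    rw [h.good.rows_iff h.nodup, add_zero, ← row_eq ((List.nodup_cons.1 h.nodup).2.sublist
      (tops_sublist f)) h.root, funext_iff, ← List.forall_mem_cons (p := fun v =>
        Matrix.mulVec (G.adjMatrix (ZMod 2) + Matrix.diagonal a) x v = b v)]
    exact ⟨fun H v _ => H v, fun H v => H v (h.cover v)⟩
  simp only [hr, Vertex, sol_iff h.nodup]
  constructor
  · rintro ⟨x, h1, h2⟩
    exact ⟨x r, _, ⟨x, rfl, rfl, h2⟩, h1⟩
  · rintro ⟨_, _, ⟨x, rfl, rfl, h2⟩, h1⟩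
    exact ⟨x, h1, h2⟩

lemma Cfg.card (f : LF V) : Fintype.card (Cfg f) = 4 ^ (labels f).length := by
  induction f with
  | nil => rfl
  | cons v c f ih1 ih2 =>
    have : Fintype.card (Cfg (cons v c f)) = 4 * (Fintype.card (Cfg c) * Fintype.card (Cfg f)) := by
      change Fintype.card ((ZMod 2 × ZMod 2) × Cfg c × Cfg f) = _
      rw [Fintype.card_prod, Fintype.card_prod, Fintype.card_prod, ZMod.card]
    rw [this, ih1, ih2, labels, List.length_cons, List.length_append]; ring

lemma cfg_injective {a b a' b' : V → ZMod 2} {f : LF V} (h : cfg a b f = cfg a' b' f) :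
    ∀ v ∈ labels f, a v = a' v ∧ b v = b' v := by
  induction f with
  | nil => simp [labels]
  | cons v c f ih1 ih2 =>
    have e1 : (a v, b v) = (a' v, b' v) := congrArg (fun q => q.1) h
    have e2 : cfg a b c = cfg a' b' c := congrArg (fun q => q.2.1) h
    have e3 : cfg a b f = cfg a' b' f := congrArg (fun q => q.2.2) h
    intro u hu
    simp only [labels, List.mem_cons, List.mem_append] at hu
    rcases hu with rfl | hu | hu
    · exact Prod.ext_iff.1 e1
    · exact ih1 e2 u hu
    · exact ih2 e3 u hu

open Classical in
/-- The solvability of a tree. -/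
theorem Rep.solvability [Fintype V] {G : SimpleGraph V} {r : V} {f : LF V} (h : Rep G r f) :
    (solvability G : ℤ) = 8 * (cnt f).1 - 5 * (cnt f).2 := by
  let φ : (V → ZMod 2) × (V → ZMod 2) → (ZMod 2 × ZMod 2) × Cfg f :=
    fun q => ((q.1 r, q.2 r), cfg q.1 q.2 f)
  have hφ : Function.Bijective φ := by
    rw [Fintype.bijective_iff_injective_and_card]
    constructor
    · rintro ⟨a, b⟩ ⟨a', b'⟩ hq
      simp only [φ, Prod.mk.injEq] at hq
      have : ∀ v, a v = a' v ∧ b v = b' v := fun v => by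
        rcases List.mem_cons.1 (h.cover v) with rfl | hv
        · exact hq.1
        · exact cfg_injective hq.2 v hv
      exact Prod.ext (funext fun v => (this v).1) (funext fun v => (this v).2)
    · simp only [Fintype.card_prod, Fintype.card_fun, ZMod.card, Cfg.card, h.card]
      rw [← mul_pow]; norm_num [pow_succ, mul_comm]
  rw [← (sum_vertex (sum_sol f)).1 0, ← (Equiv.ofBijective φ hφ).sum_comp]
  rw [_root_.solvability, Nat.card_eq_fintype_card, Fintype.card_subtype, Finset.card_filter]
  push_cast
  refine Finset.sum_congr rfl fun q _ => ?_
  rw [ind]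
  simp only [h.solvable_iff, φ, Equiv.ofBijective_apply]

end LF

/-! ### From labelled forests to weighted forests -/

namespace LF

variable {V V' : Type*}

/-- The forest of values of a labelled forest with a value for each leaf. -/
def toFo (y : V → ℝ) : LF V → Fo
  | nil => .nil
  | cons v nil f => .leaf false (y v) (toFo y f)
  | cons _ (cons v c d) f => .node (toFo y (cons v c d)) (toFo y f)

lemma toFo_cons (y : V → ℝ) {v : V} {c f : LF V} (hc : c ≠ nil) :
    toFo y (cons v c f) = .node (toFo y c) (toFo y f) := by
  cases c with
  | nil => exact absurd rfl hc
  | cons => rfl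

lemma lfs_cons {v : V} {c f : LF V} (hc : c ≠ nil) : lfs (cons v c f) = lfs c ++ lfs f := by
  cases c with
  | nil => exact absurd rfl hc
  | cons => rfl

lemma toFo_spec (y : V → ℝ) (f : LF V) : Fo.k (toFo y f) = (tops f).length ∧
    Fo.dg (toFo y f) = ((degs f).filter (2 ≤ ·) : List ℕ) ∧ Fo.mv (toFo y f) = 0 ∧
    Fo.lv (toFo y f) = ((lfs f).map y : List ℝ) := by
  induction f with
  | nil => simp [toFo, Fo.k, Fo.dg, Fo.mv, Fo.lv, tops, degs, lfs]
  | cons v c f ih1 ih2 =>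
    obtain ⟨b1, b2, b3, b4⟩ := ih2
    cases c with
    | nil => simp [toFo, Fo.k, Fo.dg, Fo.mv, Fo.lv, tops, degs, lfs, b1, b2, b3, b4]
    | cons w c d =>
      obtain ⟨a1, a2, a3, a4⟩ := ih1
      rw [toFo_cons y (by simp), lfs_cons (by simp)]
      generalize hC : cons w c d = C at *
      have hC' : (tops C).length ≠ 0 := by rw [← hC]; simp [tops]
      have h2 : 2 ≤ (tops C).length + 1 := by omega
      simp only [Fo.k, Fo.dg, Fo.mv, Fo.lv, tops, degs, a1, a2, a3, a4, b1, b2, b3, b4]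
      simp [h2]

/-- For the leaf value `2 / 3` the weights are, up to a power of `3`, numbers of solvable
choices. -/
lemma cnt_eq (f : LF V) :
    ((cnt f).1 : ℝ) = 3 ^ (lfs f).length * Fo.ta (toFo (fun _ => 2 / 3) f) ∧
    ((cnt f).2 : ℝ) = 3 ^ (lfs f).length * Fo.si (toFo (fun _ => 2 / 3) f) := by
  induction f with
  | nil => simp [cnt, lfs, toFo]
  | cons v c f ih1 ih2 =>
    by_cases hc : c = nil
    · subst hc
      simp only [cnt, toFo, lfs, List.length_cons, Fo.ta_leaf, Fo.si_leaf]
      push_cast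
      rw [ih2.1, ih2.2]
      constructor <;> ring
    · rw [toFo_cons _ hc, lfs_cons hc]
      simp only [cnt, List.length_append, Fo.ta_node, Fo.si_node]
      push_cast
      rw [ih1.1, ih1.2, ih2.1, ih2.2]
      constructor <;> ring

section graft

variable [DecidableEq V] {ι : V → V'} {w : V} {g : LF V'}

lemma graftF_eq_nil {f : LF V} : graftF ι w g f = nil ↔ f = nil := by
  cases f <;> simp [graftF]

lemma toFo_graftF_of_notMem (y : V' → ℝ) (y₀ : V → ℝ) {f : LF V} (hw : w ∉ labels f)
    (hy : ∀ u ≠ w, y₀ u = y (ι u)) : toFo y (graftF ι w g f) = toFo y₀ f := by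
  induction f with
  | nil => rfl
  | cons v c f ih1 ih2 =>
    simp only [labels, List.mem_cons, List.mem_append, not_or] at hw
    have hv : v ≠ w := fun h => hw.1 h.symm
    rw [graftF, if_neg hv]
    by_cases hc : c = nil
    · subst hc
      simp [append, graftF, toFo, ih2 hw.2.2, hy v hv]
    · rw [toFo_cons _ hc, append, toFo_cons _ (by rwa [Ne, graftF_eq_nil]), ih1 hw.2.1,
        ih2 hw.2.2]

/-- Grafting a forest to a leaf has the effect of a node in place of that leaf. -/
lemma toFo_graftF {y : V' → ℝ} {y₀ : V → ℝ} {f : LF V} (hn : (labels f).Nodup) (hw : w ∈ lfs f)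
    (hg : g ≠ nil) (hy : ∀ u ≠ w, y₀ u = y (ι u)) {B : ℝ}
    (hB : 8 * Fo.ta (toFo y g) - 5 * Fo.si (toFo y g) = B)
    (hq : 8 * Fo.ta (toFo y g) - 6 * Fo.si (toFo y g) = B * y₀ w) :
    Fo.ta (toFo y (graftF ι w g f)) = B * Fo.ta (toFo y₀ f) ∧
    Fo.si (toFo y (graftF ι w g f)) = B * Fo.si (toFo y₀ f) ∧
    Fo.dg (toFo y (graftF ι w g f)) = ((tops g).length + 1) ::ₘ
      (Fo.dg (toFo y g) + Fo.dg (toFo y₀ f)) ∧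
    y₀ w ::ₘ Fo.lv (toFo y (graftF ι w g f)) = Fo.lv (toFo y g) + Fo.lv (toFo y₀ f) := by
  induction f with
  | nil => simp [lfs] at hw
  | cons v c f ih1 ih2 =>
    simp only [labels, List.nodup_cons, List.mem_append, List.nodup_append', not_or] at hn
    obtain ⟨⟨v1, v2⟩, hc, hf, hd⟩ := hn
    by_cases hcn : c = nil
    · subst hcn
      by_cases hv : v = w
      · subst hv
        have : (if v = v then g else nil).append (graftF ι v g nil) = g := by simp [graftF]
        rw [graftF, this, toFo_cons _ hg, toFo, toFo_graftF_of_notMem y y₀ v2 hy]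
        simp only [Fo.ta_node, Fo.si_node, Fo.ta_leaf, Fo.si_leaf, hB, hq, Fo.dg, Fo.lv,
          (toFo_spec y g).1]
        refine ⟨trivial, by ring, trivial, ?_⟩
        simp
      · have hw' : w ∈ lfs f := by
          simp only [lfs, List.mem_cons] at hw
          exact hw.resolve_left fun h => hv h.symm
        obtain ⟨i1, i2, i3, i4⟩ := ih2 hf hw'
        have : (if v = w then g else nil).append (graftF ι w g nil) = nil := by
          simp [hv, graftF]
        rw [graftF, this]
        simp only [toFo, Fo.ta_leaf, Fo.si_leaf, Fo.dg, Fo.lv, i1, i2, i3, hy v hv]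
        refine ⟨trivial, by ring, trivial, ?_⟩
        simp only [Bool.false_eq_true, if_false, Multiset.singleton_add]
        rw [Multiset.cons_swap, i4, Multiset.add_cons]
    · rw [lfs_cons hcn, List.mem_append] at hw
      have hv : v ≠ w := by
        rintro rfl
        exact hw.elim (fun h => v1 ((lfs_sublist c).subset h))
          fun h => v2 ((lfs_sublist f).subset h)
      rw [graftF, if_neg hv, append, toFo_cons _ (by rwa [Ne, graftF_eq_nil]), toFo_cons _ hcn]
      have hk : Fo.k (toFo y (graftF ι w g c)) = Fo.k (toFo y₀ c) := by
        rw [(toFo_spec _ _).1, (toFo_spec _ _).1, tops_graftF, List.length_map]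
      rcases hw with hw | hw
      · obtain ⟨i1, i2, i3, i4⟩ := ih1 hc hw
        rw [toFo_graftF_of_notMem y y₀ (fun h => hd ((lfs_sublist c).subset hw) h) hy]
        simp only [Fo.ta_node, Fo.si_node, Fo.dg, Fo.lv, i1, i2, i3, hk]
        refine ⟨by ring, by ring, ?_, ?_⟩
        · rw [Multiset.cons_add, Multiset.cons_swap, Multiset.add_cons, add_assoc]
        · rw [← Multiset.cons_add, i4, add_assoc]
      · obtain ⟨i1, i2, i3, i4⟩ := ih2 hf hw
        rw [toFo_graftF_of_notMem y y₀ (fun h => hd h ((lfs_sublist f).subset hw)) hy] at hk ⊢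
        simp only [Fo.ta_node, Fo.si_node, Fo.dg, Fo.lv, i1, i2, i3]
        refine ⟨by ring, by ring, ?_, ?_⟩
        · rw [Multiset.add_cons, Multiset.cons_swap, Multiset.add_cons, add_left_comm]
        · rw [← Multiset.add_cons, i4, add_left_comm]

end graft

/-- The forest with roots `h i` and branches `c i`, for `i` in a list. -/
def branches {I : Type*} (h : I → V) (c : I → LF V) : List I → LF V
  | [] => nil
  | i :: l => cons (h i) (c i) (branches h c l)

section branches

variable {I : Type*} {h : I → V} {c : I → LF V}

lemma tops_branches (l : List I) : tops (branches h c l) = l.map h := by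
  induction l <;> simp_all [branches, tops]

lemma labels_branches (l : List I) :
    labels (branches h c l) = l.flatMap fun i => h i :: labels (c i) := by
  induction l <;> simp_all [branches, labels]

lemma good_branches {G : SimpleGraph V} {p : V} (l : List I) : Good G p (branches h c l) ↔
    ∀ i ∈ l, (∀ u, G.Adj (h i) u ↔ u = p ∨ u ∈ tops (c i)) ∧ Good G (h i) (c i) := by
  induction l <;> simp_all [branches, Good, and_assoc]

lemma toFo_branches_leaves (y : V → ℝ) (l : List I) :
    toFo y (branches h (fun _ => nil) l) = Fo.leaves (l.map fun i => y (h i)) := by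
  induction l <;> simp_all [branches, toFo, Fo.leaves]

lemma branches_eq_nil (l : List I) : branches h c l = nil ↔ l = [] := by
  cases l <;> simp [branches]

end branches

end LF

/-! ### The stars of a graft and its graph -/

namespace LF

open LabelledGraph

section stars

variable {W : Type} {es : List ℕ}

/-- The root of the `i`-th star. -/
def sRoot (i : Fin es.length) : W ⊕ StarVertices es := .inr ⟨i, none⟩

/-- A leaf of a star. -/
def sLeaf (p : Σ i : Fin es.length, Fin (es.get i - 1)) : W ⊕ StarVertices es :=
  .inr ⟨p.1, some p.2⟩

lemma sRoot_inj {i i' : Fin es.length} : (sRoot i : W ⊕ StarVertices es) = sRoot i' ↔ i = i' := by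
  refine ⟨fun h => ?_, fun h => h ▸ rfl⟩
  simp only [sRoot, Sum.inr.injEq, Sigma.mk.injEq] at h
  exact h.1

lemma sLeaf_inj {p p' : Σ i : Fin es.length, Fin (es.get i - 1)} :
    (sLeaf p : W ⊕ StarVertices es) = sLeaf p' ↔ p = p' := by
  refine ⟨fun h => ?_, fun h => h ▸ rfl⟩
  obtain ⟨i, j⟩ := p
  obtain ⟨i', j'⟩ := p'
  simp only [sLeaf, Sum.inr.injEq, Sigma.mk.injEq] at h
  obtain ⟨rfl, h⟩ := h
  rw [Option.some_injective _ (eq_of_heq h)]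

lemma sRoot_ne_sLeaf {i : Fin es.length} {p : Σ i : Fin es.length, Fin (es.get i - 1)} :
    (sRoot i : W ⊕ StarVertices es) ≠ sLeaf p := by
  intro h
  obtain ⟨i', j'⟩ := p
  simp only [sLeaf, sRoot, Sum.inr.injEq, Sigma.mk.injEq] at h
  obtain ⟨rfl, h⟩ := h
  exact Option.some_ne_none _ (eq_of_heq h).symm

lemma inl_ne_sRoot {a : W} {i : Fin es.length} : (.inl a : W ⊕ StarVertices es) ≠ sRoot i :=
  Sum.inl_ne_inr

lemma inl_ne_sLeaf {a : W} {p : Σ i : Fin es.length, Fin (es.get i - 1)} :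
    (.inl a : W ⊕ StarVertices es) ≠ sLeaf p :=
  Sum.inl_ne_inr

lemma graft_cases (v : W ⊕ StarVertices es) :
    (∃ a, v = .inl a) ∨ (∃ i, v = sRoot i) ∨ ∃ p, v = sLeaf p := by
  rcases v with a | ⟨i, _ | j⟩
  · exact Or.inl ⟨a, rfl⟩
  · exact Or.inr (Or.inl ⟨i, rfl⟩)
  · exact Or.inr (Or.inr ⟨⟨i, j⟩, rfl⟩)

variable (W es)

/-- The leaves of the `i`-th star. -/
def starLeaves (i : Fin es.length) : LF (W ⊕ StarVertices es) :=
  branches (fun j => sLeaf ⟨i, j⟩) (fun _ => .nil) (List.finRange (es.get i - 1))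

/-- The stars that are added when a graph is grafted. -/
def stars : LF (W ⊕ StarVertices es) :=
  branches (fun i => sRoot i) (starLeaves W es) (List.finRange es.length)

variable {W es}

/-- The values of the leaves of the `i`-th star. -/
def starVals (y : W ⊕ StarVertices es → ℝ) (i : Fin es.length) : Multiset ℝ :=
  ((List.finRange (es.get i - 1)).map fun j => y (sLeaf ⟨i, j⟩) : List ℝ)

lemma card_starVals (y : W ⊕ StarVertices es → ℝ) (i : Fin es.length) :
    Multiset.card (starVals y i) = es.get i - 1 := by
  simp [starVals]

lemma mem_starVals {y : W ⊕ StarVertices es → ℝ} {i : Fin es.length} {x : ℝ} :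
    x ∈ starVals y i ↔ ∃ j, y (sLeaf ⟨i, j⟩) = x := by
  simp [starVals]

lemma starLeaves_eq_nil {i : Fin es.length} : starLeaves W es i = .nil ↔ ¬ 2 ≤ es.get i := by
  rw [starLeaves, branches_eq_nil, ← List.length_eq_zero_iff, List.length_finRange]
  omega

lemma toFo_stars (y : W ⊕ StarVertices es → ℝ) (l : List (Fin es.length)) :
    Fo.ta (toFo y (branches (fun i => sRoot i) (starLeaves W es) l)) =
      ((l.filter fun i => 2 ≤ es.get i).map fun i => 8 - 5 * (starVals y i).prod).prod ∧
    Fo.si (toFo y (branches (fun i => sRoot i) (starLeaves W es) l)) =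
      ((l.filter fun i => 2 ≤ es.get i).map fun i => 8 - 6 * (starVals y i).prod).prod *
        ((l.filter fun i => ¬ 2 ≤ es.get i).map fun i => y (sRoot i)).prod ∧
    Fo.dg (toFo y (branches (fun i => sRoot i) (starLeaves W es) l)) =
      ((l.filter fun i => 2 ≤ es.get i).map fun i => es.get i : List ℕ) ∧
    Fo.lv (toFo y (branches (fun i => sRoot i) (starLeaves W es) l)) =
      ((l.filter fun i => 2 ≤ es.get i).map (starVals y)).sum +
        ((l.filter fun i => ¬ 2 ≤ es.get i).map fun i => y (sRoot i) : List ℝ) := by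
  induction l with
  | nil => simp [branches, toFo, Fo.dg, Fo.lv]
  | cons i l ih =>
    obtain ⟨i1, i2, i3, i4⟩ := ih
    by_cases hi : 2 ≤ es.get i
    · have hi' : ¬ ¬ 2 ≤ es.get i := not_not.2 hi
      have hc : starLeaves W es i ≠ .nil := fun h => starLeaves_eq_nil.1 h hi
      obtain ⟨a1, a2, a3, a4, a5, a6⟩ :=
        Fo.leaves_spec ((List.finRange (es.get i - 1)).map fun j => y (sLeaf ⟨i, j⟩))
      have hl : toFo y (starLeaves W es i) =
        Fo.leaves ((List.finRange (es.get i - 1)).map fun j => y (sLeaf ⟨i, j⟩)) :=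
        toFo_branches_leaves y _
      rw [branches, toFo_cons y hc, hl, List.filter_cons_of_pos (by simpa using hi),
        List.filter_cons_of_neg (by simpa only [decide_eq_true_eq] using hi')]
      simp only [Fo.ta_node, Fo.si_node, Fo.dg, Fo.lv, a1, a2, a4, a5, a6, i1, i2, i3, i4,
        List.map_cons, List.prod_cons, List.sum_cons]
      have e : (starVals y i).prod =
        ((List.finRange (es.get i - 1)).map fun j => y (sLeaf ⟨i, j⟩)).prod :=
        Multiset.prod_coe _
      refine ⟨by rw [e, mul_one], by rw [e]; ring, ?_, by rw [add_assoc]; rfl⟩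
      rw [zero_add, List.length_map, List.length_finRange, Nat.sub_add_cancel (by omega)]
      rfl
    · rw [branches, starLeaves_eq_nil.2 hi, List.filter_cons_of_neg (by simpa only [decide_eq_true_eq] using hi),
        List.filter_cons_of_pos (by simpa only [decide_eq_true_eq] using hi)]
      simp only [toFo, Fo.ta_leaf, Fo.si_leaf, Fo.dg, Fo.lv, i1, i2, i3, i4,
        List.map_cons, List.prod_cons]
      refine ⟨trivial, by ring, trivial, ?_⟩
      simp [← Multiset.cons_coe]

end stars

section graft

variable (M : LabelledGraph) (w : M.V) (es : List ℕ)

/-- The graph of `M.graft w es`. -/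
def graftGraph : SimpleGraph (M.V ⊕ StarVertices es) := SimpleGraph.fromRel (M.graftRel w es)

lemma adj_inl_inl (a b : M.V) :
    (graftGraph M w es).Adj (.inl a) (.inl b) ↔ M.graph.Adj a b := by
  simp only [graftGraph, SimpleGraph.fromRel_adj, graftRel]
  constructor
  · rintro ⟨_, h | h⟩
    · exact h
    · exact h.symm
  · exact fun h => ⟨by simpa using h.ne, Or.inl h⟩

lemma adj_inl_root (a : M.V) (i : Fin es.length) :
    (graftGraph M w es).Adj (.inl a) (sRoot i) ↔ a = w := by
  simp [graftGraph, SimpleGraph.fromRel_adj, graftRel, sRoot]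

lemma adj_inl_leaf (a : M.V) (p) : ¬ (graftGraph M w es).Adj (.inl a) (sLeaf p) := by
  simp [graftGraph, SimpleGraph.fromRel_adj, graftRel, sLeaf]

lemma adj_root_inl (a : M.V) (i : Fin es.length) :
    (graftGraph M w es).Adj (sRoot i) (.inl a) ↔ a = w := by
  rw [SimpleGraph.adj_comm, adj_inl_root]

lemma adj_leaf_inl (a : M.V) (p) : ¬ (graftGraph M w es).Adj (sLeaf p) (.inl a) := by
  rw [SimpleGraph.adj_comm]; exact adj_inl_leaf M w es a p

lemma adj_root_leaf (i : Fin es.length) (p) :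
    (graftGraph M w es).Adj (sRoot i) (sLeaf p) ↔ p.1 = i := by
  rw [graftGraph, SimpleGraph.fromRel_adj, and_iff_right sRoot_ne_sLeaf]
  simp only [graftRel, sRoot, sLeaf, or_false]
  exact eq_comm

lemma adj_leaf_root (i : Fin es.length) (p) :
    (graftGraph M w es).Adj (sLeaf p) (sRoot i) ↔ p.1 = i := by
  rw [SimpleGraph.adj_comm, adj_root_leaf]

lemma adj_root_root (i i' : Fin es.length) :
    ¬ (graftGraph M w es).Adj (sRoot i) (sRoot i') := by
  simp [graftGraph, SimpleGraph.fromRel_adj, graftRel, sRoot]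

lemma adj_leaf_leaf (p p') : ¬ (graftGraph M w es).Adj (sLeaf p) (sLeaf p') := by
  simp [graftGraph, SimpleGraph.fromRel_adj, graftRel, sLeaf]

variable {M w es}

lemma mem_star {i : Fin es.length} {v : M.V ⊕ StarVertices es} :
    v ∈ (List.finRange (es.get i - 1)).map (fun j => sLeaf ⟨i, j⟩) ↔
      ∃ p : Σ i : Fin es.length, Fin (es.get i - 1), p.1 = i ∧ v = sLeaf p := by
  rw [List.mem_map]
  constructor
  · rintro ⟨j, _, rfl⟩; exact ⟨⟨i, j⟩, rfl, rfl⟩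
  · rintro ⟨⟨i', j⟩, rfl, rfl⟩; exact ⟨j, List.mem_finRange _, rfl⟩

lemma tops_starLeaves (i : Fin es.length) : tops (starLeaves M.V es i) =
    (List.finRange (es.get i - 1)).map fun j => sLeaf ⟨i, j⟩ := tops_branches _

lemma tops_stars : tops (stars M.V es) = (List.finRange es.length).map sRoot := tops_branches _

lemma labels_starLeaves (i : Fin es.length) : labels (starLeaves M.V es i) =
    (List.finRange (es.get i - 1)).map fun j => sLeaf ⟨i, j⟩ := by
  rw [starLeaves, labels_branches]
  exact List.map_eq_flatMap.symm

lemma labels_stars : labels (stars M.V es) = (List.finRange es.length).flatMap fun i =>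
    sRoot i :: (List.finRange (es.get i - 1)).map fun j => sLeaf ⟨i, j⟩ := by
  rw [stars, labels_branches]; simp only [labels_starLeaves]

open Classical in
lemma rep_graft {r : M.V} {f : LF M.V} (h : Rep M.graph r f) :
    Rep (graftGraph M w es) (.inl r) (graftT Sum.inl w (stars M.V es) r f) := by
  refine h.graft Sum.inl_injective ?_ ?_ ?_ ?_ ?_ ?_
  · intro v u hv
    rcases graft_cases u with ⟨b, rfl⟩ | ⟨i, rfl⟩ | ⟨p, rfl⟩
    · simp [adj_inl_inl]
    · simp [adj_inl_root, hv, inl_ne_sRoot.symm]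
    · simp [adj_inl_leaf, inl_ne_sLeaf.symm]
  · intro u
    rcases graft_cases u with ⟨b, rfl⟩ | ⟨i, rfl⟩ | ⟨p, rfl⟩
    · simp [adj_inl_inl, tops_stars, inl_ne_sRoot.symm]
    · simp [adj_inl_root, tops_stars, sRoot_inj]
    · simp [adj_inl_leaf, tops_stars, sRoot_ne_sLeaf, inl_ne_sLeaf.symm]
  · refine (good_branches _).2 fun i _ => ⟨fun u => ?_, (good_branches _).2 fun j _ =>
      ⟨fun u => ?_, trivial⟩⟩
    · rw [tops_starLeaves, mem_star]
      rcases graft_cases u with ⟨b, rfl⟩ | ⟨i', rfl⟩ | ⟨p, rfl⟩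
      · simp [adj_root_inl, inl_ne_sLeaf]
      · simp [adj_root_root, sRoot_ne_sLeaf, inl_ne_sRoot.symm]
      · rw [adj_root_leaf]
        refine ⟨fun h => Or.inr ⟨p, h, rfl⟩, ?_⟩
        rintro (h | ⟨q, h, h'⟩)
        · exact absurd h inl_ne_sLeaf.symm
        · rw [sLeaf_inj.1 h', h]
    · rcases graft_cases u with ⟨b, rfl⟩ | ⟨i', rfl⟩ | ⟨p, rfl⟩
      · simp [adj_leaf_inl, inl_ne_sRoot, tops]
      · rw [adj_leaf_root, sRoot_inj]; simp [tops, eq_comm]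
      · simp [adj_leaf_leaf, tops, sRoot_ne_sLeaf.symm]
  · rw [labels_stars, List.nodup_flatMap]
    refine ⟨fun i _ => ?_, ?_⟩
    · rw [List.nodup_cons, mem_star]
      refine ⟨fun ⟨p, _, h⟩ => sRoot_ne_sLeaf h, (List.nodup_finRange _).map fun j j' e => ?_⟩
      exact eq_of_heq (Sigma.mk.inj (sLeaf_inj.1 e)).2
    · refine (List.nodup_finRange _).imp fun {i i'} hii => ?_
      intro x hx hx'
      rw [List.mem_cons, mem_star] at hx hx'
      rcases hx with rfl | ⟨p, rfl, rfl⟩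
      · rcases hx' with h | ⟨p, rfl, h⟩
        · exact hii (sRoot_inj.1 h)
        · exact sRoot_ne_sLeaf h
      · rcases hx' with h | ⟨q, rfl, h⟩
        · exact sRoot_ne_sLeaf h.symm
        · exact hii (by rw [sLeaf_inj.1 h])
  · intro v hv
    rw [labels_stars, List.mem_flatMap] at hv
    obtain ⟨i, _, hv⟩ := hv
    rw [List.mem_cons, mem_star] at hv
    rcases hv with h | ⟨p, _, h⟩
    · exact inl_ne_sRoot h
    · exact inl_ne_sLeaf h
  · intro u
    rw [labels_stars, List.mem_flatMap]
    rcases graft_cases u with ⟨b, rfl⟩ | ⟨i, rfl⟩ | ⟨p, rfl⟩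
    · right; exact ⟨b, rfl⟩
    · left; exact ⟨i, List.mem_finRange _, List.mem_cons_self⟩
    · left; exact ⟨p.1, List.mem_finRange _, List.mem_cons_of_mem _ (mem_star.2 ⟨p, rfl, rfl⟩)⟩

end graft

end LF

/-! ### Leaves, sorted values, and the weight of a graft -/

namespace LF

open LabelledGraph

section leaf

variable {V : Type*} {G : SimpleGraph V}

lemma isLeaf_iff_length {v : V} {l : List V} (hl : l.Nodup) (h : ∀ u, G.Adj v u ↔ u ∈ l) :
    IsLeaf G v ↔ l.length = 1 := by
  simp only [IsLeaf, h]
  constructor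
  · rintro ⟨u, hu, hu'⟩
    refine List.length_eq_one_iff.2 ⟨u, ?_⟩
    refine (List.perm_singleton.1 ?_)
    exact (List.perm_ext_iff_of_nodup hl (List.nodup_singleton u)).2 fun x =>
      ⟨fun hx => by simp [hu' x hx], fun hx => by rw [List.mem_singleton.1 hx]; exact hu⟩
  · intro h1
    obtain ⟨u, rfl⟩ := List.length_eq_one_iff.1 h1
    exact ⟨u, by simp, fun x hx => by simpa using hx⟩

lemma Good.isLeaf_iff {p : V} {f : LF V} (h : Good G p f) (hn : (p :: labels f).Nodup) :
    ∀ u ∈ labels f, IsLeaf G u ↔ u ∈ lfs f := by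
  induction f generalizing p with
  | nil => simp [labels]
  | cons v c f ih1 ih2 =>
    obtain ⟨h1, h2, h3⟩ := h
    obtain ⟨n1, n2, n3, n4, n5, n6⟩ := nodup_cons_iff.1 hn
    have hv : v ∉ labels c := (List.nodup_cons.1 n2).1
    intro u hu
    have e : u ∈ lfs (cons v c f) ↔ (c = nil ∧ u = v) ∨ u ∈ lfs c ∨ u ∈ lfs f := by
      cases c <;> simp [lfs]
    rw [e]
    simp only [labels, List.mem_cons, List.mem_append] at hu
    rcases hu with rfl | hu | hu
    · rw [isLeaf_iff_length (nodup_nbr hn) fun x => by rw [h1, List.mem_cons], List.length_cons,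
        Nat.add_eq_right, tops_length_eq_zero]
      refine ⟨fun h => Or.inl ⟨h, rfl⟩, ?_⟩
      rintro (h | h | h)
      · exact h.1
      · exact absurd ((lfs_sublist c).subset h) hv
      · exact absurd ((lfs_sublist f).subset h) n5
    · rw [ih1 h2 n2 u hu]
      refine ⟨fun h => Or.inr (Or.inl h), ?_⟩
      rintro (⟨rfl, rfl⟩ | h | h)
      · exact absurd hu hv
      · exact h
      · exact absurd ((lfs_sublist f).subset h) (fun h => n6 hu h)
    · rw [ih2 h3 n1 u hu]
      refine ⟨fun h => Or.inr (Or.inr h), ?_⟩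
      rintro (⟨rfl, rfl⟩ | h | h)
      · exact absurd hu n5
      · exact absurd ((lfs_sublist c).subset h) (fun h => n6 h hu)
      · exact h

/-- A root with at least two neighbours is not a leaf, so all leaves are childless vertices of the
forest. -/
lemma Rep.isLeaf_iff {r : V} {f : LF V} (h : Rep G r f) (h2 : 2 ≤ (tops f).length) (u : V) :
    IsLeaf G u ↔ u ∈ lfs f := by
  obtain ⟨n1, n2⟩ := List.nodup_cons.1 h.nodup
  rcases List.mem_cons.1 (h.cover u) with rfl | hu
  · rw [isLeaf_iff_length (n2.sublist (tops_sublist f)) h.root]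
    refine ⟨fun h => by omega, fun h => absurd ((lfs_sublist f).subset h) n1⟩
  · exact h.good.isLeaf_iff h.nodup u hu

/-- Leaves at vertices with earlier labels have larger values. -/
def SortedBy (G : SimpleGraph V) (L : List V) (y : V → ℝ) : Prop :=
  L.Pairwise fun v v' => ∀ u u', IsLeaf G u → G.Adj v u → IsLeaf G u' → G.Adj v' u' → y u' ≤ y u

/-- The graph `G` is a tree with root `r`, branches `f` and reduced degree sequence `ds`, which is
optimal for all leaf values that are sorted with respect to the list `L` of labelled vertices. -/
structure Opt (G : SimpleGraph V) (L : List V) (ds : List ℕ) (r : V) (f : LF V) : Prop where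
  rep : Rep G r f
  two : 2 ≤ (tops f).length
  dg : ∀ y, (tops f).length ::ₘ Fo.dg (toFo y f) = ds
  nodup : L.Nodup
  cov : ∀ u, IsLeaf G u → ∃ v ∈ L, G.Adj v u
  lb : ∀ y, SortedBy G L y → Fo.Cond ds ((lfs f).map y : List ℝ) 0 →
    Fo.LB ds ((lfs f).map y : List ℝ) (Fo.rv (toFo y f))

end leaf

variable {M : LabelledGraph} {w : M.V} {es : List ℕ}

lemma isLeaf_inl {a : M.V} (ha : a ≠ w) : IsLeaf (graftGraph M w es) (.inl a) ↔ IsLeaf M.graph a := by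
  constructor
  · rintro ⟨u, hu, hu'⟩
    rcases graft_cases u with ⟨b, rfl⟩ | ⟨i, rfl⟩ | ⟨p, rfl⟩
    · refine ⟨b, (adj_inl_inl M w es a b).1 hu, fun c hc => ?_⟩
      exact Sum.inl_injective (hu' (.inl c) ((adj_inl_inl M w es a c).2 hc))
    · exact absurd ((adj_inl_root M w es a i).1 hu) ha
    · exact absurd hu (adj_inl_leaf M w es a p)
  · rintro ⟨b, hb, hb'⟩
    refine ⟨.inl b, (adj_inl_inl M w es a b).2 hb, fun u hu => ?_⟩
    rcases graft_cases u with ⟨c, rfl⟩ | ⟨i, rfl⟩ | ⟨p, rfl⟩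
    · rw [hb' c ((adj_inl_inl M w es a c).1 hu)]
    · exact absurd ((adj_inl_root M w es a i).1 hu) ha
    · exact absurd hu (adj_inl_leaf M w es a p)

lemma isLeaf_sLeaf (p) : IsLeaf (graftGraph M w es) (sLeaf p) := by
  refine ⟨sRoot p.1, (adj_leaf_root M w es _ _).2 rfl, fun u hu => ?_⟩
  rcases graft_cases u with ⟨c, rfl⟩ | ⟨i, rfl⟩ | ⟨p, rfl⟩
  · exact absurd hu (adj_leaf_inl M w es c p)
  · rw [(adj_leaf_root M w es _ _).1 hu]
  · exact absurd hu (adj_leaf_leaf M w es _ _)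

lemma isLeaf_sRoot (i : Fin es.length) :
    IsLeaf (graftGraph M w es) (sRoot i) ↔ ¬ 2 ≤ es.get i := by
  have h1 := (adj_root_inl M w es w i).2 rfl
  constructor
  · rintro ⟨u, hu, hu'⟩ h2
    have := (hu' _ h1).trans (hu' (sLeaf ⟨i, ⟨0, by omega⟩⟩) ((adj_root_leaf M w es _ _).2 rfl)).symm
    exact inl_ne_sLeaf this
  · intro h2
    refine ⟨_, h1, fun u hu => ?_⟩
    rcases graft_cases u with ⟨c, rfl⟩ | ⟨i', rfl⟩ | ⟨p, rfl⟩
    · rw [(adj_root_inl M w es c i).1 hu]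
    · exact absurd hu (adj_root_root M w es _ _)
    · have h3 := p.2.2
      have h4 : p.1 = i := (adj_root_leaf M w es _ _).1 hu
      have h5 : es.get p.1 = es.get i := by rw [h4]
      omega

lemma not_isLeaf_inl (hw : ∃ a, M.graph.Adj w a) (he : es ≠ []) :
    ¬ IsLeaf (graftGraph M w es) (.inl w) := by
  rintro ⟨u, hu, hu'⟩
  obtain ⟨a, ha⟩ := hw
  have := (hu' _ ((adj_inl_inl M w es w a).2 ha)).trans
    (hu' (sRoot ⟨0, List.length_pos_iff.2 he⟩) ((adj_inl_root M w es _ _).2 rfl)).symm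
  exact inl_ne_sRoot this

lemma map_get_filter (es : List ℕ) :
    ((List.finRange es.length).filter fun i => 2 ≤ es.get i).map (fun i => es.get i) =
      es.filter (2 ≤ ·) := by
  conv_rhs => rw [← List.map_get_finRange es, List.filter_map]
  rfl

lemma prod_map_val {I : Type*} (S : I → Multiset ℝ) (l : List I)
    (h : ∀ i ∈ l, ∀ x ∈ S i, 0 < x ∧ x < 1) : (l.map fun i => 8 - 6 * (S i).prod).prod =
      (l.map fun i => 8 - 5 * (S i).prod).prod * (l.map fun i => Fo.val (S i)).prod := by
  rw [← List.prod_map_mul]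
  congr 1
  exact List.map_congr_left fun i hi => (Fo.val_spec (h i hi)).1.symm

open Classical in
-- Two levels of contraction: first each star becomes a leaf with its `Fo.val`, then the merged
-- vertex with these leaves becomes the leaf `w`, whose value under `y₀` is chosen accordingly. The
-- factors are the same as those in `Fo.small_moves` and `Fo.large_move`, so the bound is attained.
lemma graft_values (hes : ∀ i, 2 ≤ es.get i) (he : es ≠ []) {f : LF M.V} (hn : (labels f).Nodup)
    (hw : w ∈ lfs f) {y : M.V ⊕ StarVertices es → ℝ} (hy : ∀ p, 0 < y (sLeaf p) ∧ y (sLeaf p) < 1)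
    {Ss : List (Multiset ℝ)} (hSs : (List.finRange es.length).map (starVals y) = Ss)
    {y₀ : M.V → ℝ} (h0 : ∀ a ≠ w, y₀ a = y (.inl a))
    (hw0 : y₀ w = Fo.val (Ss.map Fo.val : List ℝ)) :
    Fo.rv (toFo y (graftF Sum.inl w (stars M.V es) f)) =
      (Ss.map fun S => 8 - 5 * S.prod).prod * ((8 - 5 * (Ss.map Fo.val).prod) * Fo.rv (toFo y₀ f)) ∧
    Fo.dg (toFo y (graftF Sum.inl w (stars M.V es) f)) =
      (es.length + 1) ::ₘ (es + Fo.dg (toFo y₀ f)) ∧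
    y₀ w ::ₘ Fo.lv (toFo y (graftF Sum.inl w (stars M.V es) f)) =
      Ss.sum + Fo.lv (toFo y₀ f) := by
  obtain ⟨a1, a2, a3, a4⟩ := toFo_stars y (List.finRange es.length)
  have f1 : (List.finRange es.length).filter (fun i => 2 ≤ es.get i) = List.finRange es.length :=
    List.filter_eq_self.2 fun i _ => by simpa only [decide_eq_true_eq] using hes i
  have f2 : (List.finRange es.length).filter (fun i => ¬ 2 ≤ es.get i) = [] :=
    List.filter_eq_nil_iff.2 fun i _ => by simpa only [decide_eq_true_eq, not_not] using hes i
  have hv : ∀ i, ∀ x ∈ starVals y i, 0 < x ∧ x < 1 := by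
    intro i x hx
    obtain ⟨j, rfl⟩ := mem_starVals.1 hx
    exact hy _
  rw [f1] at a1 a2 a3 a4
  rw [f2] at a2 a4
  rw [prod_map_val _ _ fun i _ => hv i] at a2
  have e1 : (List.finRange es.length).map (fun i => 8 - 5 * (starVals y i).prod) =
      Ss.map fun S => 8 - 5 * S.prod := by rw [← hSs, List.map_map]; rfl
  have e2 : (List.finRange es.length).map (fun i => Fo.val (starVals y i)) = Ss.map Fo.val := by
    rw [← hSs, List.map_map]; rfl
  rw [e1] at a1 a2
  rw [e2] at a2
  have hz : ∀ x ∈ ((Ss.map Fo.val : List ℝ) : Multiset ℝ), 0 < x ∧ x < 1 := by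
    intro x hx
    rw [Multiset.mem_coe, ← hSs, List.map_map, List.mem_map] at hx
    obtain ⟨i, _, rfl⟩ := hx
    exact (Fo.val_spec (hv i)).2
  have hspec := (Fo.val_spec hz).1
  rw [Multiset.prod_coe] at hspec
  obtain ⟨b1, b2, b3, b4⟩ := toFo_graftF (ι := Sum.inl) (y := y) (y₀ := y₀) (g := stars M.V es)
    (B := (Ss.map fun S => 8 - 5 * S.prod).prod * (8 - 5 * (Ss.map Fo.val).prod)) hn hw
    (by rw [stars, Ne, branches_eq_nil, ← List.length_eq_zero_iff, List.length_finRange,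
          List.length_eq_zero_iff]; exact he) h0
    (by rw [stars, a1, a2]; simp; ring)
    (by rw [stars, a1, a2, hw0]
        simp only [List.map_nil, List.prod_nil, mul_one]
        linear_combination (-(Ss.map fun S => 8 - 5 * S.prod).prod) * hspec)
  refine ⟨?_, ?_, ?_⟩
  · rw [Fo.rv, Fo.rv, b1, b2]; ring
  · rw [b3, tops_stars, stars, a3, List.map_get_finRange, List.length_map, List.length_finRange]
  · rw [b4, stars, a4, hSs]; simp

end LF

/-! ### Optimality of the M-tree: the recursive step -/

namespace LF

open LabelledGraph

/-- The labelled vertices of `M.graft w es`. -/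
def graftLabels (M : LabelledGraph) (es : List ℕ) : List (M.V ⊕ StarVertices es) :=
  M.labels.map Sum.inl ++ ((List.finRange es.length).filter fun i => 2 ≤ es.get i).map sRoot

variable {M : LabelledGraph} {w : M.V} {es : List ℕ}

lemma nodup_graftLabels (h : M.labels.Nodup) : (graftLabels M es).Nodup := by
  rw [graftLabels, List.nodup_append']
  refine ⟨h.map Sum.inl_injective, ?_, ?_⟩
  · exact ((List.nodup_finRange _).filter _).map fun i i' h => sRoot_inj.1 h
  · intro x hx hx'
    obtain ⟨a, _, rfl⟩ := List.mem_map.1 hx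
    obtain ⟨i, _, h⟩ := List.mem_map.1 hx'
    exact inl_ne_sRoot h.symm

/-- The values at the leaves of the stars are sorted as required for `Fo.small_moves`. -/
lemma SortedBy.stars {y : M.V ⊕ StarVertices es → ℝ}
    (hy : SortedBy (graftGraph M w es) (graftLabels M es) y) (hes : (es.filter (2 ≤ ·)).Pairwise (· ≤ ·)) :
    (((List.finRange es.length).filter fun i => 2 ≤ es.get i).map (starVals y)).Pairwise
      fun S S' => Multiset.card S ≤ Multiset.card S' ∧ ∀ x ∈ S', ∀ y ∈ S, x ≤ y := by
  rw [List.pairwise_map]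
  have h1 := (List.pairwise_append.1 hy).2.1
  rw [List.pairwise_map] at h1
  have h2 : ((List.finRange es.length).filter fun i => 2 ≤ es.get i).Pairwise
      fun i i' => es.get i ≤ es.get i' := by
    rw [← List.pairwise_map, map_get_filter]
    exact hes
  refine h1.imp₂ (fun i i' a b => ⟨?_, ?_⟩) h2
  · rw [card_starVals, card_starVals]; omega
  · intro x hx z hz
    obtain ⟨j, rfl⟩ := mem_starVals.1 hx
    obtain ⟨j', rfl⟩ := mem_starVals.1 hz
    exact a _ _ (isLeaf_sLeaf ⟨i, j'⟩) ((adj_root_leaf M w es _ _).2 rfl)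
      (isLeaf_sLeaf ⟨i', j⟩) ((adj_root_leaf M w es _ _).2 rfl)

lemma card_stars {y : M.V ⊕ StarVertices es → ℝ} (hes : ∀ i, 1 ≤ es.get i)
    (l : List (Fin es.length)) :
    (l.map (starVals y)).map (fun S => Multiset.card S + 1) = l.map fun i => es.get i := by
  rw [List.map_map]
  refine List.map_congr_left fun i _ => ?_
  have := hes i
  simp only [Function.comp, card_starVals]; omega

open Classical in
-- The degrees `es` are the largest, and sortedness puts the smallest leaf values on the new stars,
-- whose labels come last; `Fo.small_moves` shows that nothing is lost by this. The star values are
-- then the large leaves, and `Fo.large_move` attaches them to the vertex of the smallest degree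
-- `d`, the merged vertex. What remains is the problem for `es₁` with one new leaf value at `w`,
-- where the optimality of `M` applies.
lemma opt_graft {d : ℕ} {es₁ : List ℕ} {r : M.V} {f : LF M.V}
    (h : Opt M.graph M.labels es₁ r f) (hs : M.IsSlot w) (hd : 2 ≤ d)
    (hsort : (d :: (es₁ ++ es)).Pairwise (· ≤ ·)) (hlen : es.length + 1 = d) (h1 : es₁ ≠ []) :
    Opt (graftGraph M w es) (graftLabels M es) (d :: (es₁ ++ es)) (.inl r)
      (graftT Sum.inl w (stars M.V es) r f) := by
  obtain ⟨hwl, s, hsw, hmin⟩ := hs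
  have hwf := (h.rep.isLeaf_iff h.two w).1 hwl
  obtain ⟨n1, n2⟩ := List.nodup_cons.1 h.rep.nodup
  have hrw : r ≠ w := fun e => n1 ((lfs_sublist f).subset (e ▸ hwf))
  have eT : graftT Sum.inl w (stars M.V es) r f = graftF Sum.inl w (stars M.V es) f := by
    rw [graftT, if_neg hrw]; rfl
  have hrep := rep_graft (w := w) (es := es) h.rep
  rw [eT] at hrep ⊢
  have htwo : 2 ≤ (tops (graftF Sum.inl w (stars M.V es) f)).length := by
    rw [tops_graftF, List.length_map]; exact h.two
  rw [List.pairwise_cons, List.pairwise_append] at hsort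
  obtain ⟨hdle, hsort1, hsort2, hsort12⟩ := hsort
  have hge : ∀ i, 2 ≤ es.get i := fun i =>
    hd.trans (hdle _ (List.mem_append_right _ (List.get_mem es i)))
  have he : es ≠ [] := by rintro rfl; simp at hlen; omega
  have hfil : ((List.finRange es.length).filter fun i => 2 ≤ es.get i) = List.finRange es.length :=
    List.filter_eq_self.2 fun i _ => by simpa only [decide_eq_true_eq] using hge i
  have eds : ((d :: (es₁ ++ es) : List ℕ) : Multiset ℕ) =
      d ::ₘ ((es : Multiset ℕ) + (es₁ : Multiset ℕ)) := by
    rw [← Multiset.cons_coe, ← Multiset.coe_add, add_comm]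
  refine ⟨hrep, htwo, ?_, nodup_graftLabels h.nodup, ?_, ?_⟩
  -- The inner degrees do not depend on the leaf values, so `graft_values` may be used with the
  -- constant value `1 / 2`, which meets its positivity assumptions.
  · have hc : ∀ y y' : M.V ⊕ StarVertices es → ℝ, Fo.dg (toFo y (graftF Sum.inl w (stars M.V es) f)) =
        Fo.dg (toFo y' (graftF Sum.inl w (stars M.V es) f)) := by
      intro y y'; rw [(toFo_spec y _).2.1, (toFo_spec y' _).2.1]
    intro y
    obtain ⟨y₀, g1, g2⟩ : ∃ y₀ : M.V → ℝ, (∀ a ≠ w, y₀ a = 1 / 2) ∧ y₀ w = Fo.val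
        (((List.finRange es.length).map (starVals (W := M.V) fun _ => 1 / 2)).map Fo.val : List ℝ) :=
      ⟨Function.update (fun _ => 1 / 2) w _, fun a ha => Function.update_of_ne ha _ _, Function.update_self _ _ _⟩
    rw [hc y (fun _ => 1 / 2), (graft_values hge he n2 hwf (by norm_num) rfl g1 g2).2.1,
      tops_graftF, List.length_map, hlen, eds, ← h.dg y₀]
    rw [Multiset.cons_swap, Multiset.add_cons]
  · intro u hu
    rcases graft_cases u with ⟨a, rfl⟩ | ⟨i, rfl⟩ | ⟨p, rfl⟩
    · have ha : a ≠ w := by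
        rintro rfl
        exact not_isLeaf_inl ⟨_, hsw.symm⟩ he hu
      obtain ⟨v, hv, hva⟩ := h.cov a ((isLeaf_inl ha).1 hu)
      exact ⟨.inl v, List.mem_append_left _ (List.mem_map_of_mem hv), (adj_inl_inl M w es v a).2 hva⟩
    · exact absurd (hge i) ((isLeaf_sRoot i).1 hu)
    · refine ⟨sRoot p.1, List.mem_append_right _ (List.mem_map_of_mem ?_),
        (adj_root_leaf M w es _ _).2 rfl⟩
      rw [hfil]; exact List.mem_finRange _
  · intro y hy hC
    obtain ⟨Ss, hSs⟩ : ∃ Ss, (List.finRange es.length).map (starVals y) = Ss := ⟨_, rfl⟩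
    -- The values on the leaves of `M`: unchanged except at `w`, which receives the value of the
    -- whole contracted graft.
    obtain ⟨y₀, g1, g2⟩ : ∃ y₀ : M.V → ℝ, (∀ a ≠ w, y₀ a = y (.inl a)) ∧ y₀ w = Fo.val
        (Ss.map Fo.val : List ℝ) :=
      ⟨Function.update (fun a => y (.inl a)) w _, fun a ha => Function.update_of_ne ha _ _,
        Function.update_self _ _ _⟩
    have hleaf : ∀ u, IsLeaf (graftGraph M w es) u →
        y u ∈ (((lfs (graftF Sum.inl w (stars M.V es) f)).map y : List ℝ) : Multiset ℝ) :=
      fun u hu => List.mem_map_of_mem ((hrep.isLeaf_iff htwo u).1 hu)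
    have hstar : ∀ p, 0 < y (sLeaf p) ∧ y (sLeaf p) < 1 :=
      fun p => hC.ok _ (by rw [add_zero]; exact hleaf _ (isLeaf_sLeaf p))
    obtain ⟨v1, -, v3⟩ := graft_values hge he n2 hwf hstar hSs g1 g2
    have hX : ((lfs f).map y₀ : Multiset ℝ) = y₀ w ::ₘ (((lfs f).erase w).map fun a => y (.inl a) : List ℝ) := by
      rw [Multiset.cons_coe, Multiset.coe_eq_coe]
      refine ((List.perm_cons_erase hwf).map y₀).trans ?_
      rw [List.map_cons]
      refine List.Perm.cons _ (List.Perm.of_eq (List.map_congr_left fun a ha => ?_))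
      exact g1 a ((List.Nodup.mem_erase_iff (n2.sublist (lfs_sublist f))).1 ha).1
    obtain ⟨X, hXd⟩ : ∃ X : Multiset ℝ, X = (((lfs f).erase w).map fun a => y (.inl a) : List ℝ) :=
      ⟨_, rfl⟩
    rw [← hXd] at hX
    rw [(toFo_spec _ _).2.2.2, (toFo_spec _ _).2.2.2, hX, Multiset.add_cons,
      Multiset.cons_inj_right] at v3
    have hXmem : ∀ x ∈ X, ∃ a, a ≠ w ∧ IsLeaf M.graph a ∧ y (.inl a) = x := by
      intro x hx
      rw [hXd, Multiset.mem_coe, List.mem_map] at hx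
      obtain ⟨a, ha, rfl⟩ := hx
      obtain ⟨h1, h2⟩ := (List.Nodup.mem_erase_iff (n2.sublist (lfs_sublist f))).1 ha
      exact ⟨a, h1, (h.rep.isLeaf_iff h.two a).2 h2, rfl⟩
    have hpw := hy.stars (hsort2.filter _)
    rw [hfil, hSs] at hpw
    have hcard : (Ss.map fun S => Multiset.card S + 1) = es := by
      rw [← hSs, card_stars fun i => (hge i).trans' one_le_two]
      exact List.map_get_finRange es
    have hmemS : ∀ S ∈ Ss, ∃ i, S = starVals y i := by
      intro S hS
      rw [← hSs, List.mem_map] at hS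
      obtain ⟨i, _, rfl⟩ := hS
      exact ⟨i, rfl⟩
    rw [eds, ← Multiset.add_cons, v3] at hC ⊢
    rw [← add_zero (Ss.sum + X), v1]
    have hrest : ∀ S ∈ Ss, (∀ e ∈ d ::ₘ (es₁ : Multiset ℕ), e ≤ Multiset.card S + 1) ∧
        ∀ x ∈ S, ∀ z ∈ X, x ≤ z := by
      intro S hS
      obtain ⟨i, rfl⟩ := hmemS S hS
      have hcS : Multiset.card (starVals y i) + 1 = es.get i := by
        have := hge i
        rw [card_starVals]; omega
      refine ⟨fun e he' => ?_, fun x hx z hz => ?_⟩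
      · rw [hcS]
        rcases Multiset.mem_cons.1 he' with rfl | he'
        · exact hdle _ (List.mem_append_right _ (List.get_mem es i))
        · exact hsort12 e he' _ (List.get_mem es i)
      · obtain ⟨j, rfl⟩ := mem_starVals.1 hx
        obtain ⟨a, ha, hal, rfl⟩ := hXmem z hz
        obtain ⟨v, hv, hva⟩ := h.cov a hal
        refine (List.pairwise_append.1 hy).2.2 (.inl v) (List.mem_map_of_mem hv) (sRoot i)
          (List.mem_map_of_mem (by rw [hfil]; exact List.mem_finRange _)) _ _ ((isLeaf_inl ha).2 hal)
          ((adj_inl_inl M w es v a).2 hva) (isLeaf_sLeaf ⟨i, j⟩) ((adj_root_leaf M w es _ _).2 rfl)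
    obtain ⟨c1, c2⟩ := Fo.small_moves (D := d ::ₘ (es₁ : Multiset ℕ)) (Z := 0) (by simp) Ss
      (by rw [hcard]; exact hC) hpw hrest
    rw [hcard] at c2
    have hcz : Multiset.card ((Ss.map Fo.val : List ℝ) : Multiset ℝ) + 1 = d := by
      rw [Multiset.coe_card, List.length_map, ← hlen, ← hcard, List.length_map]
    have hD0 : (es₁ : Multiset ℕ) ≠ 0 := by simpa using h1
    obtain ⟨c3, c4⟩ := Fo.large_move c1 hcz
      (fun e he' => hdle e (List.mem_append_left _ he')) hD0 (by simp)
    -- The new leaf `w` is at least as large as every other remaining leaf, which is why the slot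
    -- must be at the earliest possible label.
    have hval := (c1.val_bounds (S := (Ss.map Fo.val : List ℝ)) (W := X) hcz
      (by rw [add_zero, add_comm]) hD0).1
    rw [← g2] at c3 c4 hval
    rw [← hX] at c3 c4
    refine c2 _ ?_
    rw [Multiset.prod_coe] at c4
    refine c4 _ ?_
    rw [add_zero]
    refine h.lb y₀ ?_ c3
    rw [SortedBy, List.pairwise_iff_getElem]
    intro i j hi hj hij u u' hu hvu hu' hvu'
    have hle : ∀ a, IsLeaf M.graph a → y₀ a ≤ y₀ w := by
      intro a ha
      by_cases haw : a = w
      · rw [haw]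
      · rw [g1 a haw]
        refine hval _ ?_
        rw [hXd, Multiset.mem_coe]
        exact List.mem_map_of_mem (f := fun a => y (.inl a)) ((List.mem_erase_of_ne haw).2
          ((h.rep.isLeaf_iff h.two a).1 ha))
    by_cases huw : u = w
    · rw [huw]; exact hle u' hu'
    · by_cases huw' : u' = w
      -- Here `w` would hang at a later label than another leaf `u`. But `w` has `v_s` as its only
      -- neighbour, and by minimality of `s` no earlier label has a leaf.
      · exfalso
        subst huw'
        have hsi : (s : ℕ) ≤ i := by
          by_contra! hlt
          exact hmin ⟨i, hi⟩ hlt u hvu hu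
        have heq : M.labels[j] = M.labels[(s : ℕ)] :=
          hwl.unique hvu'.symm hsw.symm
        have := (List.Nodup.getElem_inj_iff h.nodup).1 heq
        omega
      · rw [g1 u huw, g1 u' huw']
        have hp := (List.pairwise_append.1 hy).1
        rw [List.pairwise_map, List.pairwise_iff_getElem] at hp
        exact hp i j hi hj hij _ _ ((isLeaf_inl huw).2 hu) ((adj_inl_inl M w es _ _).2 hvu)
          ((isLeaf_inl huw').2 hu') ((adj_inl_inl M w es _ _).2 hvu')

end LF

/-! ### Optimality of the M-tree: base case and induction -/

namespace LF

open LabelledGraph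

/-- The vertex of `LabelledGraph.point`. -/
def center : point.V := ()

lemma rep_point : Rep point.graph center nil where
  nodup := List.nodup_singleton _
  cover _ := List.mem_singleton.2 rfl
  root u := ⟨fun h => False.elim h, fun h => by simp [tops] at h⟩
  good := trivial

lemma graftT_nil {V V' : Type*} [DecidableEq V] (ι : V → V') (w : V) (g : LF V') :
    graftT ι w g w nil = g := by
  rw [graftT, if_pos rfl, graftF, append_nil]

open Classical in
lemma rep_star (es : List ℕ) :
    Rep (graftGraph point center es) (.inl center) (stars point.V es) := by
  have := rep_graft (w := center) (es := es) rep_point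
  simpa only [graftT_nil] using this

/-- The list `es'` is `es` padded with stars `[1]`, which are leaves at the root. The root has the
first label, so these leaves have the largest values and are left over when `Fo.small_moves` has
served all the stars; only the degree `d` remains, and `Fo.LB_single` finishes. -/
lemma opt_base {d : ℕ} {es es' : List ℕ} (hd : 2 ≤ d)
    (hsort : (d :: es).Pairwise (· ≤ ·)) (hes : es'.filter (2 ≤ ·) = es) (hlen : es'.length = d) :
    Opt (graftGraph point center es') (graftLabels point es') (d :: es) (.inl center)
      (stars point.V es') := by
  have hrep := rep_star es'
  have htwo : 2 ≤ (tops (stars point.V es')).length := by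
    rw [tops_stars, List.length_map, List.length_finRange, hlen]; exact hd
  have hlab : graftLabels point es' = .inl center ::
      ((List.finRange es'.length).filter fun i => 2 ≤ es'.get i).map sRoot := rfl
  have hinl : ¬ IsLeaf (graftGraph point center es') (.inl center) := by
    rw [isLeaf_iff_length (hrep.nodup.of_cons.sublist (tops_sublist _)) hrep.root]
    omega
  rw [List.pairwise_cons] at hsort
  refine ⟨hrep, htwo, fun y => ?_, nodup_graftLabels (List.nodup_singleton _), ?_, ?_⟩
  · rw [stars, (toFo_stars y _).2.2.1, map_get_filter, hes, ← stars, tops_stars, List.length_map,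
      List.length_finRange, hlen, Multiset.cons_coe]
  · intro u hu
    rcases graft_cases u with ⟨a, rfl⟩ | ⟨i, rfl⟩ | ⟨p, rfl⟩
    · exact absurd hu hinl
    · exact ⟨.inl center, by rw [hlab]; exact List.mem_cons_self, (adj_inl_root _ _ _ _ _).2 rfl⟩
    · refine ⟨sRoot p.1, List.mem_append_right _ (List.mem_map_of_mem ?_),
        (adj_root_leaf _ _ _ _ _).2 rfl⟩
      rw [List.mem_filter]
      refine ⟨List.mem_finRange _, ?_⟩
      have := p.2.2
      simp only [decide_eq_true_eq]; omega
  · intro y hy hC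
    obtain ⟨a1, a2, a3, a4⟩ := toFo_stars (W := point.V) y (List.finRange es'.length)
    rw [← stars] at a1 a2 a4
    rw [← (toFo_spec _ _).2.2.2] at hC ⊢
    have hv : ∀ i, 2 ≤ es'.get i → ∀ x ∈ starVals y i, 0 < x ∧ x < 1 := by
      intro i hi x hx
      refine hC.ok x ?_
      rw [add_zero, a4]
      refine Multiset.mem_add.2 (Or.inl ?_)
      exact Multiset.mem_of_le (List.single_le_sum (fun _ _ => Multiset.zero_le _) _ (List.mem_map_of_mem (List.mem_filter.2 ⟨List.mem_finRange _, by simpa using hi⟩))) hx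
    rw [prod_map_val _ _ fun i hi => hv i (by simpa using (List.mem_filter.1 hi).2)] at a2
    obtain ⟨Ss, hSs⟩ : ∃ Ss, ((List.finRange es'.length).filter fun i => 2 ≤ es'.get i).map
      (starVals y) = Ss := ⟨_, rfl⟩
    obtain ⟨X, hX⟩ : ∃ X : List ℝ, ((List.finRange es'.length).filter fun i => ¬ 2 ≤ es'.get i).map
      (fun i => y (sRoot i)) = X := ⟨_, rfl⟩
    have e1 : ((List.finRange es'.length).filter fun i => 2 ≤ es'.get i).map
        (fun i => 8 - 5 * (starVals y i).prod) = Ss.map fun S => 8 - 5 * S.prod := by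
      rw [← hSs, List.map_map]; rfl
    have e2 : ((List.finRange es'.length).filter fun i => 2 ≤ es'.get i).map
        (fun i => Fo.val (starVals y i)) = Ss.map Fo.val := by rw [← hSs, List.map_map]; rfl
    rw [e1] at a1 a2
    rw [e2, hX] at a2
    rw [hSs, hX] at a4
    have hpw := hy.stars (by rw [hes]; exact hsort.2)
    rw [hSs] at hpw
    have hcard : (Ss.map fun S => Multiset.card S + 1) = es := by
      rw [← hSs, List.map_map, ← hes, ← map_get_filter]
      refine List.map_congr_left fun i hi => ?_
      have : 2 ≤ es'.get i := by simpa using (List.mem_filter.1 hi).2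
      simp only [Function.comp, card_starVals]; omega
    have eds : ((d :: es : List ℕ) : Multiset ℕ) = (es : Multiset ℕ) + {d} := by
      rw [add_comm, Multiset.singleton_add, Multiset.cons_coe]
    rw [a4, eds] at hC ⊢
    have hrest : ∀ S ∈ Ss, (∀ e ∈ ({d} : Multiset ℕ), e ≤ Multiset.card S + 1) ∧
        ∀ x ∈ S, ∀ z ∈ (X : Multiset ℝ), x ≤ z := by
      intro S hS
      refine ⟨fun e he => ?_, ?_⟩
      · rw [Multiset.mem_singleton.1 he]
        refine hsort.1 _ ?_
        rw [← hcard]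
        exact List.mem_map_of_mem (f := fun S => Multiset.card S + 1) hS
      · rw [← hSs, List.mem_map] at hS
        obtain ⟨i, hi, rfl⟩ := hS
        intro x hx z hz
        obtain ⟨j, rfl⟩ := mem_starVals.1 hx
        rw [Multiset.mem_coe, ← hX, List.mem_map] at hz
        obtain ⟨i', hi', rfl⟩ := hz
        rw [SortedBy, hlab, List.pairwise_cons] at hy
        exact hy.1 _ (List.mem_map_of_mem hi) _ _
          ((isLeaf_sRoot _).2 (by simpa using (List.mem_filter.1 hi').2))
          ((adj_inl_root _ _ _ _ _).2 rfl) (isLeaf_sLeaf ⟨i, j⟩) ((adj_root_leaf _ _ _ _ _).2 rfl)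
    obtain ⟨c1, c2⟩ := Fo.small_moves (D := {d}) (Z := 0) (by simp) Ss
      (by rw [hcard]; exact hC) hpw hrest
    rw [hcard, add_zero] at c2
    have c3 := c2 _ Fo.LB_single
    convert c3 using 1
    · rw [add_zero]
    · rw [Fo.rv, a1, a2, Multiset.prod_add, Multiset.prod_coe, Multiset.prod_coe]
      ring

lemma Opt.exists_isSlot {M : LabelledGraph} {ds : List ℕ} {r : M.V} {f : LF M.V}
    (h : Opt M.graph M.labels ds r f) : ∃ w, M.IsSlot w := by
  have hf : lfs f ≠ [] := by
    have : ∀ f : LF M.V, f ≠ nil → lfs f ≠ [] := by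
      intro f
      induction f with
      | nil => simp
      | cons v c f ih1 _ => cases c with
        | nil => simp [lfs]
        | cons u c g => simp [lfs_cons, ih1]
    refine this f ?_
    rintro rfl
    have := h.two
    simp [tops] at this
  obtain ⟨u, hu⟩ := List.exists_mem_of_ne_nil _ hf
  have hu := (h.rep.isLeaf_iff h.two u).2 hu
  obtain ⟨v, hv, hvu⟩ := h.cov u hu
  obtain ⟨s, hs⟩ := List.get_of_mem hv
  obtain ⟨m, ⟨w, hw, hmw⟩, hm⟩ := WellFounded.has_min (wellFounded_lt (α := Fin M.labels.length))
    {s | ∃ u, IsLeaf M.graph u ∧ M.graph.Adj (M.labels.get s) u} ⟨s, u, hu, hs ▸ hvu⟩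
  exact ⟨w, hw, m, hmw, fun r hr u hru hu => hm r ⟨u, hu, hru⟩ hr⟩

lemma exists_opt (n : ℕ) : ∀ ds : List ℕ, ds.length = n → ds ≠ [] → ds.Pairwise (· ≤ ·) →
    (∀ d ∈ ds, 2 ≤ d) →
    ∃ r f, Opt (mTreeReduced ds).graph (mTreeReduced ds).labels ds r f := by
  induction n using Nat.strong_induction_on with
  | _ n ih =>
    rintro (_ | ⟨d, es⟩) hn hne hsort h2
    · exact absurd rfl hne
    have hd := h2 d List.mem_cons_self
    obtain ⟨M, hM⟩ : ∃ M, mTreeReduced (d :: es) = M := ⟨_, rfl⟩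
    rw [hM]
    rw [mTreeReduced] at hM
    by_cases hle : es.length ≤ d
    · rw [if_pos hle] at hM
      subst hM
      refine ⟨_, _, opt_base hd hsort ?_ ?_⟩
      · rw [List.filter_append, List.filter_eq_self.2 fun e he => by
          simpa using h2 e (List.mem_cons_of_mem _ he)]
        simp
      · simp; omega
    · rw [if_neg hle] at hM
      -- The list is in increasing order, so dropping all but the last `d - 1` entries isolates the
      -- `d - 1` largest degrees.
      obtain ⟨es₁, he₁⟩ : ∃ l, es.take (es.length - (d - 1)) = l := ⟨_, rfl⟩
      obtain ⟨es₂, he₂⟩ : ∃ l, es.drop (es.length - (d - 1)) = l := ⟨_, rfl⟩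
      have hes : es = es₁ ++ es₂ := by rw [← he₁, ← he₂, List.take_append_drop]
      have hl₁ : es₁.length = es.length - (d - 1) := by rw [← he₁, List.length_take]; omega
      have hl₂ : es₂.length + 1 = d := by rw [← he₂, List.length_drop]; omega
      have hne₁ : es₁ ≠ [] := by rintro rfl; simp at hl₁; omega
      rw [he₁, he₂] at hM
      have hsub : List.Sublist es₁ (d :: es) := by
        rw [hes]; exact (List.sublist_append_left _ _).cons _
      obtain ⟨r, f, h⟩ := ih es₁.length (by rw [← hn, List.length_cons]; omega) es₁ rfl hne₁
        (hsort.sublist hsub) fun e he => h2 e (hsub.subset he)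
      have hs := h.exists_isSlot
      rw [graftAtSlot, dif_pos hs] at hM
      subst hM hes
      exact ⟨_, _, opt_graft h hs.choose_spec hd hsort hl₂ hne₁⟩

end LF

/-! ### Degree sequences and the main theorem -/

namespace LF

lemma degreeSequence_congr {V W : Type*} [Fintype V] [Fintype W] {G : SimpleGraph V}
    {H : SimpleGraph W} (h : (degreeSequence G : Multiset ℕ) = degreeSequence H) :
    degreeSequence G = degreeSequence H := by
  simp only [degreeSequence, Multiset.sort_eq] at h ⊢
  rw [h]

/-- The sum condition is the handshake lemma for trees. It determines the number of entries equal to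
`1` from the entries that are at least `2`. -/
lemma eq_of_filter_eq {A B : Multiset ℕ} (hA : ∀ d ∈ A, 1 ≤ d) (hB : ∀ d ∈ B, 1 ≤ d)
    (sA : A.sum + 2 = 2 * Multiset.card A) (sB : B.sum + 2 = 2 * Multiset.card B)
    (h : A.filter (2 ≤ ·) = B.filter (2 ≤ ·)) : A = B := by
  have key : ∀ C : Multiset ℕ, (∀ d ∈ C, 1 ≤ d) →
      C = C.filter (2 ≤ ·) + Multiset.replicate (Multiset.card (C.filter fun d => ¬ 2 ≤ d)) 1 := by
    intro C hC
    conv_lhs => rw [← Multiset.filter_add_not (2 ≤ ·) C]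
    congr 1
    refine Multiset.eq_replicate_card.2 fun d hd => ?_
    have := hC d (Multiset.mem_of_mem_filter hd)
    have := (Multiset.mem_filter.1 hd).2
    omega
  have kA := key A hA
  have kB := key B hB
  rw [h] at kA
  rw [kA, Multiset.sum_add, Multiset.card_add, Multiset.sum_replicate, Multiset.card_replicate] at sA
  rw [kB, Multiset.sum_add, Multiset.card_add, Multiset.sum_replicate, Multiset.card_replicate] at sB
  have hc : Multiset.card (A.filter fun d => ¬ 2 ≤ d) = Multiset.card (B.filter fun d => ¬ 2 ≤ d) := by
    simp only [smul_eq_mul, mul_one] at sA sB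
    omega
  rw [hc] at kA
  exact kA.trans kB.symm

variable {V : Type*} [Fintype V] {G : SimpleGraph V} {r : V} {f : LF V} {D : List ℕ}

lemma Rep.sum_degreeSequence (h : Rep G r f) :
    (_root_.degreeSequence G : Multiset ℕ).sum + 2 = 2 * Multiset.card (_root_.degreeSequence G : Multiset ℕ) := by
  rw [h.degreeSequence, Multiset.sum_coe, List.sum_cons, degs_sum, Multiset.coe_card,
    List.length_cons, degs_length]
  ring

lemma Rep.pos_degreeSequence (h : Rep G r f) (hf : f ≠ nil) :
    ∀ d ∈ (_root_.degreeSequence G : Multiset ℕ), 1 ≤ d := by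
  rw [h.degreeSequence]
  intro d hd
  rcases List.mem_cons.1 (Multiset.mem_coe.1 hd) with rfl | hd
  · exact Nat.one_le_iff_ne_zero.2 fun h => hf (tops_length_eq_zero.1 h)
  · exact degs_pos f d hd

lemma Rep.star (h : Rep G r f) (hD : _root_.degreeSequence G = D) (hs : D.filter (2 ≤ ·) = []) :
    (f = nil ∧ D.length = 1) ∨ ∃ v, f = cons v nil nil ∧ D.length = 2 := by
  have h1 := h.degreeSequence
  rw [hD, Multiset.coe_eq_coe] at h1
  have h2 : ∀ d ∈ (tops f).length :: degs f, d ≤ 1 := by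
    intro d hd
    have := List.filter_eq_nil_iff.1 hs d (h1.mem_iff.2 hd)
    simp only [decide_eq_true_eq] at this
    omega
  have h3 := h1.length_eq
  cases f with
  | nil => exact Or.inl ⟨rfl, h3⟩
  | cons v c f =>
    have a1 := h2 _ List.mem_cons_self
    have a2 := h2 _ (List.mem_cons_of_mem _ (by rw [degs]; exact List.mem_cons_self))
    rw [tops, List.length_cons, add_le_iff_nonpos_left, Nat.le_zero, tops_length_eq_zero] at a1
    rw [add_le_iff_nonpos_left, Nat.le_zero, tops_length_eq_zero] at a2
    subst a1 a2
    exact Or.inr ⟨v, rfl, h3⟩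

open Classical in
lemma exists_rep_two (hG : G.IsTree) (hD : ∃ d ∈ _root_.degreeSequence G, 2 ≤ d) :
    ∃ r f, Rep G r f ∧ 2 ≤ (tops f).length := by
  obtain ⟨d, hd, h2⟩ := hD
  rw [degreeSequence, Multiset.mem_sort, Multiset.mem_map] at hd
  obtain ⟨r, _, rfl⟩ := hd
  obtain ⟨f, hf⟩ := exists_rep _ G hG rfl r
  refine ⟨r, f, hf, ?_⟩
  rwa [degree_eq ((List.nodup_cons.1 hf.nodup).2.sublist (tops_sublist f)) hf.root] at h2

lemma Rep.reduced (h : Rep G r f) (h2 : 2 ≤ (tops f).length) (hD : _root_.degreeSequence G = D)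
    (y : V → ℝ) : (tops f).length ::ₘ Fo.dg (toFo y f) = (D.filter (2 ≤ ·) : List ℕ) ∧
      (lfs f).length = D.count 1 := by
  have h1 := h.degreeSequence
  rw [hD] at h1
  constructor
  · rw [(toFo_spec y f).2.1, ← Multiset.filter_coe, ← Multiset.filter_coe, h1, ← Multiset.cons_coe,
      Multiset.filter_cons_of_pos _ h2]
  · rw [(Multiset.coe_eq_coe.1 h1).count_eq, List.count_cons_of_ne (by omega), count_one_degs]

lemma Rep.solvability_eq (h : Rep G r f) :
    (_root_.solvability G : ℝ) = 3 ^ (lfs f).length * Fo.rv (toFo (fun _ => 2 / 3) f) := by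
  have h1 : (_root_.solvability G : ℝ) = ((8 * (cnt f).1 - 5 * (cnt f).2 : ℤ) : ℝ) := by
    rw [← h.solvability]; simp
  rw [h1, Fo.rv]
  push_cast
  rw [(cnt_eq f).1, (cnt_eq f).2]
  ring

end LF

open LF in
theorem mainTheorem7 (D : List ℕ) (hD : IsTreeDegreeSequence D) :
    (mTree D).graph.IsTree ∧ degreeSequence (mTree D).graph = D ∧
      ∀ {V : Type*} [Fintype V] (T : SimpleGraph V), T.IsTree → degreeSequence T = D →
        solvability (mTree D).graph ≤ solvability T := by
  obtain ⟨n, T₀, hT₀, hD₀⟩ := hD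
  obtain ⟨M, hM⟩ : ∃ M, mTree D = M := ⟨_, rfl⟩
  rw [hM]
  rw [mTree] at hM
  by_cases hs : D.filter (fun d => 2 ≤ d) = []
  · rw [if_pos hs] at hM
    subst hM
    obtain ⟨r₀⟩ := hT₀.1.nonempty
    obtain ⟨f₀, h₀⟩ := exists_rep _ T₀ hT₀ rfl r₀
    -- Without degrees of at least `2` the sequence has length one or two, so the default star has
    -- no leaf or one leaf.
    have key : ∃ g, Rep (LabelledGraph.point.graft () (List.replicate (D.length - 1) 1)).graph
        (.inl ()) g ∧ ((g = nil ∧ D.length = 1) ∨ ∃ v, g = cons v nil nil ∧ D.length = 2) := by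
      refine ⟨_, rep_star _, ?_⟩
      rcases h₀.star hD₀ hs with ⟨_, h⟩ | ⟨v, _, h⟩
      · left; rw [h]; exact ⟨rfl, rfl⟩
      · right; rw [h]; exact ⟨_, rfl, rfl⟩
    obtain ⟨g, hg, hg'⟩ := key
    refine ⟨hg.isTree, ?_, ?_⟩
    · refine (degreeSequence_congr ?_).trans hD₀
      rw [hg.degreeSequence, h₀.degreeSequence]
      rcases h₀.star hD₀ hs with ⟨rfl, h⟩ | ⟨v, rfl, h⟩ <;>
      rcases hg' with ⟨rfl, h'⟩ | ⟨v', rfl, h'⟩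
      · rfl
      · omega
      · omega
      · rfl
    · intro V _ T hT hTD
      obtain ⟨r⟩ := hT.1.nonempty
      obtain ⟨f, h⟩ := exists_rep _ T hT rfl r
      have e1 := hg.solvability
      have e2 := h.solvability
      have e3 : cnt g = cnt f := by
        rcases h.star hTD hs with ⟨rfl, h⟩ | ⟨v, rfl, h⟩ <;>
        rcases hg' with ⟨rfl, h'⟩ | ⟨v', rfl, h'⟩
        · rfl
        · omega
        · omega
        · rfl
      rw [e3, ← e2] at e1
      exact_mod_cast e1.le
  · rw [if_neg hs] at hM
    subst hM
    obtain ⟨ds, hds⟩ : ∃ ds, (D.filter fun d => 2 ≤ d).reverse = ds := ⟨_, rfl⟩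
    rw [hds]
    have hds' : ((D.filter fun d => 2 ≤ d : List ℕ) : Multiset ℕ) = ds := by
      rw [← hds, Multiset.coe_reverse]
    have hsort : ds.Pairwise (· ≤ ·) := by
      rw [← hds, List.pairwise_reverse]
      refine List.Pairwise.filter _ ?_
      rw [← hD₀, degreeSequence]
      exact Multiset.pairwise_sort _ _
    obtain ⟨r, f, h⟩ := exists_opt _ ds rfl (by rw [← hds]; simpa using hs) hsort fun d hd => by
      rw [← hds, List.mem_reverse, List.mem_filter] at hd
      simpa using hd.2
    have htwo : ∃ d ∈ D, 2 ≤ d := by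
      obtain ⟨d, hd⟩ := List.exists_mem_of_ne_nil _ hs
      exact ⟨d, (List.mem_filter.1 hd).1, by simpa using (List.mem_filter.1 hd).2⟩
    -- `Opt` controls only the degrees that are at least `2`; the number of leaves follows by
    -- comparison with the given tree `T₀`.
    have hdeg : degreeSequence (mTreeReduced ds).graph = D := by
      obtain ⟨r₀, f₀, h₀, h2⟩ := exists_rep_two hT₀ (by rwa [hD₀])
      rw [← hD₀]
      have ne : ∀ {W : Type} {f : LF W}, 2 ≤ (tops f).length → f ≠ nil := by
        rintro W f hf rfl
        simp [tops] at hf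
      refine degreeSequence_congr (eq_of_filter_eq (h.rep.pos_degreeSequence (ne h.two))
        (h₀.pos_degreeSequence (ne h2)) h.rep.sum_degreeSequence h₀.sum_degreeSequence ?_)
      rw [Multiset.filter_coe, Multiset.filter_coe, hD₀, hds',
        ← (h.rep.reduced h.two rfl fun _ => 0).1, h.dg]
    refine ⟨h.rep.isTree, hdeg, fun {V} _ T hT hTD => ?_⟩
    obtain ⟨r', f', h', h2'⟩ := exists_rep_two hT (by rwa [hTD])
    have e := (h.rep.reduced h.two hdeg fun _ => 0).2
    have e' := h'.reduced h2' hTD fun _ => 2 / 3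
    -- Constant values are sorted for any labelling, and they satisfy the invariant with all leaves
    -- small.
    have hlb := h.lb (fun _ => 2 / 3) (List.pairwise_of_forall fun _ _ _ _ _ _ _ _ => le_rfl) (by
      rw [List.map_const', Multiset.coe_replicate]
      exact Fo.cond_initial _ _)
    obtain ⟨s1, s2, s3, s4⟩ := toFo_spec (fun _ => (2 / 3 : ℝ)) f'
    have hle := hlb (toFo (fun _ => 2 / 3) f') (by rw [s1, e'.1, hds']) s3 (by
      rw [s4, List.map_const', List.map_const', e, e'.2])
    have := h.rep.solvability_eq
    have := h'.solvability_eq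
    rw [e'.2, ← e] at this
    have hle' : (solvability (mTreeReduced ds).graph : ℝ) ≤ solvability T := by
      rw [this, h.rep.solvability_eq]
      exact mul_le_mul_of_nonneg_left hle (by positivity)
    exact_mod_cast hle'
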